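/- **Theorem (Berry–Esseen bound for the single-split semi-supervised U-statistic).** Let $P_{XY}$ be a probability distribution on a product $\mathcal X\times\mathcal Y$ of measurable spaces, $(X,Y)\sim P_{XY}$, and let $P_X$ and $P_Y$ be its marginals. Let $r\ge 1$, let $\ell:\mathcal Y^r\to\mathbb R$ be measurable and symmetric in its arguments, and let $Y_1,\dots,Y_r$ be i.i.d. from $P_Y$. Put $$\psi=\mathbb E\{\ell(Y_1,\dots,Y_r)\},\quad \sigma_\ell^2=\mathrm{Var}\{\ell(Y_1,\dots,Y_r)\},\quad \ell_1(y)=\mathbb E\{\ell(Y_1,\dots,Y_r)\mid Y_1=y\},$$ $$\psi_1(x)=\mathbb E\{\ell_1(Y)\mid X=x\},\quad \sigma_1^2=\mathbb E[\mathrm{Var}\{\ell_1(Y)\mid X\}],\quad M_{p,\ell_1}=\mathbb E\{|\ell_1(Y)-\mathbb E[\ell_1(Y)]|^p\}.$$ Assume $\sigma_\ell^2<\infty$ and $\sigma_1^2>0$. Let $n>r$ and $m\ge 0$ be integers, and let $\mathcal D_{XY}=\{(X_i,Y_i)\}_{i=1}^n$ be i.i.d. from $P_{XY}$ and $\mathcal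 D_X=\{X_i\}_{i=n+1}^{n+m}$ i.i.d. from $P_X$, with $\mathcal D_{XY}$ and $\mathcal D_X$ independent. Let $\widehat f:\mathcal X\to\mathbb R$ be a (random) function trained on auxiliary data independent of $\mathcal D_{XY}\cup\mathcal D_X$ (with $\widehat f(x)$ jointly measurable in the auxiliary data and $x$), and define the single-split estimator $$U_{\mathrm{single}}=\binom nr^{-1}\sum_{1\le i_1<\dots<i_r\le n}\ell(Y_{i_1},\dots,Y_{i_r})-\frac rn\sum_{i=1}^n\widehat f(X_i)+\frac r{n+m}\sum_{i=1}^{n+m}\widehat f(X_i).$$ With $X\sim P_X$ independent of $\widehat f$, let $M_{p,\widehat f}=\mathbb E[|\widehat f(X)-\mathbb E\{\widehat f(X)\mid\widehat f\}|^p]\in[0,\infty]$ and $$\Lambda_{n,m,\widehat f}=r^2\,\mathrm{Var}\{\ell_1(Y)\}+\frac{r^2m}{n+m}\Bigl[\mathrm{Var}\{\widehat f(X)\mid\widehat f\}-2\,\mathrm{Cov}\{\widehat f(X),\psi_1(X)\mid\widehat f\}\Bigr].$$ Then there exists a constant $C_r>0$ depending only on $r$ such that $$\sup_{t\in\mathbb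 R}\left|\mathbb P\left\{\frac{\sqrt n\,(U_{\mathrm{single}}-\psi)}{\sqrt{\Lambda_{n,m,\widehat f}}}\le t\right\}-\Phi(t)\right|\le C_r\left\{\frac{M_{3,\ell_1}+M_{3,\widehat f}}{\sqrt n\,\sigma_1^3}+\frac{(M_{2,\ell_1}^{1/2}+M_{2,\widehat f}^{1/2}+\sigma_1)\,\sigma_\ell}{\sqrt{n-r}\,\sigma_1^2}\right\},$$ where $\Phi$ is the standard normal distribution function (the bound being trivial if a moment on the right-hand side is infinite). -/

import Mathlib

open MeasureTheory ProbabilityTheory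
open scoped ENNReal NNReal

universe u v w z

namespace SemiSup

noncomputable section

variable {𝒳 : Type u} {𝒴 : Type v} [MeasurableSpace 𝒳] [MeasurableSpace 𝒴] {r : ℕ}

/-- The kernel is symmetric in its arguments. -/
def SymmetricKernel (ℓ : (Fin r → 𝒴) → ℝ) : Prop :=
  ∀ (π : Equiv.Perm (Fin r)) (y : Fin r → 𝒴), ℓ (fun k => y (π k)) = ℓ y

/-! Below, `P` is the joint law of `(X, Y)`; `P.fst` is the law of `X`, `P.snd` the law of `Y`. -/

/-- The law of `(Y₁, …, Y_r)`, i.i.d. with the law of `Y`. -/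
def lawYs (r : ℕ) (P : Measure (𝒳 × 𝒴)) : Measure (Fin r → 𝒴) :=
  Measure.pi fun _ => P.snd

/-- `ψ = E ℓ(Y₁, …, Y_r)`. -/
def psi (ℓ : (Fin r → 𝒴) → ℝ) (P : Measure (𝒳 × 𝒴)) : ℝ :=
  ∫ y, ℓ y ∂(lawYs r P)

/-- `σ_ℓ = √Var ℓ(Y₁, …, Y_r)`. -/
def sigmaL (ℓ : (Fin r → 𝒴) → ℝ) (P : Measure (𝒳 × 𝒴)) : ℝ :=
  √(Var[ℓ; lawYs r P])

/-- `ℓ₁(y) = E{ℓ(Y₁, Y₂, …, Y_r) | Y₁ = y} = E ℓ(y, Y₂, …, Y_r)`: the first argument is set to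
`y`, the others are integrated out. -/
def ell1 [NeZero r] (ℓ : (Fin r → 𝒴) → ℝ) (P : Measure (𝒳 × 𝒴)) (y : 𝒴) : ℝ :=
  ∫ v, ℓ (Function.update v 0 y) ∂(lawYs r P)

/-- The σ-algebra generated by `X` on the space of the pairs `(X, Y)`. -/
abbrev sigmaX (𝒳 : Type u) (𝒴 : Type v) [MeasurableSpace 𝒳] : MeasurableSpace (𝒳 × 𝒴) :=
  MeasurableSpace.comap Prod.fst inferInstance

/-- The random variable `ψ₁(X) = E{ℓ₁(Y) | X}`. -/
def psi1X [NeZero r] (ℓ : (Fin r → 𝒴) → ℝ) (P : Measure (𝒳 × 𝒴)) : 𝒳 × 𝒴 → ℝ :=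
  P[fun p => ell1 ℓ P p.2 | sigmaX 𝒳 𝒴]

/-- `σ₁² = E[Var{ℓ₁(Y) | X}]`. -/
def sigma1Sq [NeZero r] (ℓ : (Fin r → 𝒴) → ℝ) (P : Measure (𝒳 × 𝒴)) : ℝ :=
  ∫ p, (Var[fun p : 𝒳 × 𝒴 => ell1 ℓ P p.2; P | sigmaX 𝒳 𝒴]) p ∂P

/-- `σ₁`, the nonnegative square root of `σ₁²`. -/
def sigma1 [NeZero r] (ℓ : (Fin r → 𝒴) → ℝ) (P : Measure (𝒳 × 𝒴)) : ℝ :=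
  √(sigma1Sq ℓ P)

/-- `M_{p,ℓ₁} = E|ℓ₁(Y) - E ℓ₁(Y)|^p`, in `[0, ∞]`. -/
def momentEll1 [NeZero r] (p : ℕ) (ℓ : (Fin r → 𝒴) → ℝ) (P : Measure (𝒳 × 𝒴)) : ℝ≥0∞ :=
  ∫⁻ y, ‖ell1 ℓ P y - ∫ y', ell1 ℓ P y' ∂P.snd‖ₑ ^ p ∂P.snd

/-- `Λ_{n,m,f} = r² Var ℓ₁(Y) + (r² m / (n + m)) [Var f(X) - 2 Cov{f(X), ψ₁(X)}]`
for a fixed function `f`. -/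
def Lam [NeZero r] (n m : ℕ) (ℓ : (Fin r → 𝒴) → ℝ) (P : Measure (𝒳 × 𝒴)) (f : 𝒳 → ℝ) : ℝ :=
  (r : ℝ) ^ 2 * Var[fun p : 𝒳 × 𝒴 => ell1 ℓ P p.2; P]
    + (r : ℝ) ^ 2 * m / (n + m) *
      (Var[fun p : 𝒳 × 𝒴 => f p.1; P]
        - 2 * cov[fun p : 𝒳 × 𝒴 => f p.1, psi1X ℓ P; P])

/-- `M_{p,f̂} = E|f̂(X) - E{f̂(X) | f̂}|^p`, in `[0, ∞]`, for a random function `f̂` on a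
probability space `(Ω, μ)` and `X` independent of it: as `X` is independent of `f̂`, conditioning
on `f̂` is integrating over the law of `X` with the function held fixed. -/
def momentF {Ω : Type w} [MeasurableSpace Ω] (p : ℕ) (μ : Measure Ω)
    (fhat : Ω → 𝒳 → ℝ) (P : Measure (𝒳 × 𝒴)) : ℝ≥0∞ :=
  ∫⁻ ω, ∫⁻ x, ‖fhat ω x - ∫ x', fhat ω x' ∂P.fst‖ₑ ^ p ∂P.fst ∂μ

open Classical in
/-- The U-statistic: the average of `ℓ(y_{i₁}, …, y_{i_r})` over all `i₁ < … < i_r`. -/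
def uStat {n : ℕ} (ℓ : (Fin r → 𝒴) → ℝ) (y : Fin n → 𝒴) : ℝ :=
  ((n.choose r : ℕ) : ℝ)⁻¹ *
    ∑ i : Fin r → Fin n with StrictMono i, ℓ (fun k => y (i k))

/-- The semi-supervised U-statistic with assistant function `f`, on the labeled sample
`(x₁, y₁), …, (x_n, y_n)` and the unlabeled sample `x_{n+1}, …, x_{n+m}`:
`U - (r/n) ∑_{i ≤ n} f(x_i) + (r/(n+m)) ∑_{i ≤ n+m} f(x_i)`. -/
def uSemi {n m : ℕ} (ℓ : (Fin r → 𝒴) → ℝ) (f : 𝒳 → ℝ)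
    (xy : Fin n → 𝒳 × 𝒴) (x' : Fin m → 𝒳) : ℝ :=
  uStat ℓ (fun i => (xy i).2)
    - (r : ℝ) / n * ∑ i, f (xy i).1
    + (r : ℝ) / (n + m) * (∑ i, f (xy i).1 + ∑ j, f (x' j))

end

end SemiSup

/-! Given the auxiliary data, the trained function is a fixed `f`, and all the randomness is in a
product of copies of `P`. The theorem is therefore a Berry–Esseen bound for fixed `f`, uniform in
`t`, averaged over the law of the auxiliary data (`ofReal_abs_measureReal_prod_sub_le`). The third
moments average exactly; the square root of the second moment averages by Jensen.

For fixed `f`, put `a = m / (n + m)`. The Hoeffding decomposition (`uStat_sub_psi`) writes the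
U-statistic as `ψ`, plus an average of `ℓ₁(Y_i) - ψ`, plus a U-statistic with a degenerate kernel.
Adding the correction in `f`, which is linear already, makes the standardized estimator a sum `W` of
`n + m` independent centered terms plus a nonlinear rest `Δ` (`uSemi_decomposition`). The labeled
terms are multiples of `ℓ₁(Y) - ψ - a (f(X) - E f(X))`, the unlabeled ones of `f(X) - E f(X)`. The
variance of the unnormalized linear part is `Λ / n`, with `Λ = r² (Var(ℓ₁ - a f) + a (1 - a) Var
f)`. Subtracting a function of `X` does not change the conditional variance given `X`, so `Λ ≥ r²
σ₁² > 0` whatever `f` is (`sq_mul_sigma1Sq_le_Lam`). This puts `σ₁` in the denominators.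

Normality of `W + Δ` is obtained by Stein's method in the manner of Chen and Shao. The key is the
randomized concentration inequality `IsStdFamily.measureReal_concentration`, which bounds the
probability that `W` lies in an interval of random length `Θ`, in terms of `E|W|Θ` and of
leave-one-out approximations of `Θ`. For constant `Θ` it feeds the Stein equation and gives
Berry–Esseen for `W` (`abs_measureReal_sum_le_sub_stdCDF_le`); for `Θ = |Δ|` it passes from `W` to
`W + Δ` (`abs_measureReal_add_le_sub_stdCDF_le`).

What remains is second moments of `Δ` and of `Δ - Δ_i`. Two values of a degenerate kernel are
uncorrelated unless their index tuples share two indices, and such pairs are rare. Hence the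
unscaled remainder has second moment of order `σ_ℓ² / n²`, and its part through one index of order
`σ_ℓ² / n³` (`integral_uRem_sq_le`, `integral_uRem_sub_sq_le`). -/

namespace SemiSup

open Set Filter Topology

/-! ### The Stein equation of the standard normal distribution -/

/-- The standard normal density. -/
noncomputable abbrev stdPDF : ℝ → ℝ := gaussianPDFReal 0 1

/-- The standard normal distribution function. -/
noncomputable abbrev stdCDF : ℝ → ℝ := fun w => cdf (gaussianReal 0 1) w

lemma stdPDF_pos (w : ℝ) : 0 < stdPDF w := gaussianPDFReal_pos _ _ _ one_ne_zero

lemma hasDerivAt_stdPDF (w : ℝ) : HasDerivAt stdPDF (-w * stdPDF w) w := by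
  have h : HasDerivAt (fun x : ℝ => (√(2 * Real.pi * (1 : ℝ≥0)))⁻¹ *
      Real.exp (-(x - 0) ^ 2 / (2 * (1 : ℝ≥0))))
      ((√(2 * Real.pi * (1 : ℝ≥0)))⁻¹ *
        (Real.exp (-(w - 0) ^ 2 / (2 * (1 : ℝ≥0))) * (-(2 * (w - 0)) / (2 * (1 : ℝ≥0))))) w := by
    refine HasDerivAt.const_mul _ (HasDerivAt.exp (HasDerivAt.div_const (HasDerivAt.fun_neg ?_) _))
    simpa using ((hasDerivAt_id w).sub_const 0).fun_pow 2
  refine h.congr_deriv ?_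
  simp only [stdPDF, gaussianPDFReal, NNReal.coe_one]
  ring

lemma continuous_stdPDF : Continuous stdPDF :=
  continuous_iff_continuousAt.2 fun w => (hasDerivAt_stdPDF w).continuousAt

lemma stdCDF_eq_integral (w : ℝ) : stdCDF w = ∫ x in Iic w, stdPDF x := by
  simp only [stdCDF]
  rw [cdf_eq_real, measureReal_def, gaussianReal_apply_eq_integral _ one_ne_zero,
    ENNReal.toReal_ofReal (integral_nonneg fun x => (stdPDF_pos x).le)]

lemma one_sub_stdCDF_eq_integral (w : ℝ) : 1 - stdCDF w = ∫ x in Ioi w, stdPDF x := by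
  have h := intervalIntegral.integral_Iic_add_Ioi
    (integrable_gaussianPDFReal 0 1).integrableOn (integrable_gaussianPDFReal 0 1).integrableOn
    (b := w)
  rw [integral_gaussianPDFReal_eq_one 0 one_ne_zero] at h
  rw [stdCDF_eq_integral]
  simp only [stdPDF]
  linarith

lemma hasDerivAt_stdCDF (w : ℝ) : HasDerivAt stdCDF (stdPDF w) w := by
  have hI : Integrable stdPDF := integrable_gaussianPDFReal 0 1
  have h : stdCDF = fun x => (∫ t in Iic 0, stdPDF t) + ∫ t in (0 : ℝ)..x, stdPDF t := by
    ext x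
    have := intervalIntegral.integral_Iic_sub_Iic (hI.integrableOn (s := Iic 0))
      (hI.integrableOn (s := Iic x))
    rw [stdCDF_eq_integral, ← this]
    ring
  rw [h]
  exact (intervalIntegral.integral_hasDerivAt_right (hI.intervalIntegrable)
    (continuous_stdPDF.stronglyMeasurableAtFilter _ _) continuous_stdPDF.continuousAt).const_add _

lemma tendsto_stdPDF_atTop : Tendsto stdPDF atTop (𝓝 0) := by
  have h : Tendsto (fun x : ℝ => (√(2 * Real.pi * (1 : ℝ≥0)))⁻¹ *
      Real.exp (-(x - 0) ^ 2 / (2 * (1 : ℝ≥0)))) atTop (𝓝 ((√(2 * Real.pi * (1 : ℝ≥0)))⁻¹ * 0)) := by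
    refine Tendsto.const_mul _ (Real.tendsto_exp_atBot.comp ?_)
    have h1 : Tendsto (fun x : ℝ => x ^ 2 / 2) atTop atTop :=
      (tendsto_pow_atTop two_ne_zero).atTop_div_const two_pos
    refine (tendsto_neg_atTop_atBot.comp h1).congr fun x => ?_
    simp [neg_div]
  rw [mul_zero] at h
  exact h

lemma stdPDF_neg (x : ℝ) : stdPDF (-x) = stdPDF x := by
  simp [stdPDF, gaussianPDFReal]

lemma integrable_mul_stdPDF : Integrable fun x : ℝ => x * stdPDF x := by
  have h := (integrable_mul_exp_neg_mul_sq (b := 1 / 2) (by norm_num)).const_mul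
    (√(2 * Real.pi * (1 : ℝ≥0)))⁻¹
  refine h.congr (ae_of_all _ fun x => ?_)
  have : -(1 / 2) * x ^ 2 = -(x - 0) ^ 2 / (2 * (1 : ℝ≥0)) := by simp; ring
  simp only [stdPDF, gaussianPDFReal, this]
  ring

lemma integral_Ioi_mul_stdPDF (w : ℝ) : ∫ x in Ioi w, x * stdPDF x = stdPDF w := by
  have h := integral_Ioi_of_hasDerivAt_of_tendsto' (a := w) (f := fun x => - stdPDF x)
    (f' := fun x => x * stdPDF x) (m := 0)
    (fun x _ => (hasDerivAt_stdPDF x).fun_neg.congr_deriv (by ring))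
    integrable_mul_stdPDF.integrableOn (by simpa using tendsto_stdPDF_atTop.neg)
  rw [h]; ring

/-- Mills' bound for the upper tail of the normal distribution. -/
lemma mul_one_sub_stdCDF_le (w : ℝ) : w * (1 - stdCDF w) ≤ stdPDF w := by
  rw [one_sub_stdCDF_eq_integral, ← integral_Ioi_mul_stdPDF w, ← integral_const_mul]
  refine setIntegral_mono_on ((integrable_gaussianPDFReal 0 1).const_mul w).integrableOn
    integrable_mul_stdPDF.integrableOn measurableSet_Ioi fun x hx => ?_
  exact mul_le_mul_of_nonneg_right (le_of_lt hx) (stdPDF_pos x).le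

lemma stdCDF_neg (w : ℝ) : stdCDF (-w) = 1 - stdCDF w := by
  rw [stdCDF_eq_integral, one_sub_stdCDF_eq_integral]
  simpa [stdPDF_neg] using integral_comp_neg_Iic (-w) stdPDF

lemma neg_mul_stdCDF_le (w : ℝ) : -w * stdCDF w ≤ stdPDF w := by
  have h := mul_one_sub_stdCDF_le (-w)
  rwa [← stdCDF_neg, neg_neg, stdPDF_neg] at h

lemma stdCDF_nonneg (w : ℝ) : 0 ≤ stdCDF w := cdf_nonneg _ _

lemma stdCDF_le_one (w : ℝ) : stdCDF w ≤ 1 := cdf_le_one _ _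

lemma stdCDF_mono : Monotone stdCDF := monotone_cdf _

/-- The solution of the Stein equation `f' (w) - w f (w) = 1 {w ≤ z} - Φ (z)`. -/
noncomputable def steinSol (z w : ℝ) : ℝ :=
  (stdCDF (min w z) - stdCDF w * stdCDF z) / stdPDF w

/-- The derivative of the Stein solution, with the value at `z` fixed by the Stein equation. -/
noncomputable def steinDer (z w : ℝ) : ℝ :=
  w * steinSol z w + (Iic z).indicator 1 w - stdCDF z

lemma continuous_steinSol (z : ℝ) : Continuous (steinSol z) := by
  have h : Continuous stdCDF :=
    continuous_iff_continuousAt.2 fun w => (hasDerivAt_stdCDF w).continuousAt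
  exact ((h.comp (continuous_id.min continuous_const)).sub (h.mul continuous_const)).div
    continuous_stdPDF fun w => (stdPDF_pos w).ne'

lemma measurable_steinDer (z : ℝ) : Measurable (steinDer z) :=
  ((measurable_id.mul (continuous_steinSol z).measurable).add
    ((measurable_one).indicator measurableSet_Iic)).sub_const _

lemma hasDerivAt_steinSol {z w : ℝ} (h : w ≠ z) :
    HasDerivAt (steinSol z) (steinDer z w) w := by
  have hφ := (stdPDF_pos w).ne'
  rcases lt_or_gt_of_ne h with h | h
  · have h1 : HasDerivAt (fun x => (stdCDF x - stdCDF x * stdCDF z) / stdPDF x) _ w :=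
      ((hasDerivAt_stdCDF w).sub ((hasDerivAt_stdCDF w).mul_const (stdCDF z))).div
        (hasDerivAt_stdPDF w) hφ
    refine (h1.congr_of_eventuallyEq ?_).congr_deriv ?_
    · filter_upwards [Iio_mem_nhds h] with x hx
      rw [steinSol, min_eq_left (le_of_lt hx)]
    · rw [steinDer, steinSol, min_eq_left h.le, indicator_of_mem (show w ∈ Iic z from h.le)]
      simp only [Pi.sub_apply, Pi.one_apply]
      field_simp
      ring
  · have h1 : HasDerivAt (fun x => (stdCDF z - stdCDF x * stdCDF z) / stdPDF x) _ w :=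
      (((hasDerivAt_stdCDF w).mul_const (stdCDF z)).const_sub (stdCDF z)).div
        (hasDerivAt_stdPDF w) hφ
    refine (h1.congr_of_eventuallyEq ?_).congr_deriv ?_
    · filter_upwards [Ioi_mem_nhds h] with x hx
      rw [steinSol, min_eq_right (le_of_lt hx)]
    · rw [steinDer, steinSol, min_eq_right h.le,
        indicator_of_notMem (show w ∉ Iic z from not_le.2 h)]
      field_simp
      ring

/-- The numerator is `Φ(w)(1 - Φ(z))` left of `z` and `Φ(z)(1 - Φ(w))` right of it, so monotonicity
bounds it by either tail at `w`. Having both tails allows Mills' bound for either sign of `w`. -/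
lemma steinNum_bounds (z w : ℝ) :
    0 ≤ stdCDF (min w z) - stdCDF w * stdCDF z ∧
      stdCDF (min w z) - stdCDF w * stdCDF z ≤ stdCDF w ∧
      stdCDF (min w z) - stdCDF w * stdCDF z ≤ 1 - stdCDF w := by
  have h1 := stdCDF_nonneg w
  have h2 := stdCDF_nonneg z
  have h3 := stdCDF_le_one w
  have h4 := stdCDF_le_one z
  rcases le_total w z with h | h
  · rw [min_eq_left h]
    have := stdCDF_mono h
    refine ⟨by nlinarith, by nlinarith, by nlinarith⟩
  · rw [min_eq_right h]
    have := stdCDF_mono h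
    refine ⟨by nlinarith, by nlinarith, by nlinarith⟩

lemma abs_mul_steinSol_le (z w : ℝ) : |w * steinSol z w| ≤ 1 := by
  obtain ⟨h0, h1, h2⟩ := steinNum_bounds z w
  have hφ := stdPDF_pos w
  have h3 := mul_one_sub_stdCDF_le w
  have h4 := neg_mul_stdCDF_le w
  rw [steinSol, ← mul_div_assoc, abs_div, abs_of_pos hφ, div_le_one hφ, abs_le]
  rcases le_total 0 w with h | h <;> constructor <;> nlinarith

lemma steinSol_nonneg (z w : ℝ) : 0 ≤ steinSol z w :=
  div_nonneg (steinNum_bounds z w).1 (stdPDF_pos w).le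

lemma stdPDF_ge {w : ℝ} (h : |w| ≤ 1) : 1 / 6 ≤ stdPDF w := by
  have h1 : w ^ 2 ≤ 1 := (sq_le_one_iff_abs_le_one w).2 h
  have h2 : √(2 * Real.pi) ≤ 2.51 := by
    -- The constant is nearly sharp for `π < 3.15`: `2.51² = 6.3001` and `2 * 3.15 = 6.30`.
    rw [Real.sqrt_le_left (by norm_num)]
    nlinarith [Real.pi_lt_d2]
  have h3 : (1 : ℝ) / 2 ≤ Real.exp (-(w ^ 2) / 2) := by
    have := Real.add_one_le_exp (-(w ^ 2) / 2)
    linarith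
  have h4 : 0 < √(2 * Real.pi) := by positivity
  have : stdPDF w = (√(2 * Real.pi))⁻¹ * Real.exp (-(w ^ 2) / 2) := by
    simp [stdPDF, gaussianPDFReal]
  rw [this, inv_mul_eq_div, div_le_div_iff₀ (by norm_num) h4]
  nlinarith

/-- On `[-1, 1]` the numerator is at most one and the density at least `1/6`; elsewhere `|w f(w)| ≤
1` suffices. -/
lemma steinSol_le (z w : ℝ) : steinSol z w ≤ 6 := by
  rcases le_total |w| 1 with h | h
  · rw [steinSol, div_le_iff₀ (stdPDF_pos w)]
    have := (steinNum_bounds z w).2.1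
    have := stdCDF_le_one w
    have := stdPDF_ge h
    linarith
  · have h1 := abs_mul_steinSol_le z w
    rw [abs_mul, abs_of_nonneg (steinSol_nonneg z w)] at h1
    nlinarith [steinSol_nonneg z w]

lemma abs_steinSol_le (z w : ℝ) : |steinSol z w| ≤ 6 := by
  rw [abs_of_nonneg (steinSol_nonneg z w)]; exact steinSol_le z w

/-- Both `w f(w)` and `1{w ≤ z} - Φ(z)` lie in `[-1, 1]`. -/
lemma abs_steinDer_le (z w : ℝ) : |steinDer z w| ≤ 2 := by
  have h1 := abs_le.1 (abs_mul_steinSol_le z w)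
  have h2 := stdCDF_nonneg z
  have h3 := stdCDF_le_one z
  have h4 : 0 ≤ (Iic z).indicator (1 : ℝ → ℝ) w ∧ (Iic z).indicator (1 : ℝ → ℝ) w ≤ 1 := by
    by_cases h : w ∈ Iic z <;> simp [h]
  rw [steinDer, abs_le]
  constructor <;> linarith

/-- The mean value theorem for the Stein solution away from `z`. -/
lemma exists_steinSol_sub_eq {z x y : ℝ} (hxy : x < y) (hz : z ∉ Ioo x y) :
    ∃ c ∈ Ioo x y, steinSol z y - steinSol z x = (y - x) * steinDer z c := by
  obtain ⟨c, hc, h⟩ := exists_hasDerivAt_eq_slope (steinSol z) (steinDer z) hxy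
    (continuous_steinSol z).continuousOn
    fun c hc => hasDerivAt_steinSol (by rintro rfl; exact hz hc)
  refine ⟨c, hc, ?_⟩
  rw [h]
  field_simp [(sub_pos.2 hxy).ne']

lemma abs_steinSol_sub_le_of_lt {z x y : ℝ} (hxy : x < y) :
    |steinSol z y - steinSol z x| ≤ 2 * (y - x) := by
  have key : ∀ {x y : ℝ}, x < y → z ∉ Ioo x y → |steinSol z y - steinSol z x| ≤ 2 * (y - x) := by
    intro x y hxy hz
    obtain ⟨c, -, h⟩ := exists_steinSol_sub_eq hxy hz
    rw [h, abs_mul, abs_of_pos (sub_pos.2 hxy), mul_comm 2]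
    exact mul_le_mul_of_nonneg_left (abs_steinDer_le z c) (sub_pos.2 hxy).le
  -- The solution has a kink at `z`, so the mean value theorem is applied on each side of it.
  by_cases hz : z ∈ Ioo x y
  · have h1 := key hz.1 (by simp)
    have h2 := key hz.2 (by simp)
    have := abs_add_le (steinSol z y - steinSol z z) (steinSol z z - steinSol z x)
    rw [sub_add_sub_cancel] at this
    linarith
  · exact key hxy hz

lemma abs_steinSol_sub_le (z x y : ℝ) : |steinSol z y - steinSol z x| ≤ 2 * |y - x| := by
  rcases lt_trichotomy x y with h | rfl | h
  · rw [abs_of_pos (sub_pos.2 h)]; exact abs_steinSol_sub_le_of_lt h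
  · simp
  · rw [abs_sub_comm, abs_sub_comm y, abs_of_pos (sub_pos.2 h)]; exact abs_steinSol_sub_le_of_lt h

/-- The modulus of continuity of the derivative of the Stein solution. -/
noncomputable def steinOsc (z w x : ℝ) : ℝ :=
  (2 * |w| + 6) * |x| + {p : ℝ × ℝ | |p.2 - z| ≤ |p.1|}.indicator 1 (x, w)

lemma steinOsc_nonneg (z w x : ℝ) : 0 ≤ steinOsc z w x :=
  add_nonneg (by positivity) (indicator_nonneg (fun _ _ => zero_le_one) _)

lemma abs_mul_steinSol_sub_le (z w u : ℝ) :
    |(w + u) * steinSol z (w + u) - w * steinSol z w| ≤ (2 * |w| + 6) * |u| := by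
  have h1 := abs_steinSol_sub_le z w (w + u)
  rw [add_sub_cancel_left] at h1
  have : (w + u) * steinSol z (w + u) - w * steinSol z w
      = w * (steinSol z (w + u) - steinSol z w) + u * steinSol z (w + u) := by ring
  rw [this]
  refine (abs_add_le _ _).trans ?_
  rw [abs_mul, abs_mul]
  have h2 := abs_steinSol_le z (w + u)
  nlinarith [mul_le_mul_of_nonneg_left h1 (abs_nonneg w),
    mul_le_mul_of_nonneg_left h2 (abs_nonneg u)]

lemma indicator_Iic_eq_of_lt_abs {z w u : ℝ} (h : |u| < |w - z|) :
    (Iic z).indicator (1 : ℝ → ℝ) (w + u) = (Iic z).indicator (1 : ℝ → ℝ) w := by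
  have hiff : w + u ∈ Iic z ↔ w ∈ Iic z := by
    simp only [mem_Iic]
    rcases abs_cases u with ⟨h1, _⟩ | ⟨h1, _⟩ <;> rcases abs_cases (w - z) with ⟨h2, _⟩ | ⟨h2, _⟩ <;>
      constructor <;> intro <;> linarith
  by_cases hw : w ∈ Iic z
  · rw [indicator_of_mem hw, indicator_of_mem (hiff.2 hw)]; rfl
  · rw [indicator_of_notMem hw, indicator_of_notMem (fun h' => hw (hiff.1 h'))]

lemma abs_steinDer_sub_le (z w x : ℝ) : |steinDer z (w + x) - steinDer z w| ≤ steinOsc z w x := by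
  have h1 := abs_mul_steinSol_sub_le z w x
  have h2 : |(Iic z).indicator (1 : ℝ → ℝ) (w + x) - (Iic z).indicator (1 : ℝ → ℝ) w|
      ≤ {p : ℝ × ℝ | |p.2 - z| ≤ |p.1|}.indicator 1 (x, w) := by
    by_cases h : |w - z| ≤ |x|
    · rw [indicator_of_mem (show (x, w) ∈ {p : ℝ × ℝ | |p.2 - z| ≤ |p.1|} from h)]
      by_cases ha : w + x ∈ Iic z <;> by_cases hb : w ∈ Iic z <;> simp [ha, hb]
    · rw [indicator_Iic_eq_of_lt_abs (not_le.1 h), sub_self, abs_zero]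
      exact indicator_nonneg (fun _ _ => zero_le_one) _
  have : steinDer z (w + x) - steinDer z w
      = ((w + x) * steinSol z (w + x) - w * steinSol z w) +
        ((Iic z).indicator (1 : ℝ → ℝ) (w + x) - (Iic z).indicator (1 : ℝ → ℝ) w) := by
    simp only [steinDer]; ring
  rw [this]
  exact (abs_add_le _ _).trans (add_le_add h1 h2)

/-- If the kink may lie between `w` and `w + x`, the indicator makes `steinOsc` at least one and the
crude bound `2|x| + 2|x|` is enough, whence the factor `4`. Otherwise the mean value theorem reduces
the claim to the oscillation of the derivative. -/
lemma abs_steinSol_sub_sub_le (z w x : ℝ) :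
    |steinSol z (w + x) - steinSol z w - x * steinDer z w| ≤ 4 * |x| * steinOsc z w x := by
  by_cases h : |w - z| ≤ |x|
  · have h1 := abs_steinSol_sub_le z w (w + x)
    rw [add_sub_cancel_left] at h1
    have h2 : 1 ≤ steinOsc z w x := by
      rw [steinOsc, indicator_of_mem (show (x, w) ∈ {p : ℝ × ℝ | |p.2 - z| ≤ |p.1|} from h),
        Pi.one_apply]
      have : 0 ≤ (2 * |w| + 6) * |x| := by positivity
      linarith
    have h3 := abs_sub (steinSol z (w + x) - steinSol z w) (x * steinDer z w)
    have h4 : |x * steinDer z w| ≤ |x| * 2 := by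
      rw [abs_mul]; exact mul_le_mul_of_nonneg_left (abs_steinDer_le z w) (abs_nonneg x)
    nlinarith [abs_nonneg x]
  · rw [not_le] at h
    have key : ∀ c, |c - w| ≤ |x| → |steinDer z c - steinDer z w| ≤ steinOsc z w x := by
      intro c hc
      have h1 := abs_mul_steinSol_sub_le z w (c - w)
      have h2 := indicator_Iic_eq_of_lt_abs (hc.trans_lt h)
      rw [add_sub_cancel] at h1 h2
      have : steinDer z c - steinDer z w = c * steinSol z c - w * steinSol z w := by
        simp only [steinDer, h2]; ring
      rw [this, steinOsc]
      have h3 : (0 : ℝ) ≤ {p : ℝ × ℝ | |p.2 - z| ≤ |p.1|}.indicator 1 (x, w) :=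
        indicator_nonneg (fun _ _ => zero_le_one) _
      have : (2 * |w| + 6) * |c - w| ≤ (2 * |w| + 6) * |x| := by gcongr
      linarith
    have hfin : ∀ c, |c - w| ≤ |x| →
        steinSol z (w + x) - steinSol z w = x * steinDer z c →
        |steinSol z (w + x) - steinSol z w - x * steinDer z w| ≤ 4 * |x| * steinOsc z w x := by
      intro c hc he
      rw [he, ← mul_sub, abs_mul]
      have := mul_le_mul_of_nonneg_left (key c hc) (abs_nonneg x)
      nlinarith [abs_nonneg x, steinOsc_nonneg z w x,
        mul_nonneg (abs_nonneg x) (steinOsc_nonneg z w x)]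
    rcases lt_trichotomy x 0 with hx | rfl | hx
    · rw [abs_of_neg hx] at h
      obtain ⟨c, hc, he⟩ := exists_steinSol_sub_eq (z := z) (x := w + x) (y := w) (by linarith) (by
        rintro ⟨h1, h2⟩
        rw [abs_of_pos (by linarith)] at h
        linarith)
      refine hfin c ?_ (by linarith)
      rw [abs_of_neg hx, abs_of_neg (by linarith [hc.2])]
      linarith [hc.1]
    · simp
    · rw [abs_of_pos hx] at h
      obtain ⟨c, hc, he⟩ := exists_steinSol_sub_eq (z := z) (x := w) (y := w + x) (by linarith) (by
        rintro ⟨h1, h2⟩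
        rw [abs_of_neg (by linarith)] at h
        linarith)
      refine hfin c ?_ (by linarith)
      rw [abs_of_pos hx, abs_of_pos (by linarith [hc.1])]
      linarith [hc.2]

/-! ### Moment inequalities -/

section Moments

variable {Ω : Type*} [MeasurableSpace Ω] {μ : Measure Ω}

lemma integral_abs_mul_abs_le {X Y : Ω → ℝ} (hX : MemLp X 2 μ) (hY : MemLp Y 2 μ) :
    ∫ ω, |X ω| * |Y ω| ∂μ ≤ √(∫ ω, X ω ^ 2 ∂μ) * √(∫ ω, Y ω ^ 2 ∂μ) := by
  have h := integral_mul_norm_le_Lp_mul_Lq (p := 2) (q := 2) (μ := μ) (f := X) (g := Y)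
    Real.HolderConjugate.two_two (by simpa using hX) (by simpa using hY)
  simpa [Real.sqrt_eq_rpow] using h

lemma integral_abs_le_sqrt [IsProbabilityMeasure μ] {X : Ω → ℝ} (hX : MemLp X 2 μ) :
    ∫ ω, |X ω| ∂μ ≤ √(∫ ω, X ω ^ 2 ∂μ) := by
  simpa using integral_abs_mul_abs_le hX (memLp_const (1 : ℝ))

lemma sq_integral_abs_le [IsProbabilityMeasure μ] {X : Ω → ℝ} (hX : MemLp X 2 μ) :
    (∫ ω, |X ω| ∂μ) ^ 2 ≤ ∫ ω, X ω ^ 2 ∂μ := by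
  have h := integral_abs_le_sqrt hX
  have h0 : 0 ≤ ∫ ω, |X ω| ∂μ := integral_nonneg fun _ => abs_nonneg _
  calc (∫ ω, |X ω| ∂μ) ^ 2 ≤ √(∫ ω, X ω ^ 2 ∂μ) ^ 2 := by gcongr
    _ = _ := Real.sq_sqrt (integral_nonneg fun _ => sq_nonneg _)

lemma MemLp.integrable_abs_pow {X : Ω → ℝ} {p : ℕ} (hX : MemLp X p μ) (hp : p ≠ 0) :
    Integrable (fun ω => |X ω| ^ p) μ := by
  simpa using hX.integrable_norm_pow hp

/-- With `a = E|X|`, expand `(|X| - a)² (|X| + a)`: in mean the terms of degree one and zero in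
`|X|` cancel. The lemma lets products of a variance and a first moment be absorbed in the Lyapunov
ratio. -/
lemma integral_sq_mul_integral_abs_le [IsProbabilityMeasure μ] {X : Ω → ℝ} (hX : MemLp X 3 μ) :
    (∫ ω, X ω ^ 2 ∂μ) * ∫ ω, |X ω| ∂μ ≤ ∫ ω, |X ω| ^ 3 ∂μ := by
  have hX2 : MemLp X 2 μ := hX.mono_exponent (by norm_num)
  have hi1 : Integrable (fun ω => |X ω|) μ := (hX.integrable (by norm_num)).abs
  have hi2 : Integrable (fun ω => X ω ^ 2) μ := hX2.integrable_sq
  have hi3 : Integrable (fun ω => |X ω| ^ 3) μ := MemLp.integrable_abs_pow (p := 3) hX (by norm_num)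
  set a := ∫ ω, |X ω| ∂μ
  have ha : 0 ≤ a := integral_nonneg fun _ => abs_nonneg _
  set v := ∫ ω, X ω ^ 2 ∂μ
  have hsq : a ^ 2 ≤ v := sq_integral_abs_le hX2
  -- integrate the inequality `(|X| - a) ^ 2 * (|X| + a) ≥ 0`
  have h0 : 0 ≤ ∫ ω, (|X ω| ^ 3 - a * X ω ^ 2 - a ^ 2 * |X ω| + a ^ 3) ∂μ := by
    refine integral_nonneg fun ω => ?_
    have : |X ω| ^ 3 - a * X ω ^ 2 - a ^ 2 * |X ω| + a ^ 3 = (|X ω| - a) ^ 2 * (|X ω| + a) := by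
      rw [← sq_abs (X ω)]; ring
    change (0 : ℝ) ≤ |X ω| ^ 3 - a * X ω ^ 2 - a ^ 2 * |X ω| + a ^ 3
    rw [this]
    positivity
  have j1 : Integrable (fun ω => |X ω| ^ 3 - a * X ω ^ 2) μ := hi3.sub (hi2.const_mul a)
  have j2 : Integrable (fun ω => |X ω| ^ 3 - a * X ω ^ 2 - a ^ 2 * |X ω|) μ :=
    j1.sub (hi1.const_mul _)
  rw [integral_add j2 (integrable_const _), integral_sub j1 (hi1.const_mul _),
    integral_sub hi3 (hi2.const_mul a), integral_const_mul, integral_const_mul] at h0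
  simp only [integral_const, probReal_univ, smul_eq_mul, one_mul] at h0
  change 0 ≤ _ - a * v - a ^ 2 * a + a ^ 3 at h0
  linarith [mul_comm a v]

end Moments

/-! ### Standardized sums of independent random variables -/

section StdSum

variable {Ω : Type*} [MeasurableSpace Ω] {ι : Type*} [Fintype ι]

/-- The summands of a standardized sum: independent, centered, with finite third moments and
variances summing to one. -/
structure IsStdFamily (μ : Measure Ω) (ξ : ι → Ω → ℝ) : Prop where
  meas : ∀ i, Measurable (ξ i)
  indep : iIndepFun ξ μ
  memLp : ∀ i, MemLp (ξ i) 3 μ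
  mean : ∀ i, ∫ ω, ξ i ω ∂μ = 0
  var : ∑ i, ∫ ω, ξ i ω ^ 2 ∂μ = 1

/-- The Lyapunov ratio of a standardized family. -/
noncomputable def lyapunov (μ : Measure Ω) (ξ : ι → Ω → ℝ) : ℝ := ∑ i, ∫ ω, |ξ i ω| ^ 3 ∂μ

namespace IsStdFamily

variable {μ : Measure Ω} {ξ : ι → Ω → ℝ}

lemma memLp_two [IsProbabilityMeasure μ] (h : IsStdFamily μ ξ) (i : ι) : MemLp (ξ i) 2 μ :=
  (h.memLp i).mono_exponent (by norm_num)

lemma measurable_sum (h : IsStdFamily μ ξ) : Measurable fun ω => ∑ i, ξ i ω :=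
  Finset.measurable_sum _ fun i _ => h.meas i

lemma memLp_sum [IsProbabilityMeasure μ] (h : IsStdFamily μ ξ) : MemLp (fun ω => ∑ i, ξ i ω) 2 μ :=
  memLp_finsetSum _ fun i _ => h.memLp_two i

lemma variance_eq (h : IsStdFamily μ ξ) (i : ι) : Var[ξ i; μ] = ∫ ω, ξ i ω ^ 2 ∂μ :=
  variance_of_integral_eq_zero (h.meas i).aemeasurable (h.mean i)

lemma integral_sum [IsProbabilityMeasure μ] (h : IsStdFamily μ ξ) : ∫ ω, ∑ i, ξ i ω ∂μ = 0 := by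
  rw [integral_finsetSum _ fun i _ => (h.memLp i).integrable (by norm_num)]
  exact Finset.sum_eq_zero fun i _ => h.mean i

lemma integral_sum_sq [IsProbabilityMeasure μ] (h : IsStdFamily μ ξ) : ∫ ω, (∑ i, ξ i ω) ^ 2 ∂μ = 1 := by
  rw [← variance_of_integral_eq_zero h.measurable_sum.aemeasurable h.integral_sum, ← h.var]
  have := IndepFun.variance_sum (s := Finset.univ) (X := ξ) (μ := μ) (fun i _ => h.memLp_two i)
    fun i _ j _ hij => h.indep.indepFun hij
  simp_rw [← h.variance_eq, ← this]
  congr 1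
  ext ω
  simp

lemma integral_abs_sum_le [IsProbabilityMeasure μ] (h : IsStdFamily μ ξ) : ∫ ω, |∑ i, ξ i ω| ∂μ ≤ 1 := by
  have := integral_abs_le_sqrt h.memLp_sum
  rwa [h.integral_sum_sq, Real.sqrt_one] at this

lemma indepFun_sub (h : IsStdFamily μ ξ) (i : ι) :
    IndepFun (ξ i) (fun ω => ∑ j, ξ j ω - ξ i ω) μ := by
  classical
  have := h.indep.indepFun_finset {i} (Finset.univ.erase i) (by simp) h.meas
  have m1 : Measurable fun x : ({i} : Finset ι) → ℝ => x ⟨i, Finset.mem_singleton_self i⟩ :=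
    measurable_pi_apply _
  have m2 : Measurable fun x : ↥(Finset.univ.erase i) → ℝ => ∑ j, x j :=
    Finset.measurable_sum _ fun j _ => measurable_pi_apply j
  have h2 := this.comp m1 m2
  refine h2.congr (by rfl) (Eventually.of_forall fun ω => ?_)
  simp only [Function.comp_apply]
  rw [Finset.sum_coe_sort (Finset.univ.erase i) fun j => ξ j ω,
    ← Finset.add_sum_erase Finset.univ (fun j => ξ j ω) (Finset.mem_univ i)]
  ring

/-- Vanishing third moments would make every summand zero almost surely, against total variance one.
Positivity is needed because the Lyapunov ratio sets the width of the truncation in the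
concentration inequality. -/
lemma lyapunov_pos (h : IsStdFamily μ ξ) : 0 < lyapunov μ ξ := by
  have h0 : ∀ i, 0 ≤ ∫ ω, |ξ i ω| ^ 3 ∂μ := fun i => integral_nonneg fun ω => by positivity
  refine (Finset.sum_nonneg fun i _ => h0 i).lt_of_ne fun h1 => ?_
  have h2 : ∀ i, ∫ ω, ξ i ω ^ 2 ∂μ = 0 := by
    intro i
    have h3 := (Finset.sum_eq_zero_iff_of_nonneg fun i _ => h0 i).1 h1.symm i (Finset.mem_univ i)
    rw [integral_eq_zero_iff_of_nonneg (fun ω => by positivity)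
      (MemLp.integrable_abs_pow (p := 3) (h.memLp i) (by norm_num))] at h3
    refine integral_eq_zero_of_ae ?_
    filter_upwards [h3] with ω hω
    have : |ξ i ω| = 0 := by simpa using hω
    simp [abs_eq_zero.1 this]
  have := h.var
  simp [h2] at this

lemma integral_sq_le_one (h : IsStdFamily μ ξ) (i : ι) : ∫ ω, ξ i ω ^ 2 ∂μ ≤ 1 := by
  rw [← h.var]
  exact Finset.single_le_sum (f := fun i => ∫ ω, ξ i ω ^ 2 ∂μ)
    (fun j _ => integral_nonneg fun _ => sq_nonneg _) (Finset.mem_univ i)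

lemma neg (h : IsStdFamily μ ξ) : IsStdFamily μ fun i ω => -ξ i ω where
  meas i := (h.meas i).neg
  indep := h.indep.comp (fun _ x => -x) fun _ => measurable_neg
  memLp i := (h.memLp i).neg
  mean i := by rw [integral_neg, h.mean i, neg_zero]
  var := by simpa using h.var

end IsStdFamily

/-! ### The randomized concentration inequality -/

/-- The truncated linear function of the randomized concentration inequality. -/
noncomputable def concFun (c δ w θ : ℝ) : ℝ := min (max (w - c + δ) 0) (θ + 2 * δ)

lemma measurable_concFun (c δ : ℝ) : Measurable fun p : ℝ × ℝ => concFun c δ p.1 p.2 := by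
  unfold concFun; fun_prop

lemma abs_concFun_le {δ : ℝ} (hδ : 0 ≤ δ) (c w θ : ℝ) : |concFun c δ w θ| ≤ |θ| + 2 * δ := by
  rw [concFun, abs_le]
  have h1 := neg_abs_le θ
  have h2 := le_abs_self θ
  have h3 := abs_nonneg θ
  constructor
  · refine le_min ?_ (by linarith)
    exact le_trans (by linarith) (le_max_right _ _)
  · exact (min_le_right _ _).trans (by linarith)

lemma abs_concFun_sub_le (c δ w θ θ' : ℝ) : |concFun c δ w θ - concFun c δ w θ'| ≤ |θ - θ'| := by
  have := abs_min_sub_min_le_max (max (w - c + δ) 0) (θ + 2 * δ) (max (w - c + δ) 0) (θ' + 2 * δ)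
  rw [concFun, concFun]
  refine this.trans ?_
  simp

lemma concFun_mono {c δ w w' θ : ℝ} (h : w ≤ w') : concFun c δ w θ ≤ concFun c δ w' θ := by
  unfold concFun; gcongr

lemma mul_concFun_sub_nonneg (c δ w θ x : ℝ) :
    0 ≤ x * (concFun c δ w θ - concFun c δ (w - x) θ) := by
  rcases le_total 0 x with h | h
  · exact mul_nonneg h (sub_nonneg.2 (concFun_mono (by linarith)))
  · exact mul_nonneg_of_nonpos_of_nonpos h (sub_nonpos.2 (concFun_mono (by linarith)))

/-- As a function of `w`, `concFun` has slope one on `[c - δ, c + θ + δ]`. From a point of `[c, c +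
θ]` a shift by `x` therefore changes it by at least `min δ |x|`. -/
lemma abs_mul_min_le_mul_concFun_sub {c δ w θ : ℝ} (hδ : 0 ≤ δ) (h1 : c ≤ w) (h2 : w ≤ c + θ)
    (x : ℝ) : |x| * min δ |x| ≤ x * (concFun c δ w θ - concFun c δ (w - x) θ) := by
  have e1 : concFun c δ w θ = w - c + δ := by
    rw [concFun, max_eq_left (by linarith), min_eq_left (by linarith)]
  rcases le_total 0 x with h | h
  · rw [abs_of_nonneg h, e1]
    refine mul_le_mul_of_nonneg_left ?_ h
    have : concFun c δ (w - x) θ ≤ max (w - x - c + δ) 0 := min_le_left _ _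
    rcases le_total (w - x - c + δ) 0 with h3 | h3
    · rw [max_eq_right h3] at this
      exact (min_le_left _ _).trans (by linarith)
    · rw [max_eq_left h3] at this
      exact (min_le_right _ _).trans (by linarith)
  · rw [abs_of_nonpos h, e1]
    have h5 : min δ (-x) ≤ concFun c δ (w - x) θ - (w - c + δ) := by
      rw [le_sub_iff_add_le, concFun]
      refine le_min (le_trans ?_ (le_max_left _ _)) ?_
      · have := min_le_right δ (-x); linarith
      · have := min_le_left δ (-x); linarith
    nlinarith

/-- For `|x| ≥ δ` the difference of the sides is `|x| (|x| - 2δ)² / (4δ)`; for `|x| ≤ δ` the right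
side is already `x²`. -/
lemma le_abs_mul_min {δ : ℝ} (hδ : 0 < δ) (x : ℝ) :
    x ^ 2 - |x| ^ 3 / (4 * δ) ≤ |x| * min δ |x| := by
  have hx := abs_nonneg x
  rw [← sq_abs x]
  rcases le_total δ |x| with h | h
  · rw [min_eq_left h]
    have : |x| * δ - (|x| ^ 2 - |x| ^ 3 / (4 * δ)) = |x| * (|x| - 2 * δ) ^ 2 / (4 * δ) := by
      field_simp; ring
    have h2 : 0 ≤ |x| * (|x| - 2 * δ) ^ 2 / (4 * δ) := by positivity
    linarith
  · rw [min_eq_right h]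
    have h2 : 0 ≤ |x| ^ 3 / (4 * δ) := by positivity
    nlinarith

/-- Test `W` against the truncated linear function `g` of width `Θ`. From above, `E W g ≤ E|W|Θ + 2δ
E|W|`. From below, leaving out one summand at a time, `E W g` is about the mean of `S = ∑ |ξ_i|
min(δ, |ξ_i|)` on the event; `S` has mean at least `1/2` and standard deviation at most `δ`.
Replacing `Θ` by `Θ' i`, which together with the remaining sum is independent of `ξ_i`, costs
`E|ξ_i||Θ - Θ' i|`. -/
lemma IsStdFamily.measureReal_concentration {μ : Measure Ω} [IsProbabilityMeasure μ]
    {ξ : ι → Ω → ℝ} (h : IsStdFamily μ ξ) (c : ℝ) {Θ : Ω → ℝ} {Θ' : ι → Ω → ℝ}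
    (hΘ0 : ∀ ω, 0 ≤ Θ ω) (hΘ : MemLp Θ 2 μ) (hΘm : Measurable Θ)
    (hΘ' : ∀ i, MemLp (Θ' i) 2 μ) (hΘm' : ∀ i, Measurable (Θ' i))
    (hind : ∀ i, IndepFun (ξ i) (fun ω => (∑ j, ξ j ω - ξ i ω, Θ' i ω)) μ) :
    μ.real {ω | c ≤ ∑ i, ξ i ω ∧ ∑ i, ξ i ω ≤ c + Θ ω} ≤
      2 * ∫ ω, |∑ i, ξ i ω| * Θ ω ∂μ + 3 * lyapunov μ ξ
        + 2 * ∑ i, ∫ ω, |ξ i ω| * |Θ ω - Θ' i ω| ∂μ := by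
  -- Chosen so that `1 - lyapunov μ ξ / (4δ) = 1/2`, the lower bound for the mean of `S`.
  set δ := lyapunov μ ξ / 2 with hδ
  have hδ0 : 0 < δ := half_pos h.lyapunov_pos
  set W : Ω → ℝ := fun ω => ∑ i, ξ i ω with hW
  set A : Set Ω := {ω | c ≤ W ω ∧ W ω ≤ c + Θ ω} with hA
  have hWm : Measurable W := h.measurable_sum
  have hAm : MeasurableSet A :=
    (measurableSet_le measurable_const hWm).inter (measurableSet_le hWm (measurable_const.add hΘm))
  set η : ι → Ω → ℝ := fun i ω => |ξ i ω| * min δ |ξ i ω| with hη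
  set S : Ω → ℝ := ∑ i, η i with hS
  have hηm : ∀ i, Measurable (η i) := fun i => by
    have := h.meas i
    fun_prop
  have hη2 : ∀ i ω, |η i ω| ≤ δ * |ξ i ω| := by
    intro i ω
    rw [abs_of_nonneg (mul_nonneg (abs_nonneg _) (le_min hδ0.le (abs_nonneg _))), mul_comm δ]
    exact mul_le_mul_of_nonneg_left (min_le_left _ _) (abs_nonneg _)
  have hηL : ∀ i, MemLp (η i) 2 μ := fun i =>
    ((h.memLp_two i).norm.const_mul δ).mono' (hηm i).aestronglyMeasurable
      (ae_of_all _ fun ω => hη2 i ω)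
  have hSL : MemLp S 2 μ := memLp_finsetSum' _ fun i _ => hηL i
  have hSi : Integrable S μ := hSL.integrable (by norm_num)
  -- the mean of `S`
  have hES : 1 / 2 ≤ ∫ ω, S ω ∂μ := by
    have h1 : ∫ ω, S ω ∂μ = ∑ i, ∫ ω, η i ω ∂μ := by
      rw [← integral_finsetSum _ fun i _ => (hηL i).integrable (by norm_num)]
      simp [hS]
    have h2 : ∀ i, ∫ ω, ξ i ω ^ 2 ∂μ - (∫ ω, |ξ i ω| ^ 3 ∂μ) / (4 * δ) ≤ ∫ ω, η i ω ∂μ := by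
      intro i
      have hi3 := MemLp.integrable_abs_pow (p := 3) (h.memLp i) (by norm_num)
      rw [← integral_div, ← integral_sub (h.memLp_two i).integrable_sq (hi3.div_const _)]
      exact integral_mono ((h.memLp_two i).integrable_sq.sub (hi3.div_const _))
        ((hηL i).integrable (by norm_num)) fun ω => le_abs_mul_min hδ0 _
    have h3 := Finset.sum_le_sum fun i (_ : i ∈ Finset.univ) => h2 i
    rw [Finset.sum_sub_distrib, ← Finset.sum_div, h.var] at h3
    have h4 : (∑ i, ∫ ω, |ξ i ω| ^ 3 ∂μ) / (4 * δ) = 1 / 2 := by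
      change lyapunov μ ξ / (4 * δ) = 1 / 2
      rw [hδ]
      field_simp [h.lyapunov_pos.ne']
      norm_num
    rw [h1]
    linarith
  -- the fluctuation of `S`
  have hVS : ∫ ω, |S ω - ∫ ω, S ω ∂μ| ∂μ ≤ δ := by
    refine (integral_abs_le_sqrt (hSL.sub (memLp_const _))).trans ?_
    have h1 : ∫ ω, (S ω - ∫ ω, S ω ∂μ) ^ 2 ∂μ = Var[S; μ] :=
      (variance_eq_integral hSL.aemeasurable).symm
    have h2 : Var[S; μ] = ∑ i, Var[η i; μ] :=
      IndepFun.variance_sum (fun i _ => hηL i) fun i _ j _ hij =>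
        (h.indep.indepFun hij).comp (φ := fun x => |x| * min δ |x|)
          (ψ := fun x => |x| * min δ |x|) (by fun_prop) (by fun_prop)
    have h3 : ∀ i, Var[η i; μ] ≤ δ ^ 2 * ∫ ω, ξ i ω ^ 2 ∂μ := by
      intro i
      refine (variance_le_expectation_sq (hηm i).aestronglyMeasurable).trans ?_
      rw [← integral_const_mul]
      refine integral_mono (hηL i).integrable_sq ((h.memLp_two i).integrable_sq.const_mul _)
        fun ω => ?_
      have := pow_le_pow_left₀ (abs_nonneg _) (hη2 i ω) 2
      rw [sq_abs, mul_pow δ, sq_abs] at this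
      exact this
    rw [Real.sqrt_le_left hδ0.le]
    calc _ = ∑ i, Var[η i; μ] := by rw [← h2]; exact h1
      _ ≤ ∑ i, δ ^ 2 * ∫ ω, ξ i ω ^ 2 ∂μ := Finset.sum_le_sum fun i _ => h3 i
      _ = δ ^ 2 := by rw [← Finset.mul_sum, h.var, mul_one]
  set E := ∫ ω, S ω ∂μ with hE
  -- the leave-one-out terms
  set G : ι → Ω → ℝ := fun i ω => ξ i ω * concFun c δ (W ω - ξ i ω) (Θ' i ω) with hG
  have hgm : ∀ i, Measurable fun ω => concFun c δ (W ω - ξ i ω) (Θ' i ω) := fun i =>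
    (measurable_concFun c δ).comp ((hWm.sub (h.meas i)).prodMk (hΘm' i))
  have hgL : ∀ i, MemLp (fun ω => concFun c δ (W ω - ξ i ω) (Θ' i ω)) 2 μ := fun i =>
    ((hΘ' i).norm.add (memLp_const (2 * δ))).mono' (hgm i).aestronglyMeasurable
      (ae_of_all _ fun ω => abs_concFun_le hδ0.le _ _ _)
  have hGi : ∀ i, Integrable (G i) μ := fun i => (h.memLp_two i).integrable_mul (hgL i)
  have hG0 : ∀ i, ∫ ω, G i ω ∂μ = 0 := by
    intro i
    have h1 := (hind i).comp (φ := id) (ψ := fun p : ℝ × ℝ => concFun c δ p.1 p.2) measurable_id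
      (measurable_concFun c δ)
    have h2 := h1.integral_mul_eq_mul_integral (h.meas i).aestronglyMeasurable
      (hgm i).aestronglyMeasurable
    refine h2.trans ?_
    simp [h.mean i]
  have hi1 : Integrable (fun ω => |W ω| * Θ ω) μ := h.memLp_sum.norm.integrable_mul hΘ
  have hi2 : Integrable (fun ω => |W ω|) μ := (h.memLp_sum.integrable (by norm_num)).abs
  have hi3 : ∀ i, Integrable (fun ω => |ξ i ω| * |Θ ω - Θ' i ω|) μ := fun i =>
    (h.memLp_two i).norm.integrable_mul (hΘ.sub (hΘ' i)).norm
  have hi4 : Integrable (fun ω => |S ω - E|) μ := (hSi.sub (integrable_const E)).abs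
  -- Pointwise form of the argument. In `W g = ∑ ξ_i g`, each term is `G i`, of mean zero, plus the
  -- cost of exchanging `Θ` for `Θ' i`, plus a nonnegative increment of `g`; on `A` these increments
  -- sum to at least `S ≥ E - |S - E|`.
  have key : ∀ ω, A.indicator (fun _ => E) ω ≤ |W ω| * Θ ω + 2 * δ * |W ω| - ∑ i, G i ω
      + ∑ i, |ξ i ω| * |Θ ω - Θ' i ω| + |S ω - E| := by
    intro ω
    set g := concFun c δ (W ω) (Θ ω)
    have k1 : W ω * g ≤ |W ω| * Θ ω + 2 * δ * |W ω| := by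
      have h1 := abs_concFun_le hδ0.le c (W ω) (Θ ω)
      rw [abs_of_nonneg (hΘ0 ω)] at h1
      have h2 := le_abs_self (W ω * g)
      rw [abs_mul] at h2
      nlinarith [mul_le_mul_of_nonneg_left h1 (abs_nonneg (W ω))]
    have k2 : W ω * g = ∑ i, ξ i ω * g := by rw [← Finset.sum_mul]
    have k3 : ∀ i, ξ i ω * (g - concFun c δ (W ω - ξ i ω) (Θ ω)) - |ξ i ω| * |Θ ω - Θ' i ω|
        ≤ ξ i ω * g - G i ω := by
      intro i
      have h1 := abs_concFun_sub_le c δ (W ω - ξ i ω) (Θ ω) (Θ' i ω)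
      have h2 := neg_abs_le (ξ i ω * (concFun c δ (W ω - ξ i ω) (Θ ω)
        - concFun c δ (W ω - ξ i ω) (Θ' i ω)))
      rw [abs_mul] at h2
      have h3 := mul_le_mul_of_nonneg_left h1 (abs_nonneg (ξ i ω))
      simp only [hG]
      nlinarith
    have k4 := Finset.sum_le_sum fun i (_ : i ∈ Finset.univ) => k3 i
    rw [Finset.sum_sub_distrib, Finset.sum_sub_distrib, ← k2] at k4
    have k5 : A.indicator (fun _ => E) ω - |S ω - E|
        ≤ ∑ i, ξ i ω * (g - concFun c δ (W ω - ξ i ω) (Θ ω)) := by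
      by_cases hω : ω ∈ A
      · rw [indicator_of_mem hω]
        have h1 : S ω ≤ ∑ i, ξ i ω * (g - concFun c δ (W ω - ξ i ω) (Θ ω)) := by
          rw [hS, Finset.sum_apply]
          exact Finset.sum_le_sum fun i _ => abs_mul_min_le_mul_concFun_sub hδ0.le hω.1 hω.2 _
        linarith [neg_abs_le (S ω - E)]
      · rw [indicator_of_notMem hω]
        have h1 : 0 ≤ ∑ i, ξ i ω * (g - concFun c δ (W ω - ξ i ω) (Θ ω)) :=
          Finset.sum_nonneg fun i _ => mul_concFun_sub_nonneg _ _ _ _ _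
        linarith [abs_nonneg (S ω - E)]
    linarith
  have hGs : Integrable (fun ω => ∑ i, G i ω) μ := integrable_finsetSum _ fun i _ => hGi i
  have hTs : Integrable (fun ω => ∑ i, |ξ i ω| * |Θ ω - Θ' i ω|) μ :=
    integrable_finsetSum _ fun i _ => hi3 i
  have j1 : Integrable (fun ω => |W ω| * Θ ω + 2 * δ * |W ω|) μ := hi1.add (hi2.const_mul (2 * δ))
  have j2 : Integrable (fun ω => |W ω| * Θ ω + 2 * δ * |W ω| - ∑ i, G i ω) μ := j1.sub hGs
  have j3 : Integrable (fun ω => |W ω| * Θ ω + 2 * δ * |W ω| - ∑ i, G i ω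
      + ∑ i, |ξ i ω| * |Θ ω - Θ' i ω|) μ := j2.add hTs
  have final := integral_mono ((integrable_const E).indicator hAm) (j3.add hi4) key
  simp only [Pi.add_apply] at final
  rw [integral_indicator_const _ hAm, integral_add j3 hi4,
    integral_add j2 hTs, integral_sub j1 hGs,
    integral_add hi1 (hi2.const_mul (2 * δ)), integral_const_mul,
    integral_finsetSum _ fun i _ => hGi i, integral_finsetSum _ fun i _ => hi3 i,
    Finset.sum_eq_zero fun i _ => hG0 i, smul_eq_mul] at final
  have hW1 : ∫ ω, |W ω| ∂μ ≤ 1 := h.integral_abs_sum_le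
  have hp : (0 : ℝ) ≤ μ.real A := measureReal_nonneg
  have := mul_le_mul_of_nonneg_left hES hp
  have := mul_le_mul_of_nonneg_left hW1 (mul_nonneg zero_le_two hδ0.le)
  linarith

end StdSum

/-! ### The Berry–Esseen theorem for sums and for nonlinear statistics -/

section BerryEsseen

variable {Ω : Type*} [MeasurableSpace Ω] {ι : Type*} [Fintype ι] {μ : Measure Ω}
  [IsProbabilityMeasure μ]

/-- By Fubini one may fix `X = x`, apply the concentration bound for `Y` at radius `|x|`, and
integrate in `x`. It handles the jump of the Stein derivative, with `X` a summand and `Y` the sum of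
the others. -/
lemma integral_mul_indicator_le_of_indepFun {X Y : Ω → ℝ} (hX : Measurable X) (hY : Measurable Y)
    (hXY : IndepFun X Y μ) {z a b : ℝ} {ψ : ℝ → ℝ} (hψ : Measurable ψ) (hψ0 : ∀ x, 0 ≤ ψ x)
    (hi1 : Integrable (fun ω => ψ (X ω)) μ) (hi2 : Integrable (fun ω => ψ (X ω) * |X ω|) μ)
    (hconc : ∀ x, μ.real {ω | |Y ω - z| ≤ |x|} ≤ a * |x| + b) :
    ∫ ω, ψ (X ω) * {p : ℝ × ℝ | |p.2 - z| ≤ |p.1|}.indicator 1 (X ω, Y ω) ∂μ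
      ≤ a * ∫ ω, ψ (X ω) * |X ω| ∂μ + b * ∫ ω, ψ (X ω) ∂μ := by
  have := Measure.isProbabilityMeasure_map (μ := μ) hX.aemeasurable
  have := Measure.isProbabilityMeasure_map (μ := μ) hY.aemeasurable
  set A : Set (ℝ × ℝ) := {p : ℝ × ℝ | |p.2 - z| ≤ |p.1|} with hA
  have hAm : MeasurableSet A := measurableSet_le (by fun_prop) (by fun_prop)
  set F : ℝ × ℝ → ℝ := fun p => ψ p.1 * A.indicator 1 p with hF
  have hFm : Measurable F := (hψ.comp measurable_fst).mul (measurable_one.indicator hAm)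
  have hFi : Integrable (fun ω => F (X ω, Y ω)) μ := by
    refine hi1.mono' (hFm.comp (hX.prodMk hY)).aestronglyMeasurable (ae_of_all _ fun ω => ?_)
    simp only [hF, norm_mul, Real.norm_eq_abs, abs_of_nonneg (hψ0 _)]
    refine mul_le_of_le_one_right (hψ0 _) ?_
    by_cases h : (X ω, Y ω) ∈ A <;> simp [h]
  have hprod := (indepFun_iff_map_prod_eq_prod_map_map hX.aemeasurable hY.aemeasurable).1 hXY
  have hFi' : Integrable F ((μ.map X).prod (μ.map Y)) := by
    rw [← hprod, integrable_map_measure hFm.aestronglyMeasurable (hX.prodMk hY).aemeasurable]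
    exact hFi
  have h1 : ∫ ω, F (X ω, Y ω) ∂μ = ∫ x, ∫ y, F (x, y) ∂(μ.map Y) ∂(μ.map X) := by
    rw [← integral_prod F hFi', ← hprod, integral_map (hX.prodMk hY).aemeasurable
      hFm.aestronglyMeasurable]
  have h2 : ∀ x, ∫ y, F (x, y) ∂(μ.map Y) = ψ x * μ.real {ω | |Y ω - z| ≤ |x|} := by
    intro x
    have hs : MeasurableSet {y : ℝ | |y - z| ≤ |x|} :=
      measurableSet_le (by fun_prop) (by fun_prop)
    have : (fun y => F (x, y)) = fun y => ψ x * {y : ℝ | |y - z| ≤ |x|}.indicator 1 y := rfl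
    rw [this, integral_const_mul, integral_indicator_one hs, map_measureReal_apply hY hs]
    rfl
  have h3 : ∫ x, ∫ y, F (x, y) ∂(μ.map Y) ∂(μ.map X)
      = ∫ ω, ∫ y, F (X ω, y) ∂(μ.map Y) ∂μ :=
    integral_map hX.aemeasurable hFi'.integral_prod_left.aestronglyMeasurable
  change ∫ ω, F (X ω, Y ω) ∂μ ≤ _
  rw [h1, h3, ← integral_const_mul, ← integral_const_mul,
    ← integral_add (hi2.const_mul a) (hi1.const_mul b)]
  refine integral_mono (hFi'.integral_prod_left.comp_measurable hX)
    ((hi2.const_mul a).add (hi1.const_mul b)) fun ω => ?_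
  simp only [h2]
  have := mul_le_mul_of_nonneg_left (hconc (X ω)) (hψ0 (X ω))
  linarith

namespace IsStdFamily

variable {ξ : ι → Ω → ℝ}

lemma measureReal_concentration_const (h : IsStdFamily μ ξ) (c : ℝ) {s : ℝ} (hs : 0 ≤ s) :
    μ.real {ω | c ≤ ∑ i, ξ i ω ∧ ∑ i, ξ i ω ≤ c + s} ≤ 2 * s + 3 * lyapunov μ ξ := by
  have := h.measureReal_concentration c (Θ := fun _ => s) (Θ' := fun _ _ => s) (fun _ => hs)
    (memLp_const s) measurable_const (fun _ => memLp_const s) (fun _ => measurable_const)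
    fun i => (h.indepFun_sub i).comp (φ := id) (ψ := fun x => (x, s)) measurable_id
      (measurable_id.prodMk measurable_const)
  simp only [sub_self, abs_zero, mul_zero, integral_zero, Finset.sum_const_zero,
    add_zero, integral_mul_const] at this
  nlinarith [h.integral_abs_sum_le]

lemma half_le_measureReal_abs_le (h : IsStdFamily μ ξ) (i : ι) :
    1 / 2 ≤ μ.real {ω | |ξ i ω| ≤ 2 * ∫ ω, |ξ i ω| ∂μ} := by
  have hi : Integrable (fun ω => |ξ i ω|) μ := ((h.memLp i).integrable (by norm_num)).abs
  have hm : MeasurableSet {ω | |ξ i ω| ≤ 2 * ∫ ω, |ξ i ω| ∂μ} :=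
    measurableSet_le (h.meas i).abs measurable_const
  set a := ∫ ω, |ξ i ω| ∂μ with ha
  -- Markov's inequality at level `2a` says nothing when `a = 0`, but then the summand vanishes
  -- almost surely.
  rcases (integral_nonneg fun ω => abs_nonneg (ξ i ω) : 0 ≤ ∫ ω, |ξ i ω| ∂μ).eq_or_lt with h0 | h0
  · have h1 := (integral_eq_zero_iff_of_nonneg (fun ω => abs_nonneg (ξ i ω)) hi).1 h0.symm
    have h2 : μ {ω | |ξ i ω| ≤ 2 * a} = 1 := by
      rw [prob_compl_eq_zero_iff hm |>.symm]
      refine measure_mono_null (fun ω hω => ?_) h1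
      simp only [mem_compl_iff, mem_ofPred_eq, ha, ← h0, mul_zero, not_le, abs_pos] at hω
      simpa using hω
    rw [measureReal_def, h2]
    norm_num
  · have h1 := mul_meas_ge_le_integral_of_nonneg (ae_of_all _ fun ω => abs_nonneg (ξ i ω)) hi (2 * a)
    have h2 : μ.real {ω | |ξ i ω| ≤ 2 * a}ᶜ ≤ μ.real {ω | 2 * a ≤ |ξ i ω|} :=
      measureReal_mono fun ω (hω : ¬ |ξ i ω| ≤ 2 * a) => (not_le.1 hω).le
    rw [probReal_compl_eq_one_sub hm] at h2
    change 0 < a at h0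
    have h3 : 2 * a * μ.real {ω | 2 * a ≤ |ξ i ω|} ≤ a := h1
    nlinarith

/-- The partial sum has variance below one, so the concentration inequality is not applied to it
directly. With probability at least `1/2`, and independently of the partial sum, `|ξ_i| ≤ K = 2
E|ξ_i|`; then the full sum is within `s + K` of `z`. Dividing by `1/2` doubles the constants. -/
lemma measureReal_concentration_erase (h : IsStdFamily μ ξ) (i : ι) (z : ℝ) {s : ℝ} (hs : 0 ≤ s) :
    μ.real {ω | |∑ j, ξ j ω - ξ i ω - z| ≤ s}
      ≤ 8 * s + (16 * ∫ ω, |ξ i ω| ∂μ + 6 * lyapunov μ ξ) := by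
  have h1 := h.half_le_measureReal_abs_le i
  have ha : 0 ≤ ∫ ω, |ξ i ω| ∂μ := integral_nonneg fun _ => abs_nonneg _
  set K := 2 * ∫ ω, |ξ i ω| ∂μ with hK
  have hB : MeasurableSet {x : ℝ | |x - z| ≤ s} := measurableSet_le (by fun_prop) (by fun_prop)
  have hC : MeasurableSet {x : ℝ | |x| ≤ K} := measurableSet_le (by fun_prop) (by fun_prop)
  have h2 := (h.indepFun_sub i).measure_inter_preimage_eq_mul _ _ hC hB
  have h3 : μ.real ({ω | |ξ i ω| ≤ K} ∩ {ω | |∑ j, ξ j ω - ξ i ω - z| ≤ s})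
      = μ.real {ω | |ξ i ω| ≤ K} * μ.real {ω | |∑ j, ξ j ω - ξ i ω - z| ≤ s} := by
    rw [measureReal_def, measureReal_def, measureReal_def, ← ENNReal.toReal_mul]
    exact congrArg ENNReal.toReal h2
  have h4 : μ.real ({ω | |ξ i ω| ≤ K} ∩ {ω | |∑ j, ξ j ω - ξ i ω - z| ≤ s})
      ≤ 2 * (2 * (s + K)) + 3 * lyapunov μ ξ := by
    refine le_trans (measureReal_mono fun ω hω => ?_)
      (h.measureReal_concentration_const (z - s - K) (by positivity))
    have e1 := abs_le.1 (show |ξ i ω| ≤ K from hω.1)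
    have e2 := abs_le.1 (show |∑ j, ξ j ω - ξ i ω - z| ≤ s from hω.2)
    constructor <;> linarith
  have h5 : 0 ≤ μ.real {ω | |∑ j, ξ j ω - ξ i ω - z| ≤ s} := measureReal_nonneg
  rw [h3] at h4
  nlinarith

lemma integral_abs_erase_le (h : IsStdFamily μ ξ) (i : ι) :
    ∫ ω, |∑ j, ξ j ω - ξ i ω| ∂μ ≤ 2 := by
  have h1 := h.integral_abs_sum_le
  have h2 : ∫ ω, |ξ i ω| ∂μ ≤ 1 :=
    (integral_abs_le_sqrt (h.memLp_two i)).trans (Real.sqrt_le_one.2 (h.integral_sq_le_one i))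
  have i1 : Integrable (fun ω => |∑ j, ξ j ω|) μ := (h.memLp_sum.integrable (by norm_num)).abs
  have i2 : Integrable (fun ω => |ξ i ω|) μ := ((h.memLp i).integrable (by norm_num)).abs
  calc ∫ ω, |∑ j, ξ j ω - ξ i ω| ∂μ ≤ ∫ ω, (|∑ j, ξ j ω| + |ξ i ω|) ∂μ :=
        integral_mono ((h.memLp_sum.sub (h.memLp_two i)).integrable (by norm_num)).abs (i1.add i2)
          fun ω => abs_sub _ _
    _ ≤ 2 := by rw [integral_add i1 i2]; linarith

/-- The error of replacing the `i`-th summand in the Stein equation. -/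
lemma integral_osc_le (h : IsStdFamily μ ξ) (z : ℝ) (i : ι) :
    Integrable (fun ω => (∫ ω, ξ i ω ^ 2 ∂μ + 4 * ξ i ω ^ 2) *
        steinOsc z (∑ j, ξ j ω - ξ i ω) (ξ i ω)) μ ∧
    ∫ ω, (∫ ω, ξ i ω ^ 2 ∂μ + 4 * ξ i ω ^ 2) * steinOsc z (∑ j, ξ j ω - ξ i ω) (ξ i ω) ∂μ
      ≤ 170 * ∫ ω, |ξ i ω| ^ 3 ∂μ + 30 * lyapunov μ ξ * ∫ ω, ξ i ω ^ 2 ∂μ := by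
  set v := ∫ ω, ξ i ω ^ 2 ∂μ with hv
  have hv0 : 0 ≤ v := integral_nonneg fun _ => sq_nonneg _
  set V : Ω → ℝ := fun ω => ∑ j, ξ j ω - ξ i ω with hV
  have hVm : Measurable V := h.measurable_sum.sub (h.meas i)
  have hVL : MemLp V 2 μ := h.memLp_sum.sub (h.memLp_two i)
  set ψ : ℝ → ℝ := fun x => v + 4 * x ^ 2 with hψ
  have i1 : Integrable (fun ω => |ξ i ω|) μ := ((h.memLp i).integrable (by norm_num)).abs
  have i2 : Integrable (fun ω => ξ i ω ^ 2) μ := (h.memLp_two i).integrable_sq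
  have i3 : Integrable (fun ω => |ξ i ω| ^ 3) μ :=
    MemLp.integrable_abs_pow (p := 3) (h.memLp i) (by norm_num)
  have i4 : Integrable (fun ω => ψ (ξ i ω)) μ := (integrable_const v).add (i2.const_mul 4)
  have e5 : ∀ ω, ψ (ξ i ω) * |ξ i ω| = v * |ξ i ω| + 4 * |ξ i ω| ^ 3 := by
    intro ω
    simp only [hψ]
    rw [← sq_abs (ξ i ω)]; ring
  have i5 : Integrable (fun ω => ψ (ξ i ω) * |ξ i ω|) μ := by
    simp_rw [e5]
    exact (i1.const_mul v).add (i3.const_mul 4)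
  have iV : Integrable (fun ω => |V ω|) μ := (hVL.integrable (by norm_num)).abs
  have iV' : Integrable (fun ω => 2 * |V ω| + 6) μ := (iV.const_mul 2).add (integrable_const 6)
  have hψm : Measurable ψ := by fun_prop
  have hind1 : IndepFun (fun ω => ψ (ξ i ω) * |ξ i ω|) (fun ω => 2 * |V ω| + 6) μ :=
    (h.indepFun_sub i).comp (φ := fun x => ψ x * |x|) (ψ := fun x => 2 * |x| + 6)
      (by fun_prop) (by fun_prop)
  have i6 : Integrable (fun ω => ψ (ξ i ω) * |ξ i ω| * (2 * |V ω| + 6)) μ :=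
    hind1.integrable_mul i5 iV'
  have e6 : ∫ ω, ψ (ξ i ω) * |ξ i ω| * (2 * |V ω| + 6) ∂μ
      = (∫ ω, ψ (ξ i ω) * |ξ i ω| ∂μ) * ∫ ω, (2 * |V ω| + 6) ∂μ :=
    hind1.integral_fun_mul_eq_mul_integral i5.aestronglyMeasurable iV'.aestronglyMeasurable
  have hAm : MeasurableSet {p : ℝ × ℝ | |p.2 - z| ≤ |p.1|} :=
    measurableSet_le (by fun_prop) (by fun_prop)
  have i7 : Integrable (fun ω => ψ (ξ i ω) *
      {p : ℝ × ℝ | |p.2 - z| ≤ |p.1|}.indicator 1 (ξ i ω, V ω)) μ := by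
    refine i4.mono' ((hψm.comp (h.meas i)).mul ((measurable_one.indicator hAm).comp
      ((h.meas i).prodMk hVm))).aestronglyMeasurable (ae_of_all _ fun ω => ?_)
    have h0 : 0 ≤ ψ (ξ i ω) := by simp only [hψ]; positivity
    simp only [norm_mul, Real.norm_eq_abs, abs_of_nonneg h0]
    refine mul_le_of_le_one_right h0 ?_
    by_cases h : (ξ i ω, V ω) ∈ {p : ℝ × ℝ | |p.2 - z| ≤ |p.1|} <;> simp only [h,
      indicator_of_mem, indicator_of_notMem, not_false_eq_true] <;> simp
  have e7 := integral_mul_indicator_le_of_indepFun (h.meas i) hVm (h.indepFun_sub i) (z := z)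
    hψm (fun x => by simp only [hψ]; positivity) i4 i5
    fun x => h.measureReal_concentration_erase i z (abs_nonneg x)
  have e8 : (fun ω => (v + 4 * ξ i ω ^ 2) * steinOsc z (∑ j, ξ j ω - ξ i ω) (ξ i ω))
      = fun ω => ψ (ξ i ω) * |ξ i ω| * (2 * |V ω| + 6) + ψ (ξ i ω) *
      {p : ℝ × ℝ | |p.2 - z| ≤ |p.1|}.indicator 1 (ξ i ω, V ω) := by
    ext ω
    simp only [steinOsc, hψ, hV]
    ring
  rw [e8]
  refine ⟨i6.add i7, ?_⟩
  rw [integral_add i6 i7, e6]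
  have b1 : v * ∫ ω, |ξ i ω| ∂μ ≤ ∫ ω, |ξ i ω| ^ 3 ∂μ := integral_sq_mul_integral_abs_le (h.memLp i)
  have b2 : ∫ ω, ψ (ξ i ω) * |ξ i ω| ∂μ ≤ 5 * ∫ ω, |ξ i ω| ^ 3 ∂μ := by
    simp_rw [e5]
    rw [integral_add (i1.const_mul v) (i3.const_mul 4), integral_const_mul, integral_const_mul]
    linarith
  have b3 : ∫ ω, (2 * |V ω| + 6) ∂μ ≤ 10 := by
    rw [integral_add (iV.const_mul 2) (integrable_const 6), integral_const_mul]
    have := h.integral_abs_erase_le i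
    simp only [integral_const, probReal_univ, smul_eq_mul, one_mul]
    linarith
  have b4 : ∫ ω, ψ (ξ i ω) ∂μ = 5 * v := by
    simp only [hψ]
    rw [integral_add (integrable_const v) (i2.const_mul 4), integral_const_mul]
    simp only [integral_const, probReal_univ, smul_eq_mul, one_mul, ← hv]
    ring
  have b5 : 0 ≤ ∫ ω, ψ (ξ i ω) * |ξ i ω| ∂μ :=
    integral_nonneg fun ω => mul_nonneg (by simp only [hψ]; positivity) (abs_nonneg _)
  -- The constants: `170 = 5 * 10` from the Lipschitz part, `+ 8 * 5 + 16 * 5` from the jump, where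
  -- `v E|ξ_i|` is absorbed by `b1`; and `30 = 6 * 5`.
  rw [b4] at e7
  have b6 := mul_le_mul_of_nonneg_left b3 b5
  nlinarith

/-- The Berry–Esseen theorem for sums of independent random variables. -/
theorem abs_measureReal_sum_le_sub_stdCDF_le (h : IsStdFamily μ ξ) (z : ℝ) :
    |μ.real {ω | ∑ i, ξ i ω ≤ z} - stdCDF z| ≤ 200 * lyapunov μ ξ := by
  set W : Ω → ℝ := fun ω => ∑ i, ξ i ω with hW
  have hWm : Measurable W := h.measurable_sum
  have hfm : Measurable (steinSol z) := (continuous_steinSol z).measurable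
  have hkm : Measurable (steinDer z) := measurable_steinDer z
  have hVm : ∀ i, Measurable fun ω => W ω - ξ i ω := fun i => hWm.sub (h.meas i)
  have bdd : ∀ {g : ℝ → ℝ} {X : Ω → ℝ} (C : ℝ), Measurable g → Measurable X → (∀ x, |g x| ≤ C) →
      MemLp (fun ω => g (X ω)) 2 μ := fun C hg hX hC =>
    (memLp_const C).mono' (hg.comp hX).aestronglyMeasurable (ae_of_all _ fun ω => hC _)
  have hk : ∀ {X : Ω → ℝ}, Measurable X → Integrable (fun ω => steinDer z (X ω)) μ := fun hX =>
    (bdd 2 hkm hX (abs_steinDer_le z)).integrable (by norm_num)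
  have hf : ∀ i {X : Ω → ℝ}, Measurable X → Integrable (fun ω => ξ i ω * steinSol z (X ω)) μ :=
    fun i X hX => (h.memLp_two i).integrable_mul (bdd 6 hfm hX (abs_steinSol_le z))
  -- the Stein equation in mean
  have s1 : μ.real {ω | W ω ≤ z} - stdCDF z
      = ∫ ω, steinDer z (W ω) ∂μ - ∑ i, ∫ ω, ξ i ω * steinSol z (W ω) ∂μ := by
    rw [← integral_finsetSum _ fun i _ => hf i hWm,
      ← integral_sub (hk hWm) (integrable_finsetSum _ fun i _ => hf i hWm)]
    have e : ∀ ω, steinDer z (W ω) - ∑ i, ξ i ω * steinSol z (W ω)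
        = {ω | W ω ≤ z}.indicator 1 ω - stdCDF z := by
      intro ω
      rw [← Finset.sum_mul, steinDer]
      change W ω * steinSol z (W ω) + {ω | W ω ≤ z}.indicator 1 ω - stdCDF z
        - W ω * steinSol z (W ω) = _
      ring
    have hm : MeasurableSet {ω | W ω ≤ z} := measurableSet_le hWm measurable_const
    simp_rw [e]
    have hi : Integrable ({ω | W ω ≤ z}.indicator (1 : Ω → ℝ)) μ :=
      (integrable_const (1 : ℝ)).indicator hm
    rw [integral_sub hi (integrable_const _), integral_indicator_one hm]
    simp
  have s2 : ∀ i, |(∫ ω, ξ i ω ^ 2 ∂μ) * ∫ ω, steinDer z (W ω) ∂μ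
      - ∫ ω, ξ i ω * steinSol z (W ω) ∂μ|
      ≤ 170 * ∫ ω, |ξ i ω| ^ 3 ∂μ + 30 * lyapunov μ ξ * ∫ ω, ξ i ω ^ 2 ∂μ := by
    intro i
    obtain ⟨o1, o2⟩ := h.integral_osc_le z i
    set v := ∫ ω, ξ i ω ^ 2 ∂μ with hv
    have hv0 : 0 ≤ v := integral_nonneg fun _ => sq_nonneg _
    have c1 : ∫ ω, ξ i ω * steinSol z (W ω - ξ i ω) ∂μ = 0 := by
      have := (h.indepFun_sub i).comp (φ := id) (ψ := steinSol z) measurable_id hfm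
      have := this.integral_fun_mul_eq_mul_integral (h.meas i).aestronglyMeasurable
        (hfm.comp (hVm i)).aestronglyMeasurable
      refine this.trans ?_
      simp [h.mean i]
    have hind := (h.indepFun_sub i).comp (φ := fun x => x ^ 2) (ψ := steinDer z)
      (by fun_prop) hkm
    have i2 : Integrable (fun ω => ξ i ω ^ 2 * steinDer z (W ω - ξ i ω)) μ :=
      hind.integrable_mul (h.memLp_two i).integrable_sq (hk (hVm i))
    have c2 : ∫ ω, ξ i ω ^ 2 * steinDer z (W ω - ξ i ω) ∂μ
        = v * ∫ ω, steinDer z (W ω - ξ i ω) ∂μ :=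
      hind.integral_fun_mul_eq_mul_integral ((h.meas i).pow_const 2).aestronglyMeasurable
        (hkm.comp (hVm i)).aestronglyMeasurable
    -- With `V = W - ξ_i` independent of `ξ_i`, one has `E ξ_i f(V) = 0` and `E ξ_i² f'(V) = v E
    -- f'(V)`. Inserting these leaves an increment of `f'` and a first order Taylor remainder of
    -- `f`, both controlled by `steinOsc`.
    have c3 : v * ∫ ω, steinDer z (W ω) ∂μ - ∫ ω, ξ i ω * steinSol z (W ω) ∂μ
        = ∫ ω, (v * (steinDer z (W ω) - steinDer z (W ω - ξ i ω)) -
          (ξ i ω * steinSol z (W ω) - ξ i ω * steinSol z (W ω - ξ i ω)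
            - ξ i ω ^ 2 * steinDer z (W ω - ξ i ω))) ∂μ := by
      have j1 : Integrable (fun ω => ξ i ω * steinSol z (W ω)
        - ξ i ω * steinSol z (W ω - ξ i ω)) μ := (hf i hWm).sub (hf i (hVm i))
      have j2 : Integrable (fun ω => steinDer z (W ω) - steinDer z (W ω - ξ i ω)) μ :=
        (hk hWm).sub (hk (hVm i))
      have j3 : Integrable (fun ω => ξ i ω * steinSol z (W ω) - ξ i ω * steinSol z (W ω - ξ i ω)
        - ξ i ω ^ 2 * steinDer z (W ω - ξ i ω)) μ := j1.sub i2
      rw [integral_sub (j2.const_mul v) j3, integral_sub j1 i2, integral_const_mul,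
        integral_sub (hk hWm) (hk (hVm i)), integral_sub (hf i hWm) (hf i (hVm i)), c1, c2]
      ring
    rw [c3, ← Real.norm_eq_abs]
    refine (norm_integral_le_of_norm_le o1 (ae_of_all _ fun ω => ?_)).trans o2
    set V := W ω - ξ i ω with hV
    have hWV : W ω = V + ξ i ω := by rw [hV]; ring
    change ‖_‖ ≤ (v + 4 * ξ i ω ^ 2) * steinOsc z V (ξ i ω)
    rw [Real.norm_eq_abs, hWV]
    have d1 := abs_steinDer_sub_le z V (ξ i ω)
    have d2 := abs_steinSol_sub_sub_le z V (ξ i ω)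
    have d3 : ξ i ω * steinSol z (V + ξ i ω) - ξ i ω * steinSol z V - ξ i ω ^ 2 * steinDer z V
        = ξ i ω * (steinSol z (V + ξ i ω) - steinSol z V - ξ i ω * steinDer z V) := by ring
    rw [d3]
    refine (abs_sub _ _).trans ?_
    rw [abs_mul, abs_mul, abs_of_nonneg hv0, add_mul]
    refine add_le_add (mul_le_mul_of_nonneg_left d1 hv0) ?_
    refine (mul_le_mul_of_nonneg_left d2 (abs_nonneg _)).trans (le_of_eq ?_)
    rw [← sq_abs (ξ i ω)]
    ring
  -- As the variances sum to one, `E f'(W)` can be shared out among the summands in proportion to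
  -- them.
  have s3 : μ.real {ω | W ω ≤ z} - stdCDF z = ∑ i, ((∫ ω, ξ i ω ^ 2 ∂μ) * ∫ ω, steinDer z (W ω) ∂μ
      - ∫ ω, ξ i ω * steinSol z (W ω) ∂μ) := by
    rw [Finset.sum_sub_distrib, ← Finset.sum_mul, h.var, one_mul, s1]
  rw [s3]
  refine (Finset.abs_sum_le_sum_abs _ _).trans ((Finset.sum_le_sum fun i _ => s2 i).trans ?_)
  rw [Finset.sum_add_distrib, ← Finset.mul_sum, ← Finset.mul_sum, h.var]
  change 170 * lyapunov μ ξ + _ ≤ _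
  linarith

/-- The Berry–Esseen theorem for a standardized sum perturbed by a nonlinear term `Δ`, where
`Δ' i` approximates `Δ` and does not depend on the `i`-th summand. -/
theorem abs_measureReal_add_le_sub_stdCDF_le (h : IsStdFamily μ ξ) {Δ : Ω → ℝ} {Δ' : ι → Ω → ℝ}
    (hΔ : MemLp Δ 2 μ) (hΔm : Measurable Δ) (hΔ' : ∀ i, MemLp (Δ' i) 2 μ)
    (hΔm' : ∀ i, Measurable (Δ' i))
    (hind : ∀ i, IndepFun (ξ i) (fun ω => (∑ j, ξ j ω - ξ i ω, Δ' i ω)) μ) (z : ℝ) :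
    |μ.real {ω | ∑ i, ξ i ω + Δ ω ≤ z} - stdCDF z| ≤
      203 * lyapunov μ ξ + 2 * ∫ ω, |∑ i, ξ i ω| * |Δ ω| ∂μ
        + 2 * ∑ i, ∫ ω, |ξ i ω| * |Δ ω - Δ' i ω| ∂μ := by
  have h0 := abs_le.1 (h.abs_measureReal_sum_le_sub_stdCDF_le z)
  have hsum : ∑ i, ∫ ω, |ξ i ω| * abs (|Δ ω| - |Δ' i ω|) ∂μ
      ≤ ∑ i, ∫ ω, |ξ i ω| * |Δ ω - Δ' i ω| ∂μ := by
    refine Finset.sum_le_sum fun i _ => integral_mono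
      ((h.memLp_two i).norm.integrable_mul (hΔ.norm.sub (hΔ' i).norm).norm)
      ((h.memLp_two i).norm.integrable_mul (hΔ.sub (hΔ' i)).norm) fun ω => ?_
    exact mul_le_mul_of_nonneg_left (abs_abs_sub_abs_le_abs_sub _ _) (abs_nonneg _)
  have h1 := h.measureReal_concentration z (Θ := fun ω => |Δ ω|) (Θ' := fun i ω => |Δ' i ω|)
    (fun _ => abs_nonneg _) hΔ.norm hΔm.abs (fun i => (hΔ' i).norm) (fun i => (hΔm' i).abs)
    fun i => (hind i).comp (φ := id) (ψ := fun p : ℝ × ℝ => (p.1, |p.2|)) measurable_id (by fun_prop)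
  -- The interval `[z - |Δ|, z]` becomes one with a deterministic left end, as the concentration
  -- inequality requires, after a change of sign.
  have h2 := h.neg.measureReal_concentration (-z) (Θ := fun ω => |Δ ω|)
    (Θ' := fun i ω => |Δ' i ω|)
    (fun _ => abs_nonneg _) hΔ.norm hΔm.abs (fun i => (hΔ' i).norm) (fun i => (hΔm' i).abs)
    fun i => ((hind i).comp (φ := fun x : ℝ => -x) (ψ := fun p : ℝ × ℝ => (-p.1, |p.2|)) (by fun_prop)
      (by fun_prop)).congr (by rfl) (Eventually.of_forall fun ω => by
        simp only [Function.comp_apply, Finset.sum_neg_distrib]; congr 1; ring)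
  have hl : lyapunov μ (fun i ω => -ξ i ω) = lyapunov μ ξ := by simp [lyapunov]
  simp only [Finset.sum_neg_distrib, abs_neg, hl] at h2
  have h3 : μ.real {ω | ∑ i, ξ i ω + Δ ω ≤ z} ≤ μ.real {ω | ∑ i, ξ i ω ≤ z}
      + μ.real {ω | z ≤ ∑ i, ξ i ω ∧ ∑ i, ξ i ω ≤ z + |Δ ω|} := by
    refine (measureReal_mono fun ω hω => ?_).trans (measureReal_union_le _ _)
    simp only [mem_ofPred_eq, mem_union] at hω ⊢
    rcases le_total (∑ i, ξ i ω) z with hz | hz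
    · exact Or.inl hz
    · exact Or.inr ⟨hz, by linarith [neg_abs_le (Δ ω)]⟩
  have h4 : μ.real {ω | ∑ i, ξ i ω ≤ z} ≤ μ.real {ω | ∑ i, ξ i ω + Δ ω ≤ z}
      + μ.real {ω | -z ≤ -∑ i, ξ i ω ∧ -∑ i, ξ i ω ≤ -z + |Δ ω|} := by
    refine (measureReal_mono fun ω hω => ?_).trans (measureReal_union_le _ _)
    simp only [mem_ofPred_eq, mem_union] at hω ⊢
    rcases le_total (∑ i, ξ i ω + Δ ω) z with hz | hz
    · exact Or.inl hz
    · exact Or.inr ⟨by linarith, by linarith [le_abs_self (Δ ω)]⟩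
  rw [abs_le]
  constructor <;> linarith

end IsStdFamily

end BerryEsseen

/-! ### Resampling coordinates of a product measure -/

lemma MeasurePreserving.integral_comp_ae {α β : Type*} [MeasurableSpace α] [MeasurableSpace β]
    {μ : Measure α} {ν : Measure β} {f : α → β} (hf : MeasurePreserving f μ ν) {g : β → ℝ}
    (hg : AEStronglyMeasurable g ν) : ∫ x, g (f x) ∂μ = ∫ y, g y ∂ν := by
  rw [← hf.map_eq] at hg ⊢
  exact (integral_map hf.aemeasurable hg).symm

section Resampling

variable {𝒴 : Type*} [MeasurableSpace 𝒴] {ν : Measure 𝒴} [IsProbabilityMeasure ν]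
  {ι κ : Type*} [Fintype ι] [Fintype κ]

lemma measurePreserving_piecewise [DecidableEq ι] (T : Finset ι) :
    MeasurePreserving (fun p : (ι → 𝒴) × (ι → 𝒴) => T.piecewise p.2 p.1)
      ((Measure.pi fun _ => ν).prod (Measure.pi fun _ => ν)) (Measure.pi fun _ => ν) := by
  have hm : Measurable fun p : (ι → 𝒴) × (ι → 𝒴) => T.piecewise p.2 p.1 := by
    refine measurable_pi_lambda _ fun i => ?_
    by_cases hi : i ∈ T
    · simp only [hi, Finset.piecewise_eq_of_mem]; fun_prop
    · simp only [hi, not_false_eq_true, Finset.piecewise_eq_of_notMem]; fun_prop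
  refine ⟨hm, (Measure.pi_eq fun s hs => ?_).symm⟩
  rw [Measure.map_apply hm (MeasurableSet.univ_pi hs)]
  have : (fun p : (ι → 𝒴) × (ι → 𝒴) => T.piecewise p.2 p.1) ⁻¹' univ.pi s
      = univ.pi (fun i => if i ∈ T then univ else s i) ×ˢ
        univ.pi (fun i => if i ∈ T then s i else univ) := by
    ext p
    simp only [mem_preimage, Set.mem_pi, mem_univ, forall_const, mem_prod]
    rw [← forall_and]
    refine forall_congr' fun i => ?_
    by_cases hi : i ∈ T <;> simp [hi]
  rw [this, Measure.prod_prod, Measure.pi_pi, Measure.pi_pi, ← Finset.prod_mul_distrib]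
  refine Finset.prod_congr rfl fun i _ => ?_
  by_cases hi : i ∈ T <;> simp [hi]

/-- `ell1` integrates over all `r` arguments with one of them overwritten; this lemma turns such
integrals into integrals of the kernel under its own law. -/
lemma measurePreserving_update [DecidableEq ι] (a : ι) :
    MeasurePreserving (fun p : (ι → 𝒴) × 𝒴 => Function.update p.1 a p.2)
      ((Measure.pi fun _ => ν).prod ν) (Measure.pi fun _ => ν) := by
  have hm : Measurable fun p : (ι → 𝒴) × 𝒴 => Function.update p.1 a p.2 := measurable_update'
  refine ⟨hm, (Measure.pi_eq fun s hs => ?_).symm⟩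
  rw [Measure.map_apply hm (MeasurableSet.univ_pi hs)]
  have : (fun p : (ι → 𝒴) × 𝒴 => Function.update p.1 a p.2) ⁻¹' univ.pi s
      = univ.pi (Function.update s a univ) ×ˢ s a := by
    ext p
    simp only [mem_preimage, Set.mem_pi, mem_univ, forall_const, mem_prod]
    constructor
    · intro h
      refine ⟨fun i => ?_, by simpa using h a⟩
      by_cases hi : i = a
      · subst hi; simp
      · simpa [hi] using h i
    · rintro ⟨h1, h2⟩ i
      by_cases hi : i = a
      · subst hi; simpa using h2
      · simpa [hi] using h1 i
  rw [this, Measure.prod_prod, Measure.pi_pi, ← Finset.prod_erase_mul _ _ (Finset.mem_univ a),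
    ← Finset.prod_erase_mul Finset.univ (fun i => ν (s i)) (Finset.mem_univ a),
    Function.update_self, measure_univ, mul_one]
  congr 1
  exact Finset.prod_congr rfl fun i hi => by
    rw [Function.update_of_ne (Finset.ne_of_mem_erase hi)]

lemma measurePreserving_comp_injective {i : κ → ι} (hi : Function.Injective i) :
    MeasurePreserving (fun (y : ι → 𝒴) k => y (i k)) (Measure.pi fun _ => ν)
      (Measure.pi fun _ => ν) := by
  have hm : Measurable fun (y : ι → 𝒴) k => y (i k) :=
    measurable_pi_lambda _ fun k => measurable_pi_apply _
  refine ⟨hm, (Measure.pi_eq fun s hs => ?_).symm⟩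
  rw [Measure.map_apply hm (MeasurableSet.univ_pi hs)]
  have : (fun (y : ι → 𝒴) k => y (i k)) ⁻¹' univ.pi s
      = univ.pi (Function.extend i s fun _ => univ) := by
    ext y
    simp only [mem_preimage, Set.mem_pi, mem_univ, forall_const]
    constructor
    · intro h j
      by_cases hj : ∃ k, i k = j
      · obtain ⟨k, rfl⟩ := hj
        rw [hi.extend_apply]
        exact h k
      · rw [Function.extend_apply' _ _ _ hj]
        exact mem_univ _
    · intro h k
      have := h (i k)
      rwa [hi.extend_apply] at this
  rw [this, Measure.pi_pi]
  refine (Fintype.prod_of_injective i hi _ _ (fun j hj => ?_) fun k => ?_).symm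
  · rw [Function.extend_apply' _ _ _ hj, measure_univ]
  · rw [hi.extend_apply]

end Resampling

/-! ### Second moments of degenerate U-statistics -/

section Degenerate

variable {𝒴 : Type*} [MeasurableSpace 𝒴] {ν : Measure 𝒴} [IsProbabilityMeasure ν] {r n : ℕ}

/-- A kernel with mean zero given any one of its arguments. -/
def IsDegenerate (ν : Measure 𝒴) (R : (Fin r → 𝒴) → ℝ) : Prop :=
  ∀ a : Fin r, ∀ᵐ y ∂ν, ∫ v, R (Function.update v a y) ∂(Measure.pi fun _ => ν) = 0

/-- Resample every coordinate read by `i` except at position `a`. This preserves the law and leaves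
the factor of `j` alone, so the integral over the fresh coordinates is that factor times a
conditional mean of `R` given one argument, which is zero. -/
lemma integral_mul_eq_zero_of_isDegenerate {R : (Fin r → 𝒴) → ℝ}
    (hR : MemLp R 2 (Measure.pi fun _ => ν)) (hRm : Measurable R) (hdeg : IsDegenerate ν R)
    {i j : Fin r → Fin n} (hi : Function.Injective i) (hj : Function.Injective j) (a : Fin r)
    (ha : ∀ b, b ≠ a → ∀ c, i b ≠ j c) :
    ∫ y, R (fun k => y (i k)) * R (fun k => y (j k)) ∂(Measure.pi fun _ : Fin n => ν) = 0 := by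
  classical
  set T : Finset (Fin n) := (Finset.univ.erase a).image i with hT
  have hΦ := measurePreserving_piecewise (ν := ν) T
  have hRi : MemLp (fun y : Fin n → 𝒴 => R (fun k => y (i k))) 2 (Measure.pi fun _ => ν) :=
    hR.comp_measurePreserving (measurePreserving_comp_injective hi)
  have hRj : MemLp (fun y : Fin n → 𝒴 => R (fun k => y (j k))) 2 (Measure.pi fun _ => ν) :=
    hR.comp_measurePreserving (measurePreserving_comp_injective hj)
  have hF : Integrable (fun y : Fin n → 𝒴 => R (fun k => y (i k)) * R (fun k => y (j k)))
      (Measure.pi fun _ => ν) := hRi.integrable_mul hRj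
  have hFΦ := hΦ.integrable_comp_of_integrable hF
  rw [← MeasurePreserving.integral_comp_ae hΦ hF.aestronglyMeasurable]
  rw [Function.comp_def] at hFΦ
  rw [integral_prod _ hFΦ]
  refine integral_eq_zero_of_ae ?_
  have hae : ∀ᵐ y ∂(Measure.pi fun _ : Fin n => ν),
      ∫ v, R (Function.update v a (y (i a))) ∂(Measure.pi fun _ => ν) = 0 :=
    (measurePreserving_eval (fun _ : Fin n => ν) (i a)).quasiMeasurePreserving.ae (hdeg a)
  filter_upwards [hae] with y hy
  have e1 : ∀ v : Fin n → 𝒴, (fun k => T.piecewise v y (j k)) = fun k => y (j k) := by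
    intro v
    ext k
    refine Finset.piecewise_eq_of_notMem _ _ _ fun hk => ?_
    obtain ⟨b, hb, hbk⟩ := Finset.mem_image.1 hk
    exact ha b (Finset.ne_of_mem_erase hb) k hbk
  have e2 : ∀ v : Fin n → 𝒴, (fun k => T.piecewise v y (i k))
      = Function.update (fun k => v (i k)) a (y (i a)) := by
    intro v
    ext k
    by_cases hk : k = a
    · subst hk
      rw [Function.update_self]
      refine Finset.piecewise_eq_of_notMem _ _ _ fun hk => ?_
      obtain ⟨b, hb, hbk⟩ := Finset.mem_image.1 hk
      exact Finset.ne_of_mem_erase hb (hi hbk)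
    · rw [Function.update_of_ne hk]
      exact Finset.piecewise_eq_of_mem _ _ _
        (Finset.mem_image_of_mem _ (Finset.mem_erase.2 ⟨hk, Finset.mem_univ _⟩))
  simp only [e1, e2]
  rw [integral_mul_const]
  have hmu : Measurable fun v : Fin r → 𝒴 => R (Function.update v a (y (i a))) :=
    hRm.comp measurable_update_left
  rw [MeasurePreserving.integral_comp_ae (measurePreserving_comp_injective (ν := ν) hi)
    (g := fun v => R (Function.update v a (y (i a)))) hmu.aestronglyMeasurable, hy, zero_mul]
  rfl

/-- Two tuples of indices that share at least two indices. -/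
def Overlap (i j : Fin r → Fin n) : Prop :=
  ∃ a a' b b', a ≠ a' ∧ b ≠ b' ∧ i a = j b ∧ i a' = j b'

lemma integral_mul_eq_zero_of_not_overlap [NeZero r] {R : (Fin r → 𝒴) → ℝ}
    (hR : MemLp R 2 (Measure.pi fun _ => ν)) (hRm : Measurable R) (hdeg : IsDegenerate ν R)
    {i j : Fin r → Fin n} (hi : Function.Injective i) (hj : Function.Injective j)
    (hij : ¬ Overlap i j) :
    ∫ y, R (fun k => y (i k)) * R (fun k => y (j k)) ∂(Measure.pi fun _ : Fin n => ν) = 0 := by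
  by_cases h : ∃ a b, i a = j b
  · obtain ⟨a, b, hab⟩ := h
    refine integral_mul_eq_zero_of_isDegenerate hR hRm hdeg hi hj a fun a' ha' b' hab' => hij ?_
    refine ⟨a', a, b', b, ha', ?_, hab', hab⟩
    rintro rfl
    exact ha' (hi (hab'.trans hab.symm))
  · push Not at h
    exact integral_mul_eq_zero_of_isDegenerate hR hRm hdeg hi hj 0 fun b _ c => h b c

/-- Overwriting the two prescribed values with arbitrary ones is injective into all tuples. The form
with `n ^ 2` on the left avoids the exponent `r - 2` in the natural numbers. -/
lemma card_filter_two_values (x x' : Fin n) {b b' : Fin r} (hb : b ≠ b') :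
    (Finset.univ.filter fun j : Fin r → Fin n => x = j b ∧ x' = j b').card * n ^ 2 ≤ n ^ r := by
  classical
  have h : Function.Injective fun p : (Fin n × Fin n) ×
      {j : Fin r → Fin n // x = j b ∧ x' = j b'} =>
      Function.update (Function.update p.2.1 b p.1.1) b' p.1.2 := by
    rintro ⟨⟨s, t⟩, j, hj1, hj2⟩ ⟨⟨s', t'⟩, j', hj1', hj2'⟩ he
    have h1 := congrFun he b
    have h2 := congrFun he b'
    simp only [Function.update_self, Function.update_of_ne hb] at h1 h2
    subst h1 h2
    simp only [Prod.mk.injEq, true_and, Subtype.mk.injEq]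
    ext k : 1
    by_cases hk : k = b
    · subst hk; rw [← hj1, ← hj1']
    · by_cases hk' : k = b'
      · subst hk'; rw [← hj2, ← hj2']
      · simpa [hk, hk'] using congrFun he k
  have := Fintype.card_le_of_injective _ h
  simp only [Fintype.card_prod, Fintype.card_fin, Fintype.card_subtype, Fintype.card_pi,
    Finset.prod_const, Finset.card_univ] at this
  linarith

open Classical in
lemma card_overlap_le (i : Fin r → Fin n) :
    (Finset.univ.filter fun j => Overlap i j).card * n ^ 2 ≤ r ^ 4 * n ^ r := by
  let Q : Finset (Fin r × Fin r × Fin r × Fin r) :=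
    Finset.univ.filter fun q => q.2.2.1 ≠ q.2.2.2
  have h1 : (Finset.univ.filter fun j => Overlap i j) ⊆ Q.biUnion fun q =>
      Finset.univ.filter fun j => i q.1 = j q.2.2.1 ∧ i q.2.1 = j q.2.2.2 := by
    intro j hj
    obtain ⟨a, a', b, b', -, hb, h1, h2⟩ := (Finset.mem_filter.1 hj).2
    exact Finset.mem_biUnion.2 ⟨(a, a', b, b'), by simp [Q, hb], by simp [h1, h2]⟩
  calc _ ≤ (∑ q ∈ Q, (Finset.univ.filter fun j : Fin r → Fin n =>
        i q.1 = j q.2.2.1 ∧ i q.2.1 = j q.2.2.2).card) * n ^ 2 :=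
        Nat.mul_le_mul_right _ ((Finset.card_le_card h1).trans Finset.card_biUnion_le)
    _ ≤ ∑ _q ∈ Q, n ^ r := by
        rw [Finset.sum_mul]
        exact Finset.sum_le_sum fun q hq =>
          card_filter_two_values _ _ (Finset.mem_filter.1 hq).2
    _ = Q.card * n ^ r := by rw [Finset.sum_const, smul_eq_mul]
    _ ≤ r ^ 4 * n ^ r := by
        refine Nat.mul_le_mul_right _ ((Finset.card_le_univ Q).trans (le_of_eq ?_))
        simp only [Fintype.card_prod, Fintype.card_fin]
        ring

/-- The second moment of a sum of values of a degenerate kernel. -/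
lemma integral_sum_sq_le_of_isDegenerate [NeZero r] {R : (Fin r → 𝒴) → ℝ}
    (hR : MemLp R 2 (Measure.pi fun _ => ν)) (hRm : Measurable R) (hdeg : IsDegenerate ν R)
    (S : Finset (Fin r → Fin n)) (hS : ∀ i ∈ S, Function.Injective i) :
    (∫ y, (∑ i ∈ S, R (fun k => y (i k))) ^ 2 ∂(Measure.pi fun _ : Fin n => ν)) * n ^ 2
      ≤ S.card * (r ^ 4 * n ^ r) * ∫ v, R v ^ 2 ∂(Measure.pi fun _ => ν) := by
  classical
  set E := ∫ v, R v ^ 2 ∂(Measure.pi fun _ : Fin r => ν) with hE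
  have hE0 : 0 ≤ E := integral_nonneg fun _ => sq_nonneg _
  have hL : ∀ i ∈ S, MemLp (fun y : Fin n → 𝒴 => R (fun k => y (i k))) 2
      (Measure.pi fun _ => ν) := fun i hi =>
    hR.comp_measurePreserving (measurePreserving_comp_injective (hS i hi))
  have hEi : ∀ i ∈ S, ∫ y : Fin n → 𝒴, R (fun k => y (i k)) ^ 2 ∂(Measure.pi fun _ => ν) = E :=
    fun i hi => MeasurePreserving.integral_comp_ae (measurePreserving_comp_injective (ν := ν)
      (hS i hi)) (g := fun v => R v ^ 2)
        (hRm.pow_const 2).aestronglyMeasurable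
  have hI : ∀ i ∈ S, ∀ j ∈ S, Integrable (fun y : Fin n → 𝒴 =>
      R (fun k => y (i k)) * R (fun k => y (j k))) (Measure.pi fun _ => ν) :=
    fun i hi j hj => (hL i hi).integrable_mul (hL j hj)
  have h1 : ∀ i ∈ S, ∀ j ∈ S,
      ∫ y, R (fun k => y (i k)) * R (fun k => y (j k)) ∂(Measure.pi fun _ : Fin n => ν)
        ≤ if Overlap i j then E else 0 := by
    intro i hi j hj
    split_ifs with hij
    -- Overlapping pairs are only bounded, by `xy ≤ (x² + y²) / 2`; the gain comes from there being
    -- few of them.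
    · have h2 : ∀ y : Fin n → 𝒴, R (fun k => y (i k)) * R (fun k => y (j k))
          ≤ 1 / 2 * R (fun k => y (i k)) ^ 2 + 1 / 2 * R (fun k => y (j k)) ^ 2 := fun y => by
        nlinarith [sq_nonneg (R (fun k => y (i k)) - R (fun k => y (j k)))]
      have i1 := (hL i hi).integrable_sq.const_mul (1 / 2)
      have i2 := (hL j hj).integrable_sq.const_mul (1 / 2)
      have h3 := integral_mono ((hL i hi).integrable_mul (hL j hj)) (i1.add i2) h2
      refine h3.trans (le_of_eq ?_)
      simp only [Pi.add_apply]
      rw [integral_add i1 i2, integral_const_mul, integral_const_mul, hEi i hi, hEi j hj]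
      ring
    · exact (integral_mul_eq_zero_of_not_overlap hR hRm hdeg (hS i hi) (hS j hj) hij).le
  have h2 : ∫ y, (∑ i ∈ S, R (fun k => y (i k))) ^ 2 ∂(Measure.pi fun _ : Fin n => ν)
      ≤ ∑ i ∈ S, ∑ j ∈ S, if Overlap i j then E else 0 := by
    simp_rw [sq, Finset.sum_mul_sum]
    rw [integral_finsetSum _ fun i hi => integrable_finsetSum _ fun j hj =>
      hI i hi j hj]
    refine Finset.sum_le_sum fun i hi => ?_
    rw [integral_finsetSum _ fun j hj => hI i hi j hj]
    exact Finset.sum_le_sum fun j hj => h1 i hi j hj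
  have h3 : ∀ i ∈ S, (∑ j ∈ S, if Overlap i j then E else 0) * (n : ℝ) ^ 2
      ≤ r ^ 4 * n ^ r * E := by
    intro i _
    rw [← Finset.sum_filter, Finset.sum_const, nsmul_eq_mul, mul_right_comm]
    refine mul_le_mul_of_nonneg_right ?_ hE0
    have := (Nat.mul_le_mul_right (n ^ 2) (Finset.card_le_card
      (Finset.filter_subset_filter (Overlap i) (Finset.subset_univ S)))).trans (card_overlap_le i)
    exact_mod_cast this
  calc _ ≤ (∑ i ∈ S, ∑ j ∈ S, if Overlap i j then E else 0) * (n : ℝ) ^ 2 := by gcongr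
    _ ≤ ∑ i ∈ S, r ^ 4 * n ^ r * E := by rw [Finset.sum_mul]; exact Finset.sum_le_sum h3
    _ = _ := by rw [Finset.sum_const, nsmul_eq_mul]; ring

end Degenerate

/-! ### Counting increasing tuples -/

section Counting

variable {r n : ℕ}

open Classical in
/-- The increasing tuples of indices, over which the U-statistic averages. -/
noncomputable def incTuples (r n : ℕ) : Finset (Fin r → Fin n) :=
  Finset.univ.filter StrictMono

lemma mem_incTuples {i : Fin r → Fin n} : i ∈ incTuples r n ↔ StrictMono i := by
  simp [incTuples]

lemma injective_of_mem_incTuples {i : Fin r → Fin n} (hi : i ∈ incTuples r n) :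
    Function.Injective i :=
  (mem_incTuples.1 hi).injective

lemma sum_incTuples (G : Finset (Fin n) → ℝ) :
    ∑ i ∈ incTuples r n, G (Finset.univ.image i) = ∑ s ∈ Finset.univ.powersetCard r, G s := by
  refine Finset.sum_bij' (fun i _ => Finset.univ.image i)
    (fun s hs => s.orderEmbOfFin (Finset.mem_powersetCard.1 hs).2) ?_ ?_ ?_ ?_ ?_
  · intro i hi
    rw [Finset.mem_powersetCard]
    exact ⟨Finset.subset_univ _, by
      rw [Finset.card_image_of_injective _ (mem_incTuples.1 hi).injective]; simp⟩
  · intro s hs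
    exact mem_incTuples.2 (s.orderEmbOfFin _).strictMono
  · intro i hi
    exact (Finset.orderEmbOfFin_unique _ (fun x => Finset.mem_image_of_mem _ (Finset.mem_univ x))
      (mem_incTuples.1 hi)).symm
  · intro s hs
    exact Finset.image_orderEmbOfFin_univ _ _
  · intro i hi
    rfl

lemma card_incTuples : ((incTuples r n).card : ℝ) = n.choose r := by
  have := sum_incTuples (r := r) (n := n) fun _ => 1
  simpa using this

/-- By Pascal's rule, the sets that contain `l` number `C(n - 1, r)`. -/
lemma card_powersetCard_mem (l : Fin n) :
    (((Finset.univ.powersetCard (r + 1)).filter fun s => l ∈ s).card : ℝ) * n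
      = (r + 1) * n.choose (r + 1) := by
  obtain ⟨n, rfl⟩ : ∃ k, n = k + 1 := ⟨n - 1, by have := l.pos; omega⟩
  have h1 : (Finset.univ.powersetCard (r + 1)).filter (fun s => l ∉ s)
      = (Finset.univ.erase l).powersetCard (r + 1) := by
    ext s
    simp only [Finset.mem_filter, Finset.mem_powersetCard, Finset.subset_univ, true_and,
      Finset.subset_erase]
    tauto
  have h2 := Finset.card_filter_add_card_filter_not
    (s := (Finset.univ : Finset (Fin (n + 1))).powersetCard (r + 1)) fun s => l ∈ s
  rw [h1, Finset.card_powersetCard, Finset.card_powersetCard, Finset.card_erase_of_mem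
    (Finset.mem_univ l), Finset.card_univ, Fintype.card_fin, Nat.add_sub_cancel,
    Nat.choose_succ_succ, add_left_inj] at h2
  rw [h2]
  have := Nat.add_one_mul_choose_eq n r
  have h3 : n.choose r * (n + 1) = (r + 1) * (n + 1).choose (r + 1) := by linarith
  exact_mod_cast h3

/-- Each index lies in the fraction `r / n` of all `r`-subsets. This turns the projected part of the
U-statistic into `r / n` times a plain sum. -/
lemma sum_incTuples_sum [NeZero r] (g : Fin n → ℝ) :
    (∑ i ∈ incTuples r n, ∑ k, g (i k)) * n = r * n.choose r * ∑ l, g l := by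
  obtain ⟨r, rfl⟩ : ∃ k, r = k + 1 := ⟨r - 1, by have := NeZero.pos r; omega⟩
  have h1 : ∑ i ∈ incTuples (r + 1) n, ∑ k, g (i k)
      = ∑ i ∈ incTuples (r + 1) n, ∑ l ∈ Finset.univ.image i, g l :=
    Finset.sum_congr rfl fun i hi => by
      rw [Finset.sum_image fun a _ b _ h => (mem_incTuples.1 hi).injective h]
  rw [h1, sum_incTuples fun s => ∑ l ∈ s, g l]
  have h2 : ∀ s ∈ Finset.univ.powersetCard (r + 1), ∑ l ∈ s, g l
      = ∑ l, if l ∈ s then g l else 0 := fun s _ => by simp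
  rw [Finset.sum_congr rfl h2, Finset.sum_comm, Finset.sum_mul, Finset.mul_sum]
  refine Finset.sum_congr rfl fun l _ => ?_
  rw [← Finset.sum_filter, Finset.sum_const, nsmul_eq_mul]
  have := card_powersetCard_mem (r := r) l
  push_cast
  linear_combination g l * this

open Classical in
lemma card_incTuples_mem_mul_le (l : Fin n) :
    ((incTuples r n).filter fun i => ∃ k, i k = l).card * n ≤ r * n ^ r := by
  have h0 : ∀ k : Fin r,
      (Finset.univ.filter fun i : Fin r → Fin n => i k = l).card * n ≤ n ^ r := by
    intro k
    have h : Function.Injective fun p : Fin n × {i : Fin r → Fin n // i k = l} =>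
        Function.update p.2.1 k p.1 := by
      rintro ⟨s, i, hi⟩ ⟨s', i', hi'⟩ he
      have h1 := congrFun he k
      simp only [Function.update_self] at h1
      subst h1
      simp only [Prod.mk.injEq, true_and, Subtype.mk.injEq]
      ext b : 1
      by_cases hb : b = k
      · subst hb; rw [hi, hi']
      · simpa [hb] using congrFun he b
    have := Fintype.card_le_of_injective _ h
    simp only [Fintype.card_prod, Fintype.card_fin, Fintype.card_subtype, Fintype.card_pi,
      Finset.prod_const, Finset.card_univ] at this
    linarith
  have h1 : (incTuples r n).filter (fun i => ∃ k, i k = l) ⊆ Finset.univ.biUnion fun k =>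
      Finset.univ.filter fun i : Fin r → Fin n => i k = l := by
    intro i hi
    obtain ⟨k, hk⟩ := (Finset.mem_filter.1 hi).2
    exact Finset.mem_biUnion.2 ⟨k, Finset.mem_univ _, by simp [hk]⟩
  calc _ ≤ (∑ k : Fin r, (Finset.univ.filter fun i : Fin r → Fin n => i k = l).card) * n :=
        Nat.mul_le_mul_right _ ((Finset.card_le_card h1).trans Finset.card_biUnion_le)
    _ ≤ ∑ _k : Fin r, n ^ r := by rw [Finset.sum_mul]; exact Finset.sum_le_sum fun k _ => h0 k
    _ = r * n ^ r := by simp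

/-- From `n ≤ r (n + 1 - r)` and `(n + 1 - r)^r ≤ r! C(n, r)`: the powers of `n` from crude counting
are comparable with the binomial coefficient, up to a constant in `r`. -/
lemma pow_le_mul_choose [NeZero r] (h : r ≤ n) :
    (n : ℝ) ^ r ≤ (r ^ r * r.factorial : ℕ) * n.choose r := by
  have h1 : n ≤ r * (n + 1 - r) := by
    obtain ⟨d, rfl⟩ := Nat.exists_eq_add_of_le h
    have := NeZero.pos r
    rw [show r + d + 1 - r = d + 1 by omega]
    nlinarith
  have h2 : ((n + 1 - r : ℕ) ^ r : ℝ) ≤ r.factorial * n.choose r := by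
    have := Nat.pow_le_choose (α := ℝ) r n
    rw [div_le_iff₀ (by positivity)] at this
    linarith
  calc (n : ℝ) ^ r ≤ ((r * (n + 1 - r) : ℕ) : ℝ) ^ r := by gcongr
    _ = r ^ r * ((n + 1 - r : ℕ) ^ r : ℝ) := by push_cast; rw [mul_pow]
    _ ≤ r ^ r * (r.factorial * n.choose r) := by gcongr
    _ = _ := by push_cast; ring

end Counting

/-! ### The first projection of the kernel -/

section Projection

variable {𝒳 : Type u} {𝒴 : Type v} [MeasurableSpace 𝒳] [MeasurableSpace 𝒴] {r n : ℕ}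
  {ℓ : (Fin r → 𝒴) → ℝ} {P : Measure (𝒳 × 𝒴)}

instance [IsProbabilityMeasure P] : IsProbabilityMeasure (lawYs r P) := by unfold lawYs; infer_instance

/-- The centered first projection `ℓ₁ - ψ`. -/
noncomputable def proj1 [NeZero r] (ℓ : (Fin r → 𝒴) → ℝ) (P : Measure (𝒳 × 𝒴)) (y : 𝒴) : ℝ :=
  ell1 ℓ P y - psi ℓ P

/-- The kernel minus its projection on the sums of functions of one argument. -/
noncomputable def projRem [NeZero r] (ℓ : (Fin r → 𝒴) → ℝ) (P : Measure (𝒳 × 𝒴))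
    (v : Fin r → 𝒴) : ℝ :=
  ℓ v - psi ℓ P - ∑ k, proj1 ℓ P (v k)

lemma sigmaL_sq (hℓ : Measurable ℓ) :
    sigmaL ℓ P ^ 2 = ∫ v, (ℓ v - psi ℓ P) ^ 2 ∂(lawYs r P) := by
  rw [sigmaL, Real.sq_sqrt (variance_nonneg _ _), variance_eq_integral hℓ.aemeasurable]
  rfl

/-- Fubini gives integrable sections only for almost every `y`; elsewhere the integral in `ell1`
takes the default value zero. Hence degeneracy, too, is an almost everywhere notion here. -/
lemma integrable_update [IsProbabilityMeasure P] (hL : MemLp ℓ 2 (lawYs r P)) (a : Fin r) :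
    ∀ᵐ y ∂P.snd, Integrable (fun v => ℓ (Function.update v a y)) (lawYs r P) := by
  have h := (measurePreserving_update (ν := P.snd) a).integrable_comp_of_integrable
    (hL.integrable (by norm_num))
  exact h.prod_left_ae

variable [NeZero r]

/-- The Hoeffding decomposition of the U-statistic, up to order one. -/
lemma uStat_sub_psi (hn : r ≤ n) (y : Fin n → 𝒴) :
    uStat ℓ y - psi ℓ P = (r : ℝ) / n * ∑ l, proj1 ℓ P (y l)
      + (n.choose r : ℝ)⁻¹ * ∑ i ∈ incTuples r n, projRem ℓ P (fun k => y (i k)) := by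
  have hc : (n.choose r : ℝ) ≠ 0 := by exact_mod_cast (Nat.choose_pos hn).ne'
  have hn0 : (n : ℝ) ≠ 0 := by
    have := NeZero.pos r
    exact_mod_cast (by omega : n ≠ 0)
  have h1 := sum_incTuples_sum (r := r) fun l => proj1 ℓ P (y l)
  have h2 : uStat ℓ y = (n.choose r : ℝ)⁻¹ * ∑ i ∈ incTuples r n, ℓ fun k => y (i k) := rfl
  rw [h2]
  simp only [projRem, Finset.sum_sub_distrib, Finset.sum_const, nsmul_eq_mul, card_incTuples]
  field_simp
  linarith

variable [IsProbabilityMeasure P]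

lemma measurable_ell1 (hℓ : Measurable ℓ) : Measurable (ell1 ℓ P) := by
  have h : StronglyMeasurable fun p : 𝒴 × (Fin r → 𝒴) => ℓ (Function.update p.2 0 p.1) :=
    (hℓ.comp (measurable_update'.comp measurable_swap)).stronglyMeasurable
  exact h.integral_prod_right.measurable

lemma measurable_proj1 (hℓ : Measurable ℓ) : Measurable (proj1 ℓ P) :=
  (measurable_ell1 hℓ).sub_const _

lemma measurable_projRem (hℓ : Measurable ℓ) : Measurable (projRem ℓ P) :=
  (hℓ.sub_const _).sub (Finset.measurable_sum _ fun k _ =>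
    (measurable_proj1 hℓ).comp (measurable_pi_apply k))

/-- Swapping positions `0` and `a` changes neither the kernel nor the law of the arguments. -/
lemma integral_update_eq_ell1 (hℓ : Measurable ℓ) (hsym : SymmetricKernel ℓ) (a : Fin r) (y : 𝒴) :
    ∫ v, ℓ (Function.update v a y) ∂(lawYs r P) = ell1 ℓ P y := by
  have h1 : ∀ v : Fin r → 𝒴, ℓ (Function.update v a y)
      = ℓ (Function.update (fun k => v (Equiv.swap 0 a k)) 0 y) := by
    intro v
    rw [← hsym (Equiv.swap 0 a)]
    congr 1
    ext k
    by_cases hk : k = 0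
    · subst hk; simp
    · rw [Function.update_of_ne hk, Function.update_of_ne]
      rw [Ne, Equiv.swap_apply_eq_iff, Equiv.swap_apply_right]
      exact hk
  simp_rw [h1]
  exact MeasurePreserving.integral_comp_ae
    (measurePreserving_comp_injective (ν := P.snd) (Equiv.swap 0 a).injective)
    (g := fun v => ℓ (Function.update v 0 y)) (hℓ.comp measurable_update_left).aestronglyMeasurable

lemma integral_ell1 (hL : MemLp ℓ 2 (lawYs r P)) : ∫ y, ell1 ℓ P y ∂P.snd = psi ℓ P := by
  have hp := measurePreserving_update (ν := P.snd) (0 : Fin r)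
  have hi := hL.integrable (q := 2) (by norm_num)
  have h := hp.integrable_comp_of_integrable hi
  refine Eq.trans ?_ (MeasurePreserving.integral_comp_ae hp hi.aestronglyMeasurable)
  rw [Function.comp_def] at h
  rw [integral_prod_symm _ h]
  rfl

/-- Jensen's inequality in the arguments that are integrated out, then Fubini. -/
lemma proj1_sq_le (hℓ : Measurable ℓ) (hL : MemLp ℓ 2 (lawYs r P)) :
    Integrable (fun y => proj1 ℓ P y ^ 2) P.snd ∧
      ∫ y, proj1 ℓ P y ^ 2 ∂P.snd ≤ ∫ v, (ℓ v - psi ℓ P) ^ 2 ∂(lawYs r P) := by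
  have hp := measurePreserving_update (ν := P.snd) (0 : Fin r)
  have hi : Integrable (fun v => (ℓ v - psi ℓ P) ^ 2) (lawYs r P) :=
    (hL.sub (memLp_const _)).integrable_sq
  have h := hp.integrable_comp_of_integrable hi
  rw [Function.comp_def] at h
  have hle : ∀ᵐ y ∂P.snd, proj1 ℓ P y ^ 2
      ≤ ∫ v, (ℓ (Function.update v 0 y) - psi ℓ P) ^ 2 ∂(lawYs r P) := by
    filter_upwards [integrable_update hL 0, h.prod_left_ae] with y h1 h2
    have hm : AEStronglyMeasurable (fun v => ℓ (Function.update v 0 y) - psi ℓ P) (lawYs r P) :=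
      (h1.sub (integrable_const _)).aestronglyMeasurable
    have h3 : proj1 ℓ P y = ∫ v, (ℓ (Function.update v 0 y) - psi ℓ P) ∂(lawYs r P) := by
      rw [integral_sub h1 (integrable_const _)]
      simp [proj1, ell1]
    rw [h3, ← sq_abs]
    exact (pow_le_pow_left₀ (abs_nonneg _) abs_integral_le_integral_abs 2).trans
      (sq_integral_abs_le ((memLp_two_iff_integrable_sq hm).2 h2))
  have hint : Integrable (fun y => proj1 ℓ P y ^ 2) P.snd := by
    refine h.integral_prod_right.mono' ((measurable_proj1 hℓ).pow_const 2).aestronglyMeasurable ?_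
    filter_upwards [hle] with y hy
    rw [Real.norm_eq_abs, abs_of_nonneg (sq_nonneg _)]
    exact hy
  refine ⟨hint, (integral_mono_ae hint h.integral_prod_right hle).trans (le_of_eq ?_)⟩
  refine Eq.trans ?_ (MeasurePreserving.integral_comp_ae hp hi.aestronglyMeasurable)
  exact (integral_prod_symm _ h).symm

lemma memLp_proj1 (hℓ : Measurable ℓ) (hL : MemLp ℓ 2 (lawYs r P)) :
    MemLp (proj1 ℓ P) 2 P.snd :=
  (memLp_two_iff_integrable_sq (measurable_proj1 hℓ).aestronglyMeasurable).2 (proj1_sq_le hℓ hL).1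

lemma integral_proj1_sq_le (hℓ : Measurable ℓ) (hL : MemLp ℓ 2 (lawYs r P)) :
    ∫ y, proj1 ℓ P y ^ 2 ∂P.snd ≤ sigmaL ℓ P ^ 2 := by
  rw [sigmaL_sq hℓ]
  exact (proj1_sq_le hℓ hL).2

lemma memLp_ell1 (hℓ : Measurable ℓ) (hL : MemLp ℓ 2 (lawYs r P)) :
    MemLp (ell1 ℓ P) 2 P.snd := by
  have := (memLp_proj1 hℓ hL).add (memLp_const (psi ℓ P))
  refine this.congr_norm (measurable_ell1 hℓ).aestronglyMeasurable (ae_of_all _ fun y => ?_)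
  simp [proj1]

lemma integral_proj1 (hℓ : Measurable ℓ) (hL : MemLp ℓ 2 (lawYs r P)) :
    ∫ y, proj1 ℓ P y ∂P.snd = 0 := by
  simp only [proj1]
  rw [integral_sub ((memLp_ell1 hℓ hL).integrable (by norm_num)) (integrable_const _),
    integral_ell1 hL]
  simp

lemma memLp_proj1_comp (hℓ : Measurable ℓ) (hL : MemLp ℓ 2 (lawYs r P)) (k : Fin r) :
    MemLp (fun v : Fin r → 𝒴 => proj1 ℓ P (v k)) 2 (lawYs r P) :=
  (memLp_proj1 hℓ hL).comp_measurePreserving (measurePreserving_eval (fun _ => P.snd) k)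

lemma memLp_projRem (hℓ : Measurable ℓ) (hL : MemLp ℓ 2 (lawYs r P)) :
    MemLp (projRem ℓ P) 2 (lawYs r P) :=
  (hL.sub (memLp_const _)).sub (memLp_finsetSum _ fun k _ => memLp_proj1_comp hℓ hL k)

/-- With argument `a` held at `y`, the kernel averages to `ℓ₁(y)`, the projections in the other
arguments average to zero, and the one in `a` equals `ℓ₁(y) - ψ`, which cancels what is left. -/
lemma isDegenerate_projRem (hℓ : Measurable ℓ) (hsym : SymmetricKernel ℓ)
    (hL : MemLp ℓ 2 (lawYs r P)) : IsDegenerate P.snd (projRem ℓ P) := by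
  intro a
  filter_upwards [integrable_update hL a] with y hy
  have hk : ∀ k, Integrable (fun v : Fin r → 𝒴 => proj1 ℓ P (Function.update v a y k))
      (lawYs r P) ∧ ∫ v, proj1 ℓ P (Function.update v a y k) ∂(lawYs r P)
        = if k = a then proj1 ℓ P y else 0 := by
    intro k
    by_cases hk : k = a
    · subst hk
      simp
    · simp only [Function.update_of_ne hk, if_neg hk]
      refine ⟨(memLp_proj1_comp hℓ hL k).integrable (by norm_num), ?_⟩
      rw [← integral_proj1 hℓ hL]
      exact MeasurePreserving.integral_comp_ae (measurePreserving_eval (fun _ => P.snd) k)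
        (measurable_proj1 hℓ).aestronglyMeasurable
  change ∫ v, projRem ℓ P (Function.update v a y) ∂(lawYs r P) = 0
  simp only [projRem]
  have i1 : Integrable (fun v => ℓ (Function.update v a y) - psi ℓ P) (lawYs r P) :=
    hy.sub (integrable_const _)
  rw [integral_sub i1 (integrable_finsetSum _ fun k _ => (hk k).1),
    integral_sub hy (integrable_const _), integral_finsetSum _ fun k _ => (hk k).1,
    integral_update_eq_ell1 hℓ hsym, Finset.sum_congr rfl fun k _ => (hk k).2]
  simp [proj1]

/-- Cauchy–Schwarz over `r + 1` terms, each of second moment at most `σ_ℓ²`. -/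
lemma integral_projRem_sq_le (hℓ : Measurable ℓ) (hL : MemLp ℓ 2 (lawYs r P)) :
    ∫ v, projRem ℓ P v ^ 2 ∂(lawYs r P) ≤ (r + 1) ^ 2 * sigmaL ℓ P ^ 2 := by
  have h1 : ∀ v, projRem ℓ P v ^ 2
      ≤ (r + 1) * ((ℓ v - psi ℓ P) ^ 2 + ∑ k, proj1 ℓ P (v k) ^ 2) := by
    intro v
    have h := sq_sum_le_card_mul_sum_sq (s := Finset.univ)
      (f := fun k : Option (Fin r) => k.elim (ℓ v - psi ℓ P) fun k => -proj1 ℓ P (v k))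
    simp only [Fintype.sum_option, Option.elim, Finset.sum_neg_distrib, neg_sq, Finset.card_univ,
      Fintype.card_option, Fintype.card_fin] at h
    push_cast at h
    simpa [projRem, sub_eq_add_neg] using h
  have i1 : Integrable (fun v => (ℓ v - psi ℓ P) ^ 2) (lawYs r P) :=
    (hL.sub (memLp_const _)).integrable_sq
  have i2 : ∀ k, Integrable (fun v : Fin r → 𝒴 => proj1 ℓ P (v k) ^ 2) (lawYs r P) :=
    fun k => (memLp_proj1_comp hℓ hL k).integrable_sq
  have i3 := integrable_finsetSum Finset.univ fun k _ => i2 k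
  have h2 : ∀ k, ∫ v : Fin r → 𝒴, proj1 ℓ P (v k) ^ 2 ∂(lawYs r P) ≤ sigmaL ℓ P ^ 2 := by
    intro k
    refine le_trans (le_of_eq ?_) (integral_proj1_sq_le hℓ hL)
    exact MeasurePreserving.integral_comp_ae (measurePreserving_eval (fun _ => P.snd) k)
      (g := fun y => proj1 ℓ P y ^ 2) ((measurable_proj1 hℓ).pow_const 2).aestronglyMeasurable
  refine (integral_mono (memLp_projRem hℓ hL).integrable_sq ((i1.add i3).const_mul _) h1).trans ?_
  simp only [Pi.add_apply]
  rw [integral_const_mul, integral_add i1 i3, integral_finsetSum _ fun k _ => i2 k, ← sigmaL_sq hℓ]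
  have h3 : ∑ k : Fin r, ∫ v : Fin r → 𝒴, proj1 ℓ P (v k) ^ 2 ∂(lawYs r P)
      ≤ r * sigmaL ℓ P ^ 2 := by
    refine (Finset.sum_le_sum fun k _ => h2 k).trans ?_
    simp
  have h4 : (0 : ℝ) ≤ r + 1 := by positivity
  nlinarith [mul_le_mul_of_nonneg_left h3 h4]

end Projection

/-! ### The remainder of the U-statistic -/

section Remainder

variable {𝒳 : Type u} {𝒴 : Type v} [MeasurableSpace 𝒳] [MeasurableSpace 𝒴] {r n : ℕ} [NeZero r]
  {ℓ : (Fin r → 𝒴) → ℝ} {P : Measure (𝒳 × 𝒴)}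

/-- The part of the U-statistic over the tuples in `S` that is left after the first projection. -/
noncomputable def uRem (ℓ : (Fin r → 𝒴) → ℝ) (P : Measure (𝒳 × 𝒴)) (S : Finset (Fin r → Fin n))
    (y : Fin n → 𝒴) : ℝ :=
  (n.choose r : ℝ)⁻¹ * ∑ i ∈ S, projRem ℓ P (fun k => y (i k))

open Classical in
/-- The increasing tuples that avoid the index `l`. -/
noncomputable def incTuplesOff (r : ℕ) (l : Fin n) : Finset (Fin r → Fin n) :=
  (incTuples r n).filter fun i => ¬ ∃ k, i k = l

/-- The constant of the bounds of the remainder of the U-statistic. -/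
noncomputable def remConst (r : ℕ) : ℝ := (r ^ r * r.factorial : ℕ) * (r ^ 3 * (r + 1))

lemma remConst_nonneg (r : ℕ) : 0 ≤ remConst r := by unfold remConst; positivity

lemma measurable_uRem [IsProbabilityMeasure P] (hℓ : Measurable ℓ) (S : Finset (Fin r → Fin n)) :
    Measurable (uRem ℓ P S) :=
  (Finset.measurable_sum _ fun i _ => (measurable_projRem hℓ).comp
    (measurable_pi_lambda _ fun k => measurable_pi_apply (i k))).const_mul _

lemma uRem_sub (S : Finset (Fin r → Fin n)) (p : (Fin r → Fin n) → Prop) [DecidablePred p]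
    (y : Fin n → 𝒴) :
    uRem ℓ P S y - uRem ℓ P (S.filter fun i => ¬ p i) y = uRem ℓ P (S.filter p) y := by
  simp only [uRem]
  rw [← Finset.sum_filter_add_sum_filter_not S p]
  ring

variable [IsProbabilityMeasure P]

lemma memLp_uRem (hℓ : Measurable ℓ) (hL : MemLp ℓ 2 (lawYs r P)) (S : Finset (Fin r → Fin n))
    (hS : ∀ i ∈ S, Function.Injective i) :
    MemLp (uRem ℓ P S) 2 (Measure.pi fun _ => P.snd) :=
  (memLp_finsetSum _ fun i hi => (memLp_projRem hℓ hL).comp_measurePreserving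
    (measurePreserving_comp_injective (hS i hi))).const_mul _

lemma integral_uRem_sq_mul_le (hℓ : Measurable ℓ) (hsym : SymmetricKernel ℓ)
    (hL : MemLp ℓ 2 (lawYs r P)) (S : Finset (Fin r → Fin n))
    (hS : ∀ i ∈ S, Function.Injective i) :
    (∫ y, uRem ℓ P S y ^ 2 ∂(Measure.pi fun _ => P.snd)) * (n.choose r : ℝ) ^ 2 * n ^ 2
      ≤ S.card * (r ^ 4 * n ^ r) * ((r + 1) ^ 2 * sigmaL ℓ P ^ 2) := by
  by_cases hc : n.choose r = 0
  · rw [hc]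
    simp only [Nat.cast_zero, ne_eq, OfNat.ofNat_ne_zero, not_false_eq_true, zero_pow, mul_zero,
      zero_mul]
    positivity
  have h1 := integral_sum_sq_le_of_isDegenerate (memLp_projRem hℓ hL) (measurable_projRem hℓ)
    (isDegenerate_projRem hℓ hsym hL) S hS
  have h2 : (∫ y, uRem ℓ P S y ^ 2 ∂(Measure.pi fun _ => P.snd)) * (n.choose r : ℝ) ^ 2
      = ∫ y, (∑ i ∈ S, projRem ℓ P (fun k => y (i k))) ^ 2 ∂(Measure.pi fun _ => P.snd) := by
    simp only [uRem, mul_pow]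
    rw [integral_const_mul]
    field_simp
  rw [h2]
  refine h1.trans (mul_le_mul_of_nonneg_left (integral_projRem_sq_le hℓ hL) (by positivity))

lemma integral_uRem_sq_le (hℓ : Measurable ℓ) (hsym : SymmetricKernel ℓ)
    (hL : MemLp ℓ 2 (lawYs r P)) (hn : r ≤ n) :
    ∫ y, uRem ℓ P (incTuples r n) y ^ 2 ∂(Measure.pi fun _ => P.snd)
      ≤ (remConst r * sigmaL ℓ P / n) ^ 2 := by
  have hr : 1 ≤ r := NeZero.one_le
  have hn0 : (0 : ℝ) < n := by exact_mod_cast hr.trans hn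
  have hr1 : (1 : ℝ) ≤ r := by exact_mod_cast hr
  have hc : (0 : ℝ) < n.choose r := by exact_mod_cast Nat.choose_pos hn
  have h1 := integral_uRem_sq_mul_le hℓ hsym hL (incTuples r n)
    fun i hi => injective_of_mem_incTuples hi
  have h2 := pow_le_mul_choose hn
  rw [card_incTuples] at h1
  set K : ℝ := ((r ^ r * r.factorial : ℕ) : ℝ) with hK
  have hK1 : 1 ≤ K := by
    rw [hK]; exact_mod_cast Nat.one_le_iff_ne_zero.2 (by positivity)
  set C : ℝ := (n.choose r : ℝ)
  set I := ∫ y, uRem ℓ P (incTuples r n) y ^ 2 ∂(Measure.pi fun _ => P.snd)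
  have h3 : I * n ^ 2 * C ^ 2 ≤ (remConst r * sigmaL ℓ P) ^ 2 * C ^ 2 := by
    calc I * n ^ 2 * C ^ 2 = I * C ^ 2 * n ^ 2 := by ring
      _ ≤ C * (r ^ 4 * n ^ r) * ((r + 1) ^ 2 * sigmaL ℓ P ^ 2) := h1
      _ ≤ C * (r ^ 4 * (K * C)) * ((r + 1) ^ 2 * sigmaL ℓ P ^ 2) := by gcongr
      _ = K * r ^ 4 * ((r + 1) ^ 2 * sigmaL ℓ P ^ 2) * C ^ 2 := by ring
      -- The power of `K` is raised so that one constant `remConst` serves here and in the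
      -- leave-one-out bound, where `K` enters squared; `r ^ 6` makes the factor a perfect square.
      _ ≤ K ^ 2 * r ^ 6 * ((r + 1) ^ 2 * sigmaL ℓ P ^ 2) * C ^ 2 := by
        gcongr
        · exact le_self_pow₀ hK1 two_ne_zero
        · norm_num
      _ = _ := by rw [remConst]; ring
  have h4 := le_of_mul_le_mul_right h3 (by positivity)
  rw [div_pow, le_div_iff₀ (by positivity)]
  exact h4

/-- The difference is the sum over the tuples through `l`. These make up a fraction of order `1 / n`
of all tuples, which improves `n⁻²` to `n⁻³`. -/
lemma integral_uRem_sub_sq_le (hℓ : Measurable ℓ) (hsym : SymmetricKernel ℓ)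
    (hL : MemLp ℓ 2 (lawYs r P)) (hn : r ≤ n) (l : Fin n) :
    ∫ y, (uRem ℓ P (incTuples r n) y - uRem ℓ P (incTuplesOff r l) y) ^ 2
        ∂(Measure.pi fun _ => P.snd)
      ≤ (remConst r * sigmaL ℓ P) ^ 2 / n ^ 3 := by
  classical
  have hr : 1 ≤ r := NeZero.one_le
  have hn0 : (0 : ℝ) < n := by exact_mod_cast hr.trans hn
  have hr1 : (1 : ℝ) ≤ r := by exact_mod_cast hr
  have hc : (0 : ℝ) < n.choose r := by exact_mod_cast Nat.choose_pos hn
  have h0 : ∀ y : Fin n → 𝒴, uRem ℓ P (incTuples r n) y - uRem ℓ P (incTuplesOff r l) y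
      = uRem ℓ P ((incTuples r n).filter fun i => ∃ k, i k = l) y := fun y => by
    rw [← uRem_sub]
    congr!
  simp_rw [h0]
  have h1 := integral_uRem_sq_mul_le hℓ hsym hL ((incTuples r n).filter fun i => ∃ k, i k = l)
    fun i hi => injective_of_mem_incTuples (Finset.mem_of_mem_filter i hi)
  have h2 := pow_le_mul_choose hn
  have h5 : (((incTuples r n).filter fun i => ∃ k, i k = l).card : ℝ) * n ≤ r * n ^ r := by
    have := card_incTuples_mem_mul_le (r := r) l
    have h6 : (((incTuples r n).filter fun i => ∃ k, i k = l).card : ℕ) * n ≤ r * n ^ r := by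
      convert this
    exact_mod_cast h6
  set K : ℝ := ((r ^ r * r.factorial : ℕ) : ℝ) with hK
  set C : ℝ := (n.choose r : ℝ)
  set N : ℝ := (((incTuples r n).filter fun i => ∃ k, i k = l).card : ℝ)
  set I := ∫ y, uRem ℓ P ((incTuples r n).filter fun i => ∃ k, i k = l) y ^ 2
    ∂(Measure.pi fun _ => P.snd)
  have h3 : I * n ^ 3 * C ^ 2 ≤ (remConst r * sigmaL ℓ P) ^ 2 * C ^ 2 := by
    calc I * n ^ 3 * C ^ 2 = I * C ^ 2 * n ^ 2 * n := by ring
      _ ≤ N * (r ^ 4 * n ^ r) * ((r + 1) ^ 2 * sigmaL ℓ P ^ 2) * n := by gcongr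
      _ = (N * n) * (r ^ 4 * n ^ r) * ((r + 1) ^ 2 * sigmaL ℓ P ^ 2) := by ring
      _ ≤ (r * n ^ r) * (r ^ 4 * n ^ r) * ((r + 1) ^ 2 * sigmaL ℓ P ^ 2) := by gcongr
      _ ≤ (r * (K * C)) * (r ^ 4 * (K * C)) * ((r + 1) ^ 2 * sigmaL ℓ P ^ 2) := by gcongr
      _ = K ^ 2 * r ^ 5 * ((r + 1) ^ 2 * sigmaL ℓ P ^ 2) * C ^ 2 := by ring
      _ ≤ K ^ 2 * r ^ 6 * ((r + 1) ^ 2 * sigmaL ℓ P ^ 2) * C ^ 2 := by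
        gcongr
        norm_num
      _ = _ := by rw [remConst]; ring
  have h4 := le_of_mul_le_mul_right h3 (by positivity)
  rw [le_div_iff₀ (by positivity)]
  exact h4

end Remainder

/-! ### The asymptotic variance -/

/-- The law of total variance for `X - G`, whose conditional variance is that of `X` because `G` is
`m`-measurable. -/
lemma integral_condVar_le_variance_sub {Ω : Type*} {m₀ m : MeasurableSpace Ω} (hm : m ≤ m₀)
    {μ : Measure[m₀] Ω} [IsProbabilityMeasure μ] {X G : Ω → ℝ} (hX : MemLp X 2 μ)
    (hG : MemLp G 2 μ) (hGm : StronglyMeasurable[m] G) :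
    ∫ ω, (Var[X; μ | m]) ω ∂μ ≤ Var[X - G; μ] := by
  have h1 := integral_condVar_add_variance_condExp hm (hX.sub hG)
  have h2 : Var[X - G; μ | m] =ᵐ[μ] Var[X; μ | m] := by
    unfold condVar
    refine condExp_congr_ae ?_
    have h3 := condExp_sub (hX.integrable (by norm_num)) (hG.integrable (by norm_num)) m
    have h4 : μ[G | m] = G :=
      condExp_of_stronglyMeasurable hm hGm (hG.integrable (by norm_num))
    rw [h4] at h3
    filter_upwards [h3] with ω hω
    simp only [Pi.pow_apply, Pi.sub_apply, hω]
    ring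
  have h5 := variance_nonneg (μ[X - G | m]) μ
  rw [integral_congr_ae h2] at h1
  linarith

section AsymptoticVariance

variable {𝒳 : Type u} {𝒴 : Type v} [MeasurableSpace 𝒳]

lemma stronglyMeasurable_fst_sigmaX {f : 𝒳 → ℝ} (hf : Measurable f) :
    StronglyMeasurable[sigmaX 𝒳 𝒴] fun p : 𝒳 × 𝒴 => f p.1 :=
  (hf.comp (comap_measurable Prod.fst)).stronglyMeasurable

variable [MeasurableSpace 𝒴] {P : Measure (𝒳 × 𝒴)} {r n m : ℕ} {ℓ : (Fin r → 𝒴) → ℝ} {f : 𝒳 → ℝ}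

lemma sigmaX_le : sigmaX 𝒳 𝒴 ≤ (inferInstance : MeasurableSpace (𝒳 × 𝒴)) :=
  measurable_fst.comap_le

lemma measurePreserving_fst' : MeasurePreserving Prod.fst P P.fst := ⟨measurable_fst, rfl⟩

lemma measurePreserving_snd' : MeasurePreserving Prod.snd P P.snd := ⟨measurable_snd, rfl⟩

lemma memLp_fst (hf : MemLp f 2 P.fst) : MemLp (fun p : 𝒳 × 𝒴 => f p.1) 2 P :=
  hf.comp_measurePreserving measurePreserving_fst'

variable [NeZero r] [IsProbabilityMeasure P]

lemma memLp_ell1_snd (hℓ : Measurable ℓ) (hL : MemLp ℓ 2 (lawYs r P)) :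
    MemLp (fun p : 𝒳 × 𝒴 => ell1 ℓ P p.2) 2 P :=
  (memLp_ell1 hℓ hL).comp_measurePreserving measurePreserving_snd'

lemma covariance_psi1X (hℓ : Measurable ℓ) (hL : MemLp ℓ 2 (lawYs r P)) (hf : Measurable f)
    (hfL : MemLp f 2 P.fst) :
    cov[fun p : 𝒳 × 𝒴 => f p.1, psi1X ℓ P; P]
      = cov[fun p : 𝒳 × 𝒴 => f p.1, fun p => ell1 ℓ P p.2; P] := by
  have h1 := memLp_ell1_snd hℓ hL
  have h2 := memLp_fst (𝒴 := 𝒴) hfL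
  rw [psi1X, covariance_eq_sub h2 h1, covariance_eq_sub h2 (h1.condExp (by norm_num)),
    integral_condExp sigmaX_le]
  congr 1
  rw [← integral_condExp (μ := P) (sigmaX_le (𝒳 := 𝒳) (𝒴 := 𝒴))
    (f := (fun p : 𝒳 × 𝒴 => f p.1) * fun p : 𝒳 × 𝒴 => ell1 ℓ P p.2)]
  refine integral_congr_ae (EventuallyEq.symm ?_)
  exact condExp_mul_of_stronglyMeasurable_left (stronglyMeasurable_fst_sigmaX hf)
    (h2.integrable_mul h1) (h1.integrable (by norm_num))

/-- Expand the variance, with `Cov(f, ψ₁) = Cov(f, ℓ₁)`; the coefficient of `Var f` is `a² + a (1 -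
a) = a`. In this form `Λ` is visibly nonnegative, with one term from each sample. -/
lemma Lam_eq (hℓ : Measurable ℓ) (hL : MemLp ℓ 2 (lawYs r P)) (hf : Measurable f)
    (hfL : MemLp f 2 P.fst) {a : ℝ} (ha : a = m / (n + m)) :
    Lam n m ℓ P f = (r : ℝ) ^ 2 * (Var[fun p : 𝒳 × 𝒴 => ell1 ℓ P p.2 - a * f p.1; P]
      + a * (1 - a) * Var[fun p : 𝒳 × 𝒴 => f p.1; P]) := by
  have h1 := memLp_ell1_snd hℓ hL
  have h2 := memLp_fst (𝒴 := 𝒴) hfL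
  rw [variance_fun_sub h1 (h2.const_mul a), variance_const_mul, covariance_const_mul_right, Lam,
    covariance_psi1X hℓ hL hf hfL, covariance_comm (fun p : 𝒳 × 𝒴 => ell1 ℓ P p.2), mul_div_assoc,
    ← ha]
  ring

lemma sigma1Sq_le_variance (hℓ : Measurable ℓ) (hL : MemLp ℓ 2 (lawYs r P)) (hf : Measurable f)
    (hfL : MemLp f 2 P.fst) (a : ℝ) :
    sigma1Sq ℓ P ≤ Var[fun p : 𝒳 × 𝒴 => ell1 ℓ P p.2 - a * f p.1; P] := by
  have h1 := memLp_ell1_snd hℓ hL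
  have h2 := memLp_fst (𝒴 := 𝒴) hfL
  exact integral_condVar_le_variance_sub sigmaX_le h1 (h2.const_mul a)
    ((stronglyMeasurable_fst_sigmaX hf).const_mul a)

end AsymptoticVariance

/-! ### Standardized sums on product spaces -/

section ProductSpace

variable {E : Type*} [MeasurableSpace E] {ι : Type*} [Fintype ι] {P : Measure E}
  [IsProbabilityMeasure P]

lemma indepFun_eval_update [DecidableEq ι] (k : ι) (p₀ : E) :
    IndepFun (fun e : ι → E => e k) (fun e => Function.update e k p₀)
      (Measure.pi fun _ => P) := by
  have hind : iIndepFun (fun k (e : ι → E) => e k) (Measure.pi fun _ => P) :=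
    iIndepFun_pi (X := fun _ => id) fun _ => aemeasurable_id
  have h := hind.indepFun_finset {k} (Finset.univ.erase k) (by simp) fun i => measurable_pi_apply i
  have m1 : Measurable fun x : ({k} : Finset ι) → E => x ⟨k, Finset.mem_singleton_self k⟩ :=
    measurable_pi_apply _
  have m2 : Measurable fun (x : ↥(Finset.univ.erase k) → E) (j : ι) =>
      if hj : j ∈ Finset.univ.erase k then x ⟨j, hj⟩ else p₀ := by
    refine measurable_pi_lambda _ fun j => ?_
    by_cases hj : j ∈ Finset.univ.erase k
    · simp only [hj, dite_true]; exact measurable_pi_apply _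
    · simp only [hj, dite_false]; exact measurable_const
  refine (h.comp m1 m2).congr (by rfl) (Eventually.of_forall fun e => ?_)
  ext j
  by_cases hj : j = k
  · subst hj; simp
  · simp [hj]

/-- Both components of the pair ignore coordinate `k`, so they can be evaluated at the point with
that coordinate frozen at `p₀`, which is independent of it. -/
lemma indepFun_of_update_invariant [DecidableEq ι] {φ : ι → E → ℝ} (hφ : ∀ k, Measurable (φ k))
    (k : ι) {D : (ι → E) → ℝ} (hD : Measurable D)
    (hinv : ∀ e p, D (Function.update e k p) = D e) :
    IndepFun (fun e : ι → E => φ k (e k)) (fun e => (∑ j, φ j (e j) - φ k (e k), D e))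
      (Measure.pi fun _ => P) := by
  obtain ⟨p₀⟩ : Nonempty E := nonempty_of_isProbabilityMeasure P
  have hG : Measurable fun e : ι → E => (∑ j, φ j (e j) - φ k (e k), D e) :=
    ((Finset.measurable_sum _ fun j _ => (hφ j).comp (measurable_pi_apply j)).sub
      ((hφ k).comp (measurable_pi_apply k))).prodMk hD
  refine ((indepFun_eval_update k p₀).comp (hφ k) hG).congr (by rfl)
    (Eventually.of_forall fun e => ?_)
  simp only [Function.comp_apply, hinv]
  congr 1
  rw [← Finset.sum_erase_add _ _ (Finset.mem_univ k),
    ← Finset.sum_erase_add Finset.univ (fun j => φ j (e j)) (Finset.mem_univ k),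
    add_sub_cancel_right, add_sub_cancel_right]
  exact Finset.sum_congr rfl fun j hj => by
    rw [Function.update_of_ne (Finset.ne_of_mem_erase hj)]

lemma integral_pi_eval {φ : E → ℝ} (hφ : AEStronglyMeasurable φ P) (k : ι) :
    ∫ e : ι → E, φ (e k) ∂(Measure.pi fun _ => P) = ∫ p, φ p ∂P :=
  MeasurePreserving.integral_comp_ae (measurePreserving_eval (fun _ => P) k) hφ

lemma isStdFamily_pi {φ : ι → E → ℝ} (hφ : ∀ k, Measurable (φ k)) (hL : ∀ k, MemLp (φ k) 3 P)
    (hmean : ∀ k, ∫ p, φ k p ∂P = 0) (hvar : ∑ k, ∫ p, φ k p ^ 2 ∂P = 1) :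
    IsStdFamily (Measure.pi fun _ : ι => P) fun k e => φ k (e k) where
  meas k := (hφ k).comp (measurable_pi_apply k)
  indep := iIndepFun_pi (X := φ) fun k => (hφ k).aemeasurable
  memLp k := (hL k).comp_measurePreserving (measurePreserving_eval (fun _ => P) k)
  mean k := by rw [integral_pi_eval (hφ k).aestronglyMeasurable, hmean]
  var := by
    rw [← hvar]
    exact Finset.sum_congr rfl fun k _ =>
      integral_pi_eval (φ := fun p => φ k p ^ 2) ((hφ k).pow_const 2).aestronglyMeasurable k

lemma lyapunov_pi {φ : ι → E → ℝ} (hφ : ∀ k, Measurable (φ k)) :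
    lyapunov (Measure.pi fun _ : ι => P) (fun k e => φ k (e k)) = ∑ k, ∫ p, |φ k p| ^ 3 ∂P :=
  Finset.sum_congr rfl fun k _ =>
    integral_pi_eval (φ := fun p => |φ k p| ^ 3) ((hφ k).abs.pow_const 3).aestronglyMeasurable k

end ProductSpace

/-! ### The bound for a fixed assistant function -/

section FixedFunction

variable {𝒳 : Type u} {𝒴 : Type v} [MeasurableSpace 𝒳] [MeasurableSpace 𝒴] {r n m : ℕ}
  {ℓ : (Fin r → 𝒴) → ℝ} {P : Measure (𝒳 × 𝒴)} {f : 𝒳 → ℝ}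

/-- The assistant function, centered. -/
noncomputable def centered (P : Measure (𝒳 × 𝒴)) (f : 𝒳 → ℝ) (x : 𝒳) : ℝ :=
  f x - ∫ x', f x' ∂P.fst

/-- The summand of the labeled sample in the linear part of the estimator. -/
noncomputable def labeledPart [NeZero r] (ℓ : (Fin r → 𝒴) → ℝ) (P : Measure (𝒳 × 𝒴)) (f : 𝒳 → ℝ)
    (a : ℝ) (p : 𝒳 × 𝒴) : ℝ :=
  proj1 ℓ P p.2 - a * centered P f p.1

/-- The summands of the linear part of the estimator. -/
noncomputable def summand [NeZero r] (n m : ℕ) (ℓ : (Fin r → 𝒴) → ℝ) (P : Measure (𝒳 × 𝒴))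
    (f : 𝒳 → ℝ) (s : ℝ) : Fin n ⊕ Fin m → 𝒳 × 𝒴 → ℝ
  | Sum.inl _ => fun p => r / (√n * s) * labeledPart ℓ P f (m / (n + m)) p
  | Sum.inr _ => fun p => r * √n / ((n + m) * s) * centered P f p.1

lemma measurable_centered (hf : Measurable f) : Measurable (centered P f) := hf.sub_const _

lemma memLp_centered_fst {p : ℝ≥0∞} (h : MemLp (centered P f) p P.fst) :
    MemLp (fun q : 𝒳 × 𝒴 => centered P f q.1) p P :=
  h.comp_measurePreserving measurePreserving_fst'

variable [NeZero r]

lemma memLp_proj1_snd {p : ℝ≥0∞} (h : MemLp (proj1 ℓ P) p P.snd) :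
    MemLp (fun q : 𝒳 × 𝒴 => proj1 ℓ P q.2) p P :=
  h.comp_measurePreserving measurePreserving_snd'

lemma memLp_labeledPart {p : ℝ≥0∞} (h1 : MemLp (proj1 ℓ P) p P.snd)
    (h2 : MemLp (centered P f) p P.fst) (a : ℝ) : MemLp (labeledPart ℓ P f a) p P :=
  (memLp_proj1_snd h1).sub ((memLp_centered_fst h2).const_mul a)

/-- The labeled responses in the pooled sample. -/
def responses (n m : ℕ) (e : Fin n ⊕ Fin m → 𝒳 × 𝒴) (l : Fin n) : 𝒴 := (e (Sum.inl l)).2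

/-- A labeled `f(X_i)` has coefficient `-r/n + r/(n + m) = -(r/n) m/(n + m)`. The function may be
centered freely because its mean cancels between the two averages. Unlabeled points are points of `𝒳
× 𝒴` whose response is never read, so all `n + m` observations share the law `P`. -/
lemma uSemi_decomposition (hn : r < n) {s : ℝ} (hs : 0 < s) (e : Fin n ⊕ Fin m → 𝒳 × 𝒴) :
    √(n : ℝ) * (uSemi ℓ f (fun i => e (Sum.inl i)) (fun j => (e (Sum.inr j)).1) - psi ℓ P) / s
      = ∑ k, summand n m ℓ P f s k (e k)
        + √n / s * uRem ℓ P (incTuples r n) (responses n m e) := by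
  have hn0 : (0 : ℝ) < n := by exact_mod_cast (Nat.zero_le r).trans_lt hn
  have hnm : (0 : ℝ) < n + m := by positivity
  have hsq : √(n : ℝ) ^ 2 = n := Real.sq_sqrt hn0.le
  have hsq0 : √(n : ℝ) ≠ 0 := (Real.sqrt_pos.2 hn0).ne'
  have h1 := uStat_sub_psi (P := P) (ℓ := ℓ) hn.le fun i => (e (Sum.inl i)).2
  rw [uSemi, Fintype.sum_sum_type]
  simp only [summand, labeledPart, ← Finset.mul_sum, Finset.sum_sub_distrib]
  have h3 : ∑ i : Fin n, f (e (Sum.inl i)).1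
      = ∑ i : Fin n, centered P f (e (Sum.inl i)).1 + n * ∫ x', f x' ∂P.fst := by
    simp only [centered, Finset.sum_sub_distrib, Finset.sum_const, Finset.card_univ,
      Fintype.card_fin, nsmul_eq_mul]
    ring
  have h4 : ∑ i : Fin m, f (e (Sum.inr i)).1
      = ∑ i : Fin m, centered P f (e (Sum.inr i)).1 + m * ∫ x', f x' ∂P.fst := by
    simp only [centered, Finset.sum_sub_distrib, Finset.sum_const, Finset.card_univ,
      Fintype.card_fin, nsmul_eq_mul]
    ring
  rw [h3, h4]
  have h5 : uRem ℓ P (incTuples r n) (responses n m e)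
      = uStat ℓ (fun i => (e (Sum.inl i)).2) - psi ℓ P
        - (r : ℝ) / n * ∑ l, proj1 ℓ P (e (Sum.inl l)).2 := by
    rw [h1, uRem]
    simp only [responses]
    ring
  rw [h5]
  generalize uStat ℓ (fun i => (e (Sum.inl i)).2) = U
  generalize ∑ l, proj1 ℓ P (e (Sum.inl l)).2 = H
  generalize ∑ i : Fin n, centered P f (e (Sum.inl i)).1 = G
  generalize ∑ i : Fin m, centered P f (e (Sum.inr i)).1 = G'
  generalize ∫ x', f x' ∂P.fst = c
  have h6 : r / (√n * s) = √n * r / (n * s) := by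
    field_simp
    rw [hsq]
  rw [h6]
  field_simp
  ring

variable [IsProbabilityMeasure P]

lemma measurable_labeledPart (hℓ : Measurable ℓ) (hf : Measurable f) (a : ℝ) :
    Measurable (labeledPart ℓ P f a) :=
  ((measurable_proj1 hℓ).comp measurable_snd).sub
    (((measurable_centered hf).comp measurable_fst).const_mul a)

lemma measurable_summand (hℓ : Measurable ℓ) (hf : Measurable f) (s : ℝ) (k : Fin n ⊕ Fin m) :
    Measurable (summand n m ℓ P f s k) := by
  rcases k with i | j
  · exact (measurable_labeledPart hℓ hf _).const_mul _
  · exact ((measurable_centered hf).comp measurable_fst).const_mul _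

lemma memLp_of_centered (hf : Measurable f) {p : ℝ≥0∞} (h : MemLp (centered P f) p P.fst) :
    MemLp f p P.fst := by
  refine (h.add (memLp_const (∫ x', f x' ∂P.fst))).congr_norm hf.aestronglyMeasurable
    (ae_of_all _ fun x => ?_)
  simp [centered]

lemma integral_centered_fst (hf : Measurable f) (h : MemLp (centered P f) 2 P.fst) :
    ∫ q : 𝒳 × 𝒴, centered P f q.1 ∂P = 0 := by
  rw [MeasurePreserving.integral_comp_ae measurePreserving_fst' (g := centered P f)
    (measurable_centered hf).aestronglyMeasurable]
  simp only [centered]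
  rw [integral_sub ((memLp_of_centered hf h).integrable (by norm_num)) (integrable_const _)]
  simp

lemma integral_labeledPart (hℓ : Measurable ℓ) (hL : MemLp ℓ 2 (lawYs r P)) (hf : Measurable f)
    (h : MemLp (centered P f) 2 P.fst) (a : ℝ) : ∫ q, labeledPart ℓ P f a q ∂P = 0 := by
  simp only [labeledPart]
  rw [integral_sub ((memLp_proj1_snd (memLp_proj1 hℓ hL)).integrable (by norm_num))
    (((memLp_centered_fst h).integrable (by norm_num)).const_mul a), integral_const_mul,
    integral_centered_fst hf h, MeasurePreserving.integral_comp_ae measurePreserving_snd'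
    (g := proj1 ℓ P) (measurable_proj1 hℓ).aestronglyMeasurable, integral_proj1 hℓ hL]
  simp

lemma variance_fst_eq (hf : Measurable f) (h : MemLp (centered P f) 2 P.fst) :
    Var[fun p : 𝒳 × 𝒴 => f p.1; P] = ∫ q : 𝒳 × 𝒴, centered P f q.1 ^ 2 ∂P := by
  rw [← variance_of_integral_eq_zero (X := fun q : 𝒳 × 𝒴 => centered P f q.1)
    ((measurable_centered hf).comp measurable_fst).aemeasurable (integral_centered_fst hf h)]
  exact (variance_sub_const ((hf.comp measurable_fst).aestronglyMeasurable) _).symm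

lemma variance_ell1_sub_eq (hℓ : Measurable ℓ) (hL : MemLp ℓ 2 (lawYs r P)) (hf : Measurable f)
    (h : MemLp (centered P f) 2 P.fst) (a : ℝ) :
    Var[fun p : 𝒳 × 𝒴 => ell1 ℓ P p.2 - a * f p.1; P]
      = ∫ q, labeledPart ℓ P f a q ^ 2 ∂P := by
  rw [← variance_of_integral_eq_zero (measurable_labeledPart hℓ hf a).aemeasurable
    (integral_labeledPart hℓ hL hf h a)]
  have hm : Measurable fun p : 𝒳 × 𝒴 => ell1 ℓ P p.2 - a * f p.1 :=
    ((measurable_ell1 hℓ).comp measurable_snd).sub ((hf.comp measurable_fst).const_mul a)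
  have : labeledPart ℓ P f a = fun p : 𝒳 × 𝒴 => (ell1 ℓ P p.2 - a * f p.1)
      - (psi ℓ P - a * ∫ x', f x' ∂P.fst) := by
    ext p
    simp only [labeledPart, proj1, centered]
    ring
  rw [this, variance_sub_const hm.aestronglyMeasurable]

lemma Lam_eq_integral (hℓ : Measurable ℓ) (hL : MemLp ℓ 2 (lawYs r P)) (hf : Measurable f)
    (h : MemLp (centered P f) 2 P.fst) {a : ℝ} (ha : a = m / (n + m)) :
    Lam n m ℓ P f = (r : ℝ) ^ 2 * (∫ q, labeledPart ℓ P f a q ^ 2 ∂P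
      + a * (1 - a) * ∫ q : 𝒳 × 𝒴, centered P f q.1 ^ 2 ∂P) := by
  rw [Lam_eq hℓ hL hf (memLp_of_centered hf h) ha, variance_fst_eq hf h,
    variance_ell1_sub_eq hℓ hL hf h]

lemma sq_mul_sigma1Sq_le_Lam (hn : r < n) (hℓ : Measurable ℓ) (hL : MemLp ℓ 2 (lawYs r P))
    (hf : Measurable f) (h : MemLp (centered P f) 2 P.fst) :
    (r : ℝ) ^ 2 * sigma1Sq ℓ P ≤ Lam n m ℓ P f := by
  have hn0 : (0 : ℝ) < n := by exact_mod_cast (Nat.zero_le r).trans_lt hn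
  rw [Lam_eq hℓ hL hf (memLp_of_centered hf h) rfl]
  have h1 := sigma1Sq_le_variance hℓ hL hf (memLp_of_centered hf h) ((m : ℝ) / (n + m))
  have h2 : (m : ℝ) / (n + m) ≤ 1 := by
    rw [div_le_one (by positivity)]; linarith
  have h3 : 0 ≤ (m : ℝ) / (n + m) * (1 - (m : ℝ) / (n + m))
      * Var[fun p : 𝒳 × 𝒴 => f p.1; P] :=
    mul_nonneg (mul_nonneg (by positivity) (by linarith)) (variance_nonneg _ _)
  have h4 : (0 : ℝ) ≤ (r : ℝ) ^ 2 := by positivity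
  exact mul_le_mul_of_nonneg_left (by linarith) h4

lemma isStdFamily_summand (hn : r < n) (hℓ : Measurable ℓ) (hL : MemLp ℓ 2 (lawYs r P))
    (hf : Measurable f) (h3 : MemLp (proj1 ℓ P) 3 P.snd) (hf3 : MemLp (centered P f) 3 P.fst)
    (hΛ : 0 < Lam n m ℓ P f) :
    IsStdFamily (Measure.pi fun _ : Fin n ⊕ Fin m => P)
      fun k e => summand n m ℓ P f (√(Lam n m ℓ P f)) k (e k) := by
  have hn0 : (0 : ℝ) < n := by exact_mod_cast (Nat.zero_le r).trans_lt hn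
  have hnm : (0 : ℝ) < n + m := by positivity
  have hf2 : MemLp (centered P f) 2 P.fst := hf3.mono_exponent (by norm_num)
  refine isStdFamily_pi (fun k => measurable_summand hℓ hf _ k) ?_ ?_ ?_
  · rintro (i | j)
    · exact (memLp_labeledPart h3 hf3 _).const_mul _
    · exact (memLp_centered_fst hf3).const_mul _
  · rintro (i | j)
    · simp only [summand]
      rw [integral_const_mul, integral_labeledPart hℓ hL hf hf2, mul_zero]
    · simp only [summand]
      rw [integral_const_mul, integral_centered_fst hf hf2, mul_zero]
  -- The unlabeled sample contributes `r² n m / (n + m)²` times the variance of `f`, divided by `Λ`;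
  -- since `n m / (n + m)² = a (1 - a)`, the total is `Λ / Λ`.
  · rw [Fintype.sum_sum_type]
    simp only [summand, mul_pow, integral_const_mul, Finset.sum_const, Finset.card_univ,
      Fintype.card_fin, nsmul_eq_mul, div_pow, Real.sq_sqrt hn0.le, Real.sq_sqrt hΛ.le]
    have h1 := Lam_eq_integral (m := m) (n := n) hℓ hL hf hf2 rfl
    generalize Lam n m ℓ P f = L at h1 hΛ ⊢
    generalize ∫ q, labeledPart ℓ P f ((m : ℝ) / (n + m)) q ^ 2 ∂P = A at h1 ⊢
    generalize ∫ q : 𝒳 × 𝒴, centered P f q.1 ^ 2 ∂P = G at h1 ⊢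
    have h2 : n * ((r : ℝ) ^ 2 / (n * L) * A) + m * ((r : ℝ) ^ 2 * n / ((n + m) ^ 2 * L) * G)
        = (r : ℝ) ^ 2 * (A + (m : ℝ) / (n + m) * (1 - (m : ℝ) / (n + m)) * G) / L := by
      field_simp
      ring
    rw [h2, ← h1, div_self hΛ.ne']

end FixedFunction

/-! ### Error terms of the linearization, and their assembly for a fixed function -/

section FixedFunctionBound

variable {𝒳 : Type u} {𝒴 : Type v} [MeasurableSpace 𝒳] [MeasurableSpace 𝒴] {r n m : ℕ}
  {ℓ : (Fin r → 𝒴) → ℝ} {P : Measure (𝒳 × 𝒴)} {f : 𝒳 → ℝ}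

/-- The tuples that contribute to the nonlinear part when one observation is left out. -/
noncomputable def tuplesOff (r n m : ℕ) : Fin n ⊕ Fin m → Finset (Fin r → Fin n)
  | Sum.inl l => incTuplesOff r l
  | Sum.inr _ => incTuples r n

lemma injective_of_mem_tuplesOff {k : Fin n ⊕ Fin m} {i : Fin r → Fin n}
    (hi : i ∈ tuplesOff r n m k) : Function.Injective i := by
  rcases k with l | j
  · exact injective_of_mem_incTuples (Finset.mem_of_mem_filter i hi)
  · exact injective_of_mem_incTuples hi

variable [NeZero r]

/-- The nonlinear part of the standardized estimator. -/
noncomputable def nonlin (m : ℕ) (ℓ : (Fin r → 𝒴) → ℝ) (P : Measure (𝒳 × 𝒴)) (s : ℝ)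
    (S : Finset (Fin r → Fin n)) (e : Fin n ⊕ Fin m → 𝒳 × 𝒴) : ℝ :=
  √n / s * uRem ℓ P S (responses n m e)

/-- For a labeled `k` only tuples avoiding it are kept; an unlabeled observation never enters the
U-statistic. -/
lemma nonlin_update (s : ℝ) (k : Fin n ⊕ Fin m) (e : Fin n ⊕ Fin m → 𝒳 × 𝒴) (p : 𝒳 × 𝒴) :
    nonlin m ℓ P s (tuplesOff r n m k) (Function.update e k p)
      = nonlin m ℓ P s (tuplesOff r n m k) e := by
  rcases k with l | j
  · simp only [nonlin, uRem, tuplesOff]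
    congr 2
    refine Finset.sum_congr rfl fun i hi => ?_
    congr 1
    ext k
    have : i k ≠ l := fun h => (Finset.mem_filter.1 hi).2 ⟨k, h⟩
    simp only [responses]
    rw [Function.update_of_ne]
    simpa using this
  · have : responses n m (Function.update e (Sum.inr j) p) = responses n m e := by
      ext l
      simp [responses]
    simp only [nonlin, this]

variable [IsProbabilityMeasure P]

lemma ratio_nonneg (n m : ℕ) : (0 : ℝ) ≤ m / (n + m) := by positivity

lemma ratio_le_one (n m : ℕ) : (m : ℝ) / (n + m) ≤ 1 :=
  div_le_one_of_le₀ (by linarith [(Nat.cast_nonneg n : (0 : ℝ) ≤ n)]) (by positivity)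

lemma integral_abs_labeledPart_pow_le (hℓ : Measurable ℓ) (hf : Measurable f)
    (h3 : MemLp (proj1 ℓ P) 3 P.snd) (hf3 : MemLp (centered P f) 3 P.fst) :
    ∫ q, |labeledPart ℓ P f (m / (n + m)) q| ^ 3 ∂P
      ≤ 4 * (∫ y, |proj1 ℓ P y| ^ 3 ∂P.snd + ∫ x, |centered P f x| ^ 3 ∂P.fst) := by
  have i1 : Integrable (fun q : 𝒳 × 𝒴 => |proj1 ℓ P q.2| ^ 3) P :=
    MemLp.integrable_abs_pow (p := 3) (memLp_proj1_snd h3) (by norm_num)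
  have i2 : Integrable (fun q : 𝒳 × 𝒴 => |centered P f q.1| ^ 3) P :=
    MemLp.integrable_abs_pow (p := 3) (memLp_centered_fst hf3) (by norm_num)
  have i3 : Integrable (fun q => |labeledPart ℓ P f (m / (n + m)) q| ^ 3) P :=
    MemLp.integrable_abs_pow (p := 3) (memLp_labeledPart h3 hf3 _) (by norm_num)
  rw [← MeasurePreserving.integral_comp_ae measurePreserving_snd'
      (g := fun y => |proj1 ℓ P y| ^ 3) ((measurable_proj1 hℓ).abs.pow_const 3).aestronglyMeasurable,
    ← MeasurePreserving.integral_comp_ae measurePreserving_fst'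
      (g := fun x => |centered P f x| ^ 3)
      ((measurable_centered hf).abs.pow_const 3).aestronglyMeasurable,
    ← integral_add i1 i2, ← integral_const_mul]
  refine integral_mono i3 ((i1.add i2).const_mul 4) fun q => ?_
  have ha := ratio_nonneg n m
  have ha1 := ratio_le_one n m
  have h1 : |labeledPart ℓ P f (m / (n + m)) q| ≤ |proj1 ℓ P q.2| + |centered P f q.1| := by
    refine (abs_sub _ _).trans ?_
    rw [abs_mul, abs_of_nonneg ha]
    gcongr
    exact mul_le_of_le_one_left (abs_nonneg _) ha1
  refine (pow_le_pow_left₀ (abs_nonneg _) h1 3).trans ?_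
  have := add_pow_le (abs_nonneg (proj1 ℓ P q.2)) (abs_nonneg (centered P f q.1)) 3
  norm_num at this
  exact this

lemma sqrt_integral_labeledPart_sq_le (hℓ : Measurable ℓ) (hL : MemLp ℓ 2 (lawYs r P))
    (hf : Measurable f) (hf2 : MemLp (centered P f) 2 P.fst) :
    √(∫ q, labeledPart ℓ P f (m / (n + m)) q ^ 2 ∂P)
      ≤ 2 * (√(∫ y, proj1 ℓ P y ^ 2 ∂P.snd) + √(∫ x, centered P f x ^ 2 ∂P.fst)) := by
  have h2 := memLp_proj1 hℓ hL
  have i1 : Integrable (fun q : 𝒳 × 𝒴 => proj1 ℓ P q.2 ^ 2) P := (memLp_proj1_snd h2).integrable_sq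
  have i2 : Integrable (fun q : 𝒳 × 𝒴 => centered P f q.1 ^ 2) P :=
    (memLp_centered_fst hf2).integrable_sq
  have e1 := MeasurePreserving.integral_comp_ae (measurePreserving_snd' (P := P))
      (g := fun y => proj1 ℓ P y ^ 2) ((measurable_proj1 hℓ).pow_const 2).aestronglyMeasurable
  have e2 := MeasurePreserving.integral_comp_ae (measurePreserving_fst' (P := P))
      (g := fun x => centered P f x ^ 2)
      ((measurable_centered hf).pow_const 2).aestronglyMeasurable
  have h1 : ∫ q, labeledPart ℓ P f (m / (n + m)) q ^ 2 ∂P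
      ≤ 2 * (∫ y, proj1 ℓ P y ^ 2 ∂P.snd + ∫ x, centered P f x ^ 2 ∂P.fst) := by
    rw [← e1, ← e2, ← integral_add i1 i2, ← integral_const_mul]
    refine integral_mono (memLp_labeledPart h2 hf2 _).integrable_sq
      ((i1.add i2).const_mul 2) fun q => ?_
    have ha := ratio_nonneg n m
    have ha1 := ratio_le_one n m
    simp only [labeledPart]
    generalize (m : ℝ) / (n + m) = a at ha ha1
    generalize proj1 ℓ P q.2 = x
    generalize centered P f q.1 = y
    have h3 : (a * y) ^ 2 ≤ y ^ 2 := by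
      rw [mul_pow]
      exact mul_le_of_le_one_left (sq_nonneg _) (pow_le_one₀ ha ha1)
    nlinarith [sq_nonneg (x + a * y)]
  have h0 : 0 ≤ ∫ y, proj1 ℓ P y ^ 2 ∂P.snd := integral_nonneg fun _ => sq_nonneg _
  have h0' : 0 ≤ ∫ x, centered P f x ^ 2 ∂P.fst := integral_nonneg fun _ => sq_nonneg _
  rw [Real.sqrt_le_left (by positivity)]
  nlinarith [Real.sq_sqrt h0, Real.sq_sqrt h0', Real.sqrt_nonneg (∫ y, proj1 ℓ P y ^ 2 ∂P.snd),
    Real.sqrt_nonneg (∫ x, centered P f x ^ 2 ∂P.fst),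
    mul_nonneg (Real.sqrt_nonneg (∫ y, proj1 ℓ P y ^ 2 ∂P.snd))
      (Real.sqrt_nonneg (∫ x, centered P f x ^ 2 ∂P.fst))]

/-- The labeled sample contributes `4` by convexity of the cube, the unlabeled one `1` because `m n²
≤ (n + m)³`. The factor `r³ / s³` is at most `1 / σ₁³`. -/
lemma lyapunov_summand_le (hn : r < n) (hℓ : Measurable ℓ) (hf : Measurable f)
    (h3 : MemLp (proj1 ℓ P) 3 P.snd) (hf3 : MemLp (centered P f) 3 P.fst) {s : ℝ}
    (hσ : 0 < sigma1 ℓ P) (hs : r * sigma1 ℓ P ≤ s) :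
    lyapunov (Measure.pi fun _ : Fin n ⊕ Fin m => P) (fun k e => summand n m ℓ P f s k (e k))
      ≤ 5 * ((∫ y, |proj1 ℓ P y| ^ 3 ∂P.snd + ∫ x, |centered P f x| ^ 3 ∂P.fst)
        / (√n * sigma1 ℓ P ^ 3)) := by
  have hn0 : (0 : ℝ) < n := by exact_mod_cast (Nat.zero_le r).trans_lt hn
  have hr : (0 : ℝ) < r := by exact_mod_cast NeZero.pos r
  have hs0 : 0 < s := (mul_pos hr hσ).trans_le hs
  have hq : 0 < √(n : ℝ) := Real.sqrt_pos.2 hn0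
  have hsq : √(n : ℝ) ^ 2 = n := Real.sq_sqrt hn0.le
  rw [lyapunov_pi fun k => measurable_summand hℓ hf s k, Fintype.sum_sum_type]
  have hA := integral_abs_labeledPart_pow_le (m := m) (n := n) hℓ hf h3 hf3
  have hH0 : 0 ≤ ∫ y, |proj1 ℓ P y| ^ 3 ∂P.snd := integral_nonneg fun _ => by positivity
  have hG0 : 0 ≤ ∫ x, |centered P f x| ^ 3 ∂P.fst := integral_nonneg fun _ => by positivity
  have hA0 : 0 ≤ ∫ q, |labeledPart ℓ P f (m / (n + m)) q| ^ 3 ∂P :=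
    integral_nonneg fun _ => by positivity
  simp only [summand, abs_mul, mul_pow, integral_const_mul, Finset.sum_const, Finset.card_univ,
    Fintype.card_fin, nsmul_eq_mul]
  rw [MeasurePreserving.integral_comp_ae measurePreserving_fst'
      (g := fun x => |centered P f x| ^ 3)
      ((measurable_centered hf).abs.pow_const 3).aestronglyMeasurable,
    abs_of_nonneg (show (0 : ℝ) ≤ r / (√n * s) by positivity),
    abs_of_nonneg (show (0 : ℝ) ≤ r * √n / ((n + m) * s) by positivity)]
  generalize ∫ y, |proj1 ℓ P y| ^ 3 ∂P.snd = H at *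
  generalize ∫ x, |centered P f x| ^ 3 ∂P.fst = G at *
  generalize ∫ q, |labeledPart ℓ P f (m / (n + m)) q| ^ 3 ∂P = A at *
  set q := √(n : ℝ)
  have hrs : (r : ℝ) ^ 3 / s ^ 3 ≤ 1 / sigma1 ℓ P ^ 3 := by
    rw [div_le_div_iff₀ (by positivity) (by positivity), one_mul, ← mul_pow]
    exact pow_le_pow_left₀ (by positivity) hs 3
  have e1 : n * ((r / (q * s)) ^ 3 * A) = (r : ℝ) ^ 3 / s ^ 3 * (A / q) := by
    rw [← hsq]; field_simp
  have e2 : m * ((r * q / ((n + m) * s)) ^ 3 * G)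
      = (r : ℝ) ^ 3 / s ^ 3 * (m * n ^ 2 / (n + m) ^ 3 * (G / q)) := by
    have : (0 : ℝ) < n + m := by positivity
    have h4 : (n : ℝ) ^ 2 = q ^ 4 := by rw [← hsq]; ring
    rw [h4]
    field_simp
  have e3 : (m : ℝ) * n ^ 2 / (n + m) ^ 3 ≤ 1 := by
    have hm0 : (0 : ℝ) ≤ m := Nat.cast_nonneg m
    rw [div_le_one (by positivity)]
    nlinarith [pow_nonneg hm0 2, pow_nonneg hm0 3, pow_pos hn0 3, mul_nonneg hm0 hn0.le,
      mul_nonneg hm0 (pow_pos hn0 2).le, mul_nonneg hn0.le (pow_nonneg hm0 2)]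
  rw [e1, e2]
  calc _ = (r : ℝ) ^ 3 / s ^ 3 * (A / q + m * n ^ 2 / (n + m) ^ 3 * (G / q)) := by ring
    _ ≤ 1 / sigma1 ℓ P ^ 3 * (4 * (H + G) / q + 1 * ((H + G) / q)) := by
        gcongr
        linarith
    _ = _ := by field_simp; ring

lemma measurable_responses : Measurable (responses n m : (Fin n ⊕ Fin m → 𝒳 × 𝒴) → Fin n → 𝒴) :=
  measurable_pi_lambda _ fun _ => measurable_snd.comp (measurable_pi_apply _)

lemma measurePreserving_responses : MeasurePreserving
    (responses n m : (Fin n ⊕ Fin m → 𝒳 × 𝒴) → Fin n → 𝒴)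
    (Measure.pi fun _ => P) (Measure.pi fun _ => P.snd) := by
  refine ⟨measurable_responses, ?_⟩
  have h1 : iIndepFun (fun k (e : Fin n ⊕ Fin m → 𝒳 × 𝒴) => (e k).2) (Measure.pi fun _ => P) :=
    iIndepFun_pi (X := fun _ => Prod.snd) fun _ => measurable_snd.aemeasurable
  have h2 := (h1.precomp Sum.inl_injective).map_fun_eq_pi_map
    fun l => (measurable_snd.comp (measurable_pi_apply (Sum.inl l))).aemeasurable
  refine h2.trans ?_
  congr 1
  ext1 l
  exact ((measurePreserving_snd' (P := P)).comp
    (measurePreserving_eval (fun _ : Fin n ⊕ Fin m => P) (Sum.inl l))).map_eq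

lemma measurable_nonlin (hℓ : Measurable ℓ) (s : ℝ) (S : Finset (Fin r → Fin n)) :
    Measurable (nonlin m ℓ P s S) :=
  ((measurable_uRem hℓ S).comp measurable_responses).const_mul _

lemma memLp_nonlin (hℓ : Measurable ℓ) (hL : MemLp ℓ 2 (lawYs r P)) (s : ℝ)
    (S : Finset (Fin r → Fin n)) (hS : ∀ i ∈ S, Function.Injective i) :
    MemLp (nonlin m ℓ P s S) 2 (Measure.pi fun _ => P) :=
  ((memLp_uRem hℓ hL S hS).comp_measurePreserving measurePreserving_responses).const_mul _

lemma integral_nonlin_sq_le (hn : r < n) (hℓ : Measurable ℓ) (hsym : SymmetricKernel ℓ)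
    (hL : MemLp ℓ 2 (lawYs r P)) {s : ℝ} (hs : 0 < s) :
    √(∫ e, nonlin m ℓ P s (incTuples r n) e ^ 2 ∂(Measure.pi fun _ => P))
      ≤ remConst r * sigmaL ℓ P / (√n * s) := by
  have hn0 : (0 : ℝ) < n := by exact_mod_cast (Nat.zero_le r).trans_lt hn
  have hσL : 0 ≤ sigmaL ℓ P := Real.sqrt_nonneg _
  have hD := remConst_nonneg r
  have h1 := integral_uRem_sq_le hℓ hsym hL hn.le
  have h2 := MeasurePreserving.integral_comp_ae
    (measurePreserving_responses (P := P) (n := n) (m := m))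
    (g := fun y => uRem ℓ P (incTuples r n) y ^ 2)
    ((measurable_uRem hℓ _).pow_const 2).aestronglyMeasurable
  rw [Real.sqrt_le_left (by positivity)]
  simp only [nonlin, mul_pow, integral_const_mul]
  rw [h2]
  calc _ ≤ (√(n : ℝ) / s) ^ 2 * (remConst r * sigmaL ℓ P / n) ^ 2 := by gcongr
    _ = _ := by
      have hsq : √(n : ℝ) ^ 2 = n := Real.sq_sqrt hn0.le
      simp only [div_pow, mul_pow, hsq]
      field_simp

lemma integral_nonlin_sub_sq_le (hn : r < n) (hℓ : Measurable ℓ) (hsym : SymmetricKernel ℓ)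
    (hL : MemLp ℓ 2 (lawYs r P)) {s : ℝ} (hs : 0 < s) (l : Fin n) :
    √(∫ e, (nonlin m ℓ P s (incTuples r n) e - nonlin m ℓ P s (incTuplesOff r l) e) ^ 2
        ∂(Measure.pi fun _ => P))
      ≤ remConst r * sigmaL ℓ P / (n * s) := by
  have hn0 : (0 : ℝ) < n := by exact_mod_cast (Nat.zero_le r).trans_lt hn
  have hσL : 0 ≤ sigmaL ℓ P := Real.sqrt_nonneg _
  have hD := remConst_nonneg r
  have h1 := integral_uRem_sub_sq_le hℓ hsym hL hn.le l
  have h2 := MeasurePreserving.integral_comp_ae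
    (measurePreserving_responses (P := P) (n := n) (m := m))
    (g := fun y => (uRem ℓ P (incTuples r n) y - uRem ℓ P (incTuplesOff r l) y) ^ 2)
    (((measurable_uRem hℓ _).sub (measurable_uRem hℓ _)).pow_const 2).aestronglyMeasurable
  rw [Real.sqrt_le_left (by positivity)]
  simp only [nonlin, ← mul_sub, mul_pow, integral_const_mul]
  rw [h2]
  calc _ ≤ (√(n : ℝ) / s) ^ 2 * ((remConst r * sigmaL ℓ P) ^ 2 / n ^ 3) := by gcongr
    _ = _ := by
      have hsq : √(n : ℝ) ^ 2 = n := Real.sq_sqrt hn0.le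
      simp only [div_pow, mul_pow, hsq]
      field_simp

/-- The Berry–Esseen bound for a fixed assistant function. -/
theorem abs_measureReal_uSemi_sub_stdCDF_le (hn : r < n) (hℓ : Measurable ℓ)
    (hsym : SymmetricKernel ℓ) (hL : MemLp ℓ 2 (lawYs r P)) (hf : Measurable f)
    (h3 : MemLp (proj1 ℓ P) 3 P.snd) (hf3 : MemLp (centered P f) 3 P.fst)
    (hσ : 0 < sigma1Sq ℓ P) (t : ℝ) :
    |(Measure.pi fun _ : Fin n ⊕ Fin m => P).real
        {e | √(n : ℝ) * (uSemi ℓ f (fun i => e (Sum.inl i)) (fun j => (e (Sum.inr j)).1) - psi ℓ P)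
          / √(Lam n m ℓ P f) ≤ t} - stdCDF t| ≤
      (1015 + 4 * remConst r) *
        ((∫ y, |proj1 ℓ P y| ^ 3 ∂P.snd + ∫ x, |centered P f x| ^ 3 ∂P.fst)
            / (√n * sigma1 ℓ P ^ 3)
          + (√(∫ y, proj1 ℓ P y ^ 2 ∂P.snd) + √(∫ x, centered P f x ^ 2 ∂P.fst) + sigma1 ℓ P)
            * sigmaL ℓ P / (√((n : ℝ) - r) * sigma1 ℓ P ^ 2)) := by
  have hn0 : (0 : ℝ) < n := by exact_mod_cast (Nat.zero_le r).trans_lt hn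
  have hr1 : (1 : ℝ) ≤ r := by exact_mod_cast (NeZero.one_le : 1 ≤ r)
  have hnr : (0 : ℝ) < (n : ℝ) - r := sub_pos.2 (by exact_mod_cast hn)
  have hf2 : MemLp (centered P f) 2 P.fst := hf3.mono_exponent (by norm_num)
  have hD := remConst_nonneg r
  have hσL : 0 ≤ sigmaL ℓ P := Real.sqrt_nonneg _
  have hσ1 : 0 < sigma1 ℓ P := Real.sqrt_pos.2 hσ
  have hσsq : sigma1 ℓ P ^ 2 = sigma1Sq ℓ P := Real.sq_sqrt hσ.le
  have hΛ1 := sq_mul_sigma1Sq_le_Lam (m := m) hn hℓ hL hf hf2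
  have hΛ : 0 < Lam n m ℓ P f := lt_of_lt_of_le (by positivity) hΛ1
  have hst := isStdFamily_summand hn hℓ hL hf h3 hf3 hΛ
  set s := √(Lam n m ℓ P f) with hs
  have hs0 : 0 < s := Real.sqrt_pos.2 hΛ
  have hs1 : r * sigma1 ℓ P ≤ s := by
    rw [hs]
    refine Real.le_sqrt_of_sq_le ?_
    rw [mul_pow, hσsq]
    exact hΛ1
  have hs2 : sigma1 ℓ P ≤ s := (le_mul_of_one_le_left hσ1.le hr1).trans hs1
  have main := hst.abs_measureReal_add_le_sub_stdCDF_le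
    (Δ := nonlin m ℓ P s (incTuples r n)) (Δ' := fun k => nonlin m ℓ P s (tuplesOff r n m k))
    (memLp_nonlin hℓ hL s _ fun i hi => injective_of_mem_incTuples hi)
    (measurable_nonlin hℓ s _)
    (fun k => memLp_nonlin hℓ hL s _ fun i hi => injective_of_mem_tuplesOff hi)
    (fun k => measurable_nonlin hℓ s _)
    (fun k => indepFun_of_update_invariant (fun k => measurable_summand hℓ hf s k) k
      (measurable_nonlin hℓ s _) fun e p => nonlin_update s k e p) t
  have hev : {e : Fin n ⊕ Fin m → 𝒳 × 𝒴 | √(n : ℝ) *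
      (uSemi ℓ f (fun i => e (Sum.inl i)) (fun j => (e (Sum.inr j)).1) - psi ℓ P) / s ≤ t}
      = {e | ∑ k, summand n m ℓ P f s k (e k) + nonlin m ℓ P s (incTuples r n) e ≤ t} := by
    ext e
    simp only [mem_ofPred_eq]
    rw [uSemi_decomposition (P := P) hn hs0]
    rfl
  rw [hev]
  refine main.trans ?_
  have b1 := lyapunov_summand_le (m := m) hn hℓ hf h3 hf3 hσ1 hs1
  have hsum := hst.memLp_sum
  have b2 : ∫ e, |∑ k, summand n m ℓ P f s k (e k)| * |nonlin m ℓ P s (incTuples r n) e|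
      ∂(Measure.pi fun _ => P) ≤ remConst r * sigmaL ℓ P / (√n * s) := by
    refine (integral_abs_mul_abs_le hsum
      (memLp_nonlin hℓ hL s _ fun i hi => injective_of_mem_incTuples hi)).trans ?_
    rw [hst.integral_sum_sq, Real.sqrt_one, one_mul]
    exact integral_nonlin_sq_le hn hℓ hsym hL hs0
  -- Cauchy–Schwarz for each labeled term: `n` terms of order `n^(-1/2) * n⁻¹` leave order
  -- `n^(-1/2)`. The unlabeled terms vanish because leaving one out does not change the nonlinear
  -- part.
  have b3 : ∑ k, ∫ e, |summand n m ℓ P f s k (e k)| *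
      |nonlin m ℓ P s (incTuples r n) e - nonlin m ℓ P s (tuplesOff r n m k) e|
      ∂(Measure.pi fun _ => P)
      ≤ r * √(∫ q, labeledPart ℓ P f (m / (n + m)) q ^ 2 ∂P) * (remConst r * sigmaL ℓ P)
        / (√n * s ^ 2) := by
    rw [Fintype.sum_sum_type]
    have c1 : ∀ l : Fin n, ∫ e, |summand n m ℓ P f s (Sum.inl l) (e (Sum.inl l))| *
        |nonlin m ℓ P s (incTuples r n) e - nonlin m ℓ P s (tuplesOff r n m (Sum.inl l)) e|
        ∂(Measure.pi fun _ => P)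
        ≤ (r / (√n * s) * √(∫ q, labeledPart ℓ P f (m / (n + m)) q ^ 2 ∂P))
          * (remConst r * sigmaL ℓ P / (n * s)) := by
      intro l
      have d1 := memLp_nonlin (m := m) hℓ hL s (incTuples r n)
        fun i hi => injective_of_mem_incTuples hi
      have d2 := memLp_nonlin (m := m) hℓ hL s (tuplesOff r n m (Sum.inl l))
        fun i hi => injective_of_mem_tuplesOff hi
      refine (integral_abs_mul_abs_le (hst.memLp_two (Sum.inl l)) (d1.sub d2)).trans ?_
      refine mul_le_mul (le_of_eq ?_) (integral_nonlin_sub_sq_le hn hℓ hsym hL hs0 l)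
        (Real.sqrt_nonneg _) (by positivity)
      rw [integral_pi_eval (φ := fun p => summand n m ℓ P f s (Sum.inl l) p ^ 2)
        ((measurable_summand hℓ hf s _).pow_const 2).aestronglyMeasurable (Sum.inl l)]
      simp only [summand, mul_pow, integral_const_mul]
      rw [Real.sqrt_mul (by positivity), Real.sqrt_sq (by positivity)]
    have c2 : ∀ j : Fin m, ∫ e, |summand n m ℓ P f s (Sum.inr j) (e (Sum.inr j))| *
        |nonlin m ℓ P s (incTuples r n) e - nonlin m ℓ P s (tuplesOff r n m (Sum.inr j)) e|
        ∂(Measure.pi fun _ => P) = 0 := by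
      intro j
      simp [tuplesOff]
    rw [Finset.sum_eq_zero fun j _ => c2 j, add_zero]
    refine (Finset.sum_le_sum fun l _ => c1 l).trans (le_of_eq ?_)
    rw [Finset.sum_const, Finset.card_univ, Fintype.card_fin, nsmul_eq_mul]
    field_simp
  have b4 := sqrt_integral_labeledPart_sq_le (m := m) (n := n) hℓ hL hf hf2
  have hH0 : 0 ≤ ∫ y, |proj1 ℓ P y| ^ 3 ∂P.snd := integral_nonneg fun _ => by positivity
  have hG0 : 0 ≤ ∫ x, |centered P f x| ^ 3 ∂P.fst := integral_nonneg fun _ => by positivity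
  generalize ∫ y, |proj1 ℓ P y| ^ 3 ∂P.snd = H3 at *
  generalize ∫ x, |centered P f x| ^ 3 ∂P.fst = G3 at *
  have hh : 0 ≤ √(∫ y, proj1 ℓ P y ^ 2 ∂P.snd) := Real.sqrt_nonneg _
  have hg : 0 ≤ √(∫ x, centered P f x ^ 2 ∂P.fst) := Real.sqrt_nonneg _
  have hA : 0 ≤ √(∫ q, labeledPart ℓ P f (m / (n + m)) q ^ 2 ∂P) := Real.sqrt_nonneg _
  generalize √(∫ y, proj1 ℓ P y ^ 2 ∂P.snd) = H2 at *
  generalize √(∫ x, centered P f x ^ 2 ∂P.fst) = G2 at *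
  generalize √(∫ q, labeledPart ℓ P f (m / (n + m)) q ^ 2 ∂P) = A2 at *
  have hq : 0 < √((n : ℝ) - r) := Real.sqrt_pos.2 hnr
  have hqn : √((n : ℝ) - r) ≤ √n := Real.sqrt_le_sqrt (by linarith)
  generalize √((n : ℝ) - r) = q at *
  have hqn0 : 0 < √(n : ℝ) := hq.trans_le hqn
  have f2 : remConst r * sigmaL ℓ P / (√n * s)
      ≤ remConst r * (sigma1 ℓ P * sigmaL ℓ P / (q * sigma1 ℓ P ^ 2)) := by
    calc _ ≤ remConst r * sigmaL ℓ P / (q * sigma1 ℓ P) := by gcongr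
      _ = _ := by field_simp
  have f3 : r * A2 * (remConst r * sigmaL ℓ P) / (√n * s ^ 2)
      ≤ 2 * remConst r * ((H2 + G2) * sigmaL ℓ P / (q * sigma1 ℓ P ^ 2)) := by
    calc _ ≤ r * (2 * (H2 + G2)) * (remConst r * sigmaL ℓ P) / (q * (r * sigma1 ℓ P) ^ 2) := by
          gcongr
      _ = 2 * remConst r * ((H2 + G2) * sigmaL ℓ P / (q * sigma1 ℓ P ^ 2)) / r := by field_simp
      _ ≤ _ := div_le_self (by positivity) hr1
  have e3 : 0 ≤ (H3 + G3) / (√(n : ℝ) * sigma1 ℓ P ^ 3) := by positivity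
  have e4 : 0 ≤ (H2 + G2) * sigmaL ℓ P / (q * sigma1 ℓ P ^ 2) := by positivity
  have e5 : 0 ≤ sigma1 ℓ P * sigmaL ℓ P / (q * sigma1 ℓ P ^ 2) := by positivity
  have e6 : (H2 + G2 + sigma1 ℓ P) * sigmaL ℓ P / (q * sigma1 ℓ P ^ 2)
      = (H2 + G2) * sigmaL ℓ P / (q * sigma1 ℓ P ^ 2)
        + sigma1 ℓ P * sigmaL ℓ P / (q * sigma1 ℓ P ^ 2) := by ring
  rw [e6]
  generalize (H3 + G3) / (√(n : ℝ) * sigma1 ℓ P ^ 3) = X at *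
  generalize (H2 + G2) * sigmaL ℓ P / (q * sigma1 ℓ P ^ 2) = Y at *
  generalize sigma1 ℓ P * sigmaL ℓ P / (q * sigma1 ℓ P ^ 2) = Z at *
  have := mul_nonneg hD e3
  have := mul_nonneg hD e5
  -- The constant: `1015 = 203 * 5` for the Lyapunov ratio, `2 remConst` for `E|W||Δ|` and `2 * 2
  -- remConst` for the leave-one-out terms.
  have b2' := b2.trans f2
  have b3' := b3.trans f3
  linarith

end FixedFunctionBound

/-! ### The bound with moments in `[0, ∞]` -/

section ExtendedMoments

lemma lintegral_enorm_pow {E : Type*} [MeasurableSpace E] {ν : Measure E} {X : E → ℝ} {p : ℕ}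
    (hX : Integrable (fun ω => |X ω| ^ p) ν) :
    ∫⁻ ω, ‖X ω‖ₑ ^ p ∂ν = ENNReal.ofReal (∫ ω, |X ω| ^ p ∂ν) := by
  rw [ofReal_integral_eq_lintegral_ofReal hX (ae_of_all _ fun ω => by positivity)]
  refine lintegral_congr fun ω => ?_
  rw [Real.enorm_eq_ofReal_abs, ENNReal.ofReal_pow (abs_nonneg _)]

lemma memLp_of_lintegral_enorm_pow {E : Type*} [MeasurableSpace E] {ν : Measure E} {X : E → ℝ}
    {p : ℕ} (hp : p ≠ 0) (hX : AEStronglyMeasurable X ν) (h : ∫⁻ ω, ‖X ω‖ₑ ^ p ∂ν ≠ ∞) :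
    MemLp X p ν := by
  refine ⟨hX, (eLpNorm_lt_top_iff_lintegral_rpow_enorm_lt_top (by exact_mod_cast hp)
    (by simp)).2 ?_⟩
  simpa using h.lt_top

/-- Cauchy–Schwarz against the constant one. Being in `[0, ∞]`, it needs no integrability of the
conditional second moment. -/
lemma lintegral_rpow_half_le {E : Type*} [MeasurableSpace E] {ν : Measure E}
    [IsProbabilityMeasure ν] {g : E → ℝ≥0∞} (hg : Measurable g) :
    ∫⁻ x, g x ^ (1 / 2 : ℝ) ∂ν ≤ (∫⁻ x, g x ∂ν) ^ (1 / 2 : ℝ) := by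
  have h := ENNReal.lintegral_mul_le_Lp_mul_Lq ν (p := 2) (q := 2)
    (Real.holderConjugate_iff.2 ⟨by norm_num, by norm_num⟩)
    (f := fun x => g x ^ (1 / 2 : ℝ)) (g := fun _ => 1)
    (hg.pow_const _).aemeasurable aemeasurable_const
  have e : ∀ x, (g x ^ (1 / 2 : ℝ)) ^ (2 : ℝ) = g x := fun x => by
    rw [← ENNReal.rpow_mul]; norm_num
  simpa only [Pi.mul_apply, mul_one, e, ENNReal.one_rpow, lintegral_const, measure_univ] using h

variable {𝒳 : Type u} {𝒴 : Type v} [MeasurableSpace 𝒳] [MeasurableSpace 𝒴] {r n m : ℕ}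
  {ℓ : (Fin r → 𝒴) → ℝ} {P : Measure (𝒳 × 𝒴)} {f : 𝒳 → ℝ}

/-- The constant of the Berry–Esseen bound. -/
noncomputable def boundConst (r : ℕ) : ℝ := 1015 + 4 * remConst r

lemma boundConst_pos (r : ℕ) : 0 < boundConst r := by
  have := remConst_nonneg r
  unfold boundConst; positivity

variable [NeZero r] [IsProbabilityMeasure P]

lemma ofReal_abs_measureReal_uSemi_sub_stdCDF_le (hn : r < n) (hℓ : Measurable ℓ)
    (hsym : SymmetricKernel ℓ) (hL : MemLp ℓ 2 (lawYs r P)) (hσ : 0 < sigma1Sq ℓ P)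
    (hf : Measurable f) (t : ℝ) :
    ENNReal.ofReal |(Measure.pi fun _ : Fin n ⊕ Fin m => P).real
        {e | √(n : ℝ) * (uSemi ℓ f (fun i => e (Sum.inl i)) (fun j => (e (Sum.inr j)).1)
          - psi ℓ P) / √(Lam n m ℓ P f) ≤ t} - stdCDF t|
      ≤ ENNReal.ofReal (boundConst r) *
        ((momentEll1 3 ℓ P + ∫⁻ x, ‖f x - ∫ x', f x' ∂P.fst‖ₑ ^ 3 ∂P.fst)
            / ENNReal.ofReal (√(n : ℝ) * sigma1 ℓ P ^ 3)
          + (momentEll1 2 ℓ P ^ (1 / 2 : ℝ)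
              + (∫⁻ x, ‖f x - ∫ x', f x' ∂P.fst‖ₑ ^ 2 ∂P.fst) ^ (1 / 2 : ℝ)
              + ENNReal.ofReal (sigma1 ℓ P))
            * ENNReal.ofReal (sigmaL ℓ P)
            / ENNReal.ofReal (√((n : ℝ) - r) * sigma1 ℓ P ^ 2)) := by
  have hC := boundConst_pos r
  have hC0 : ENNReal.ofReal (boundConst r) ≠ 0 := by simpa using hC
  -- If a third moment is infinite, so is the right side, since the denominator is finite and the
  -- constant nonzero. Default values of integrals or of `Lam` for such `f` are thus harmless.
  by_cases htop : momentEll1 3 ℓ P + ∫⁻ x, ‖f x - ∫ x', f x' ∂P.fst‖ₑ ^ 3 ∂P.fst = ∞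
  · rw [htop, ENNReal.top_div_of_ne_top ENNReal.ofReal_ne_top, top_add, ENNReal.mul_top hC0]
    exact le_top
  obtain ⟨hl, hr⟩ := not_or.1 (mt ENNReal.add_eq_top.2 htop)
  have hl1 : ∀ p, momentEll1 p ℓ P = ∫⁻ y, ‖proj1 ℓ P y‖ₑ ^ p ∂P.snd := fun p => by
    rw [momentEll1, integral_ell1 hL]; rfl
  rw [hl1] at hl
  have hr1 : ∀ p, ∫⁻ x, ‖f x - ∫ x', f x' ∂P.fst‖ₑ ^ p ∂P.fst
      = ∫⁻ x, ‖centered P f x‖ₑ ^ p ∂P.fst := fun p => rfl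
  rw [hr1] at hr
  have h3 : MemLp (proj1 ℓ P) 3 P.snd :=
    memLp_of_lintegral_enorm_pow (by norm_num) (measurable_proj1 hℓ).aestronglyMeasurable hl
  have hf3 : MemLp (centered P f) 3 P.fst :=
    memLp_of_lintegral_enorm_pow (by norm_num) (measurable_centered hf).aestronglyMeasurable hr
  have h2 : MemLp (proj1 ℓ P) 2 P.snd := h3.mono_exponent (by norm_num)
  have hf2 : MemLp (centered P f) 2 P.fst := hf3.mono_exponent (by norm_num)
  have hσ1 : 0 < sigma1 ℓ P := Real.sqrt_pos.2 hσ
  have hn0 : (0 : ℝ) < n := by exact_mod_cast (Nat.zero_le r).trans_lt hn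
  have hnr : (0 : ℝ) < n - r := sub_pos.2 (by exact_mod_cast hn)
  have hL0 : 0 ≤ sigmaL ℓ P := Real.sqrt_nonneg _
  simp only [hl1, hr1]
  rw [lintegral_enorm_pow (MemLp.integrable_abs_pow (p := 3) h3 (by norm_num)),
    lintegral_enorm_pow (MemLp.integrable_abs_pow (p := 3) hf3 (by norm_num)),
    lintegral_enorm_pow (MemLp.integrable_abs_pow (p := 2) h2 (by norm_num)),
    lintegral_enorm_pow (MemLp.integrable_abs_pow (p := 2) hf2 (by norm_num)),
    ENNReal.ofReal_rpow_of_nonneg (by positivity) (by norm_num),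
    ENNReal.ofReal_rpow_of_nonneg (by positivity) (by norm_num), ← Real.sqrt_eq_rpow,
    ← Real.sqrt_eq_rpow, ← ENNReal.ofReal_add (by positivity) (by positivity),
    ← ENNReal.ofReal_add (by positivity) (by positivity),
    ← ENNReal.ofReal_add (by positivity) (by positivity),
    ← ENNReal.ofReal_mul (by positivity), ← ENNReal.ofReal_div_of_pos (by positivity),
    ← ENNReal.ofReal_div_of_pos (by positivity), ← ENNReal.ofReal_add (by positivity) (by positivity),
    ← ENNReal.ofReal_mul hC.le]
  simp only [sq_abs]
  exact ENNReal.ofReal_le_ofReal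
    (abs_measureReal_uSemi_sub_stdCDF_le hn hℓ hsym hL hf h3 hf3 hσ t)

end ExtendedMoments

/-! ### The trained function -/

section Trained

/-- The joint probability is the mean of the conditional ones, and the modulus passes under the
integral. This is the conditioning on the auxiliary data. -/
lemma ofReal_abs_measureReal_prod_sub_le {D E : Type*} [MeasurableSpace D] [MeasurableSpace E]
    {κ : Measure D} {Q : Measure E} [IsProbabilityMeasure κ] [IsProbabilityMeasure Q]
    {S : Set (D × E)} (hS : MeasurableSet S) (c : ℝ) :
    ENNReal.ofReal |(κ.prod Q).real S - c|
      ≤ ∫⁻ d, ENNReal.ofReal |Q.real (Prod.mk d ⁻¹' S) - c| ∂κ := by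
  have hm : Measurable fun d => Q (Prod.mk d ⁻¹' S) := measurable_measure_prodMk_left hS
  have hi : Integrable (fun d => Q.real (Prod.mk d ⁻¹' S)) κ := by
    refine Integrable.of_bound hm.ennreal_toReal.aestronglyMeasurable 1 (ae_of_all _ fun d => ?_)
    rw [Real.norm_eq_abs, abs_of_nonneg measureReal_nonneg]
    exact measureReal_le_one
  have h : (κ.prod Q).real S - c = ∫ d, (Q.real (Prod.mk d ⁻¹' S) - c) ∂κ := by
    rw [integral_sub hi (integrable_const _), measureReal_def, Measure.prod_apply hS,
      ← integral_toReal hm.aemeasurable (ae_of_all _ fun d => measure_lt_top _ _)]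
    simp [measureReal_def]
  rw [h]
  simpa only [Real.enorm_eq_ofReal_abs] using
    enorm_integral_le_lintegral_enorm (μ := κ) fun d => Q.real (Prod.mk d ⁻¹' S) - c

variable {𝒳 : Type u} {𝒴 : Type v} {𝒟 : Type w} [MeasurableSpace 𝒳] [MeasurableSpace 𝒴]
  [MeasurableSpace 𝒟] {r n m : ℕ} {ℓ : (Fin r → 𝒴) → ℝ} {P : Measure (𝒳 × 𝒴)}
  {fhat : 𝒟 → 𝒳 → ℝ}

lemma measurable_uStat (hℓ : Measurable ℓ) : Measurable (uStat ℓ : (Fin n → 𝒴) → ℝ) := by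
  classical
  exact (Finset.measurable_sum _ fun i _ => hℓ.comp
    (measurable_pi_lambda _ fun k => measurable_pi_apply (i k))).const_mul _

lemma measurable_uSemi (hℓ : Measurable ℓ) (hf : Measurable (Function.uncurry fhat)) :
    Measurable fun q : 𝒟 × ((Fin n → 𝒳 × 𝒴) × (Fin m → 𝒳)) =>
      uSemi ℓ (fhat q.1) q.2.1 q.2.2 := by
  have h1 : Measurable fun q : 𝒟 × ((Fin n → 𝒳 × 𝒴) × (Fin m → 𝒳)) =>
      uStat ℓ fun i => (q.2.1 i).2 :=
    (measurable_uStat hℓ).comp (by fun_prop)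
  have h2 : Measurable fun q : 𝒟 × ((Fin n → 𝒳 × 𝒴) × (Fin m → 𝒳)) =>
      ∑ i, fhat q.1 (q.2.1 i).1 :=
    Finset.measurable_sum _ fun i _ => hf.comp (measurable_fst.prodMk (by fun_prop))
  have h3 : Measurable fun q : 𝒟 × ((Fin n → 𝒳 × 𝒴) × (Fin m → 𝒳)) =>
      ∑ j, fhat q.1 (q.2.2 j) :=
    Finset.measurable_sum _ fun i _ => hf.comp (measurable_fst.prodMk (by fun_prop))
  exact (h1.sub (h2.const_mul _)).add ((h2.add h3).const_mul _)

/-- The joint law of the auxiliary data and the two samples. -/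
lemma map_data_eq {Ω : Type z} [MeasurableSpace Ω] {μ : Measure Ω} [IsProbabilityMeasure μ]
    {XY : Fin n → Ω → 𝒳 × 𝒴} {X' : Fin m → Ω → 𝒳} {D : Ω → 𝒟}
    (hXY : ∀ i, Measurable (XY i)) (hX' : ∀ j, Measurable (X' j)) (hD : Measurable D)
    (hXYP : ∀ i, μ.map (XY i) = P) (hX'P : ∀ j, μ.map (X' j) = P.fst)
    (hiXY : iIndepFun XY μ) (hiX' : iIndepFun X' μ)
    (hi : IndepFun (fun ω i => XY i ω) (fun ω j => X' j ω) μ)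
    (hiD : IndepFun D (fun ω => ((fun i => XY i ω), (fun j => X' j ω))) μ) :
    μ.map (fun ω => (D ω, ((fun i => XY i ω), (fun j => X' j ω))))
      = (μ.map D).prod ((Measure.pi fun _ => P).prod (Measure.pi fun _ => P.fst)) := by
  have mXY : Measurable fun ω i => XY i ω := measurable_pi_lambda _ hXY
  have mX' : Measurable fun ω j => X' j ω := measurable_pi_lambda _ hX'
  rw [(indepFun_iff_map_prod_eq_prod_map_map hD.aemeasurable
      (mXY.prodMk mX').aemeasurable).1 hiD,
    (indepFun_iff_map_prod_eq_prod_map_map mXY.aemeasurable mX'.aemeasurable).1 hi,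
    hiXY.map_fun_eq_pi_map fun i => (hXY i).aemeasurable,
    hiX'.map_fun_eq_pi_map fun j => (hX' j).aemeasurable]
  simp only [hXYP, hX'P]

variable [IsProbabilityMeasure P]

lemma measurable_lintegral_centered_pow (hf : Measurable (Function.uncurry fhat)) (p : ℕ) :
    Measurable fun d => ∫⁻ x, ‖fhat d x - ∫ x', fhat d x' ∂P.fst‖ₑ ^ p ∂P.fst := by
  have h1 : Measurable fun d => ∫ x, fhat d x ∂P.fst :=
    (hf.stronglyMeasurable.integral_prod_right (ν := P.fst)).measurable
  have h2 : Measurable fun q : 𝒟 × 𝒳 => ‖fhat q.1 q.2 - ∫ x', fhat q.1 x' ∂P.fst‖ₑ ^ p :=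
    ((hf.sub (h1.comp measurable_fst)).enorm).pow_const p
  exact h2.lintegral_prod_right'

lemma measurable_Lam [NeZero r] (hf : Measurable (Function.uncurry fhat)) :
    Measurable fun d => Lam n m ℓ P (fhat d) := by
  have h0 : Measurable fun q : 𝒟 × (𝒳 × 𝒴) => fhat q.1 q.2.1 :=
    hf.comp (measurable_fst.prodMk measurable_snd.fst)
  have h1 : Measurable fun d => ∫ p : 𝒳 × 𝒴, fhat d p.1 ∂P :=
    (h0.stronglyMeasurable.integral_prod_right (ν := P)).measurable
  have h2 : Measurable fun q : 𝒟 × (𝒳 × 𝒴) => fhat q.1 q.2.1 - ∫ p : 𝒳 × 𝒴, fhat q.1 p.1 ∂P :=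
    h0.sub (h1.comp measurable_fst)
  have h3 : Measurable (psi1X ℓ P) :=
    (stronglyMeasurable_condExp.mono measurable_fst.comap_le).measurable
  have h4 : Measurable fun d => Var[fun p : 𝒳 × 𝒴 => fhat d p.1; P] :=
    ((h2.enorm.pow_const 2).lintegral_prod_right').ennreal_toReal
  have h5 : Measurable fun d => cov[fun p : 𝒳 × 𝒴 => fhat d p.1, psi1X ℓ P; P] :=
    ((h2.mul ((h3.comp measurable_snd).sub_const _)).stronglyMeasurable.integral_prod_right
      (ν := P)).measurable
  exact ((h4.sub (h5.const_mul 2)).const_mul _).const_add _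

/-- Forgetting the fictitious responses of the unlabeled observations gives the actual law of the
two samples. -/
lemma measurePreserving_split : MeasurePreserving
    (fun e : Fin n ⊕ Fin m → 𝒳 × 𝒴 => (fun i => e (Sum.inl i), fun j => (e (Sum.inr j)).1))
    (Measure.pi fun _ => P) ((Measure.pi fun _ => P).prod (Measure.pi fun _ => P.fst)) := by
  have h1 := measurePreserving_sumPiEquivProdPi (X := fun _ : Fin n ⊕ Fin m => 𝒳 × 𝒴) fun _ => P
  have h2 := measurePreserving_pi (fun _ : Fin m => P) (fun _ => P.fst)
    fun _ => measurePreserving_fst'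
  exact ((MeasurePreserving.id (Measure.pi fun _ : Fin n => P)).prod h2).comp h1

end Trained

end SemiSup

/-! ### Averaging the fixed-function bound over the auxiliary data -/

theorem mainTheorem4 (r : ℕ) [NeZero r] :
    ∃ C : ℝ≥0, 0 < C ∧
      ∀ (𝒳 : Type u) (𝒴 : Type v) (𝒟 : Type w) (Ω : Type z)
        [MeasurableSpace 𝒳] [MeasurableSpace 𝒴] [MeasurableSpace 𝒟] [MeasurableSpace Ω]
        -- the law of the pair, and the kernel
        (P : Measure (𝒳 × 𝒴)) [IsProbabilityMeasure P]
        (ℓ : (Fin r → 𝒴) → ℝ) (_ : Measurable ℓ) (_ : SemiSup.SymmetricKernel ℓ)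
        (_ : MemLp ℓ 2 (SemiSup.lawYs r P))
        (_ : 0 < SemiSup.sigma1Sq ℓ P)
        -- sample sizes
        (n m : ℕ) (_ : r < n)
        -- labeled sample, unlabeled sample, auxiliary data
        (μ : Measure Ω) [IsProbabilityMeasure μ]
        (XY : Fin n → Ω → 𝒳 × 𝒴) (X' : Fin m → Ω → 𝒳) (D : Ω → 𝒟)
        (_ : ∀ i, Measurable (XY i)) (_ : ∀ j, Measurable (X' j)) (_ : Measurable D)
        (_ : ∀ i, μ.map (XY i) = P) (_ : ∀ j, μ.map (X' j) = P.fst)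
        (_ : iIndepFun XY μ) (_ : iIndepFun X' μ)
        (_ : IndepFun (fun ω i => XY i ω) (fun ω j => X' j ω) μ)
        (_ : IndepFun D (fun ω => ((fun i => XY i ω), (fun j => X' j ω))) μ)
        -- the training rule: `fhat (D ω)` is the trained function
        (fhat : 𝒟 → 𝒳 → ℝ) (_ : Measurable (Function.uncurry fhat)),
        ⨆ t : ℝ, ENNReal.ofReal
            |μ.real {ω | √(n : ℝ) *
                  (SemiSup.uSemi ℓ (fhat (D ω)) (fun i => XY i ω) (fun j => X' j ω)
                    - SemiSup.psi ℓ P)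
                  / √(SemiSup.Lam n m ℓ P (fhat (D ω))) ≤ t}
              - cdf (gaussianReal 0 1) t|
          ≤ C *
            ((SemiSup.momentEll1 3 ℓ P + SemiSup.momentF 3 μ (fun ω => fhat (D ω)) P)
                / ENNReal.ofReal (√(n : ℝ) * SemiSup.sigma1 ℓ P ^ 3)
              + (SemiSup.momentEll1 2 ℓ P ^ (1 / 2 : ℝ)
                  + SemiSup.momentF 2 μ (fun ω => fhat (D ω)) P ^ (1 / 2 : ℝ)
                  + ENNReal.ofReal (SemiSup.sigma1 ℓ P))
                * ENNReal.ofReal (SemiSup.sigmaL ℓ P)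
                / ENNReal.ofReal (√((n : ℝ) - r) * SemiSup.sigma1 ℓ P ^ 2)) := by
  refine ⟨(SemiSup.boundConst r).toNNReal, Real.toNNReal_pos.2 (SemiSup.boundConst_pos r), ?_⟩
  intro 𝒳 𝒴 𝒟 Ω _ _ _ _ P _ ℓ hℓ hsym hL hσ n m hn μ _ XY X' D hXY hX' hD hXYP hX'P hiXY hiX' hi
    hiD fhat hf
  refine iSup_le fun t => ?_
  have := Measure.isProbabilityMeasure_map (μ := μ) hD.aemeasurable
  have hfd : ∀ d, Measurable (fhat d) := fun d => hf.comp measurable_prodMk_left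
  set Q := (Measure.pi fun _ : Fin n => P).prod (Measure.pi fun _ : Fin m => P.fst) with hQ
  set S : Set (𝒟 × ((Fin n → 𝒳 × 𝒴) × (Fin m → 𝒳))) :=
    {q | √(n : ℝ) * (SemiSup.uSemi ℓ (fhat q.1) q.2.1 q.2.2 - SemiSup.psi ℓ P)
      / √(SemiSup.Lam n m ℓ P (fhat q.1)) ≤ t} with hS
  have mS : MeasurableSet S := measurableSet_le
    ((((SemiSup.measurable_uSemi hℓ hf).sub_const _).const_mul _).div
      (((SemiSup.measurable_Lam hf).comp measurable_fst).sqrt)) measurable_const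
  have h1 : μ.real {ω | √(n : ℝ) *
      (SemiSup.uSemi ℓ (fhat (D ω)) (fun i => XY i ω) (fun j => X' j ω) - SemiSup.psi ℓ P)
        / √(SemiSup.Lam n m ℓ P (fhat (D ω))) ≤ t} = ((μ.map D).prod Q).real S := by
    rw [← SemiSup.map_data_eq hXY hX' hD hXYP hX'P hiXY hiX' hi hiD,
      map_measureReal_apply (hD.prodMk ((measurable_pi_lambda _ hXY).prodMk
        (measurable_pi_lambda _ hX'))) mS]
    rfl
  have h2 : ∀ d, Q.real (Prod.mk d ⁻¹' S) = (Measure.pi fun _ : Fin n ⊕ Fin m => P).real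
      {e | √(n : ℝ) * (SemiSup.uSemi ℓ (fhat d) (fun i => e (Sum.inl i))
        (fun j => (e (Sum.inr j)).1) - SemiSup.psi ℓ P)
          / √(SemiSup.Lam n m ℓ P (fhat d)) ≤ t} := fun d =>
    (SemiSup.measurePreserving_split.measureReal_preimage
      (measurable_prodMk_left mS).nullMeasurableSet).symm
  have m3 := SemiSup.measurable_lintegral_centered_pow (P := P) hf 3
  have m2 := SemiSup.measurable_lintegral_centered_pow (P := P) hf 2
  rw [h1]
  refine (SemiSup.ofReal_abs_measureReal_prod_sub_le mS _).trans ?_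
  simp only [h2]
  -- The bound for fixed `d` is used for every `d`, including those with infinite conditional
  -- moments, so no exceptional set has to be removed.
  refine (lintegral_mono fun d => SemiSup.ofReal_abs_measureReal_uSemi_sub_stdCDF_le hn hℓ hsym hL
    hσ (hfd d) t).trans ?_
  simp only [div_eq_mul_inv]
  rw [lintegral_const_mul _ (by fun_prop), lintegral_add_left (by fun_prop),
    lintegral_mul_const _ (by fun_prop), lintegral_mul_const _ (by fun_prop),
    lintegral_mul_const _ (by fun_prop), lintegral_add_left (by fun_prop),
    lintegral_add_right _ (by fun_prop), lintegral_add_left (by fun_prop),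
    lintegral_const, lintegral_const, lintegral_const, measure_univ, mul_one, mul_one, mul_one]
  have e : ∀ p, SemiSup.momentF p μ (fun ω => fhat (D ω)) P
      = ∫⁻ d, ∫⁻ x, ‖fhat d x - ∫ x', fhat d x' ∂P.fst‖ₑ ^ p ∂P.fst ∂(μ.map D) := fun p =>
    (lintegral_map (SemiSup.measurable_lintegral_centered_pow hf p) hD).symm
  rw [e, e]
  -- The only term not linear in a conditional moment is the root of the second one; Jensen moves
  -- the mean inside the root.
  have hJ := SemiSup.lintegral_rpow_half_le (ν := μ.map D) m2
  simp only [one_div, one_mul] at hJ ⊢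
  rw [show ENNReal.ofReal (SemiSup.boundConst r) = ((SemiSup.boundConst r).toNNReal : ℝ≥0∞)
    from rfl]
  gcongr
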